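/- Let $2\le k\le n$ be integers, let $\Omega\subset\mathbb R^n$ be a bounded domain, and let $f=f(x,z)>0$ satisfy $f^{1/(k-1)}\in C^{1,1}(\overline\Omega\times\mathbb R)$ (i.e. it is $C^1$ on $\overline\Omega\times\mathbb R$ and its derivative is Lipschitz on $\overline\Omega\times[a,b]$ for all $a<b$). For a function $u$ let $M_u=\{(x,u(x)):x\in\Omega\}$ be its graph, with the induced metric $g_{ij}=\delta_{ij}+u_iu_j$ and the second fundamental form $h_{ij}=u_{ij}/\sqrt{1+|Du|^2}$; let $\kappa[M_u]$ be the vector of principal curvatures (the eigenvalues of $h$ relative to $g$), and $|h|$ the norm of $h$ with respect to $g$. Let $\sigma_m$ be the $m$-th elementary symmetric function on $\mathbb R^n$ and $\Gamma_m=\{\lambda\in\mathbb R^n:\sigma_j(\lambda)>0,\ 1\le j\le m\}$. Let $u\in C^4(\Omega)\cap C^1(\overline\Omega)$ be an admissible solution of the Dirichlet problem $$\sigma_k(\kappa[M_u])=f(x,u)\ \text{ in }\Omega,\qquad u=\varphi\ \text{ on }\partial\Omega,$$ where admissible means that $\kappa[M_u]\in\overline{\Gamma}_k$ at every point. Let $\overline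 u\in C^{1,1}(\overline\Omega)$ satisfy $\overline u>u$ in $\Omega$ and $\overline u=u$ on $\partial\Omega$. If $k<n$, suppose that $\overline u$ is $(k+1)$-convex, i.e. the eigenvalue vector of $D^2\overline u(x)$ lies in $\overline{\Gamma}_{k+1}$ for almost every $x\in\Omega$; if $k=n$, suppose that $\overline u$ is convex (on every convex subset of $\Omega$). Then $$|h|\le\frac{C}{(\overline u-u)^{\alpha}}\quad\text{on } M_u,\qquad \alpha=\max\{3,k-1\},$$ where the constant $C$ depends only on $n$, $k$ and upper bounds for $\operatorname{diam}\Omega$, $\|u\|_{C^1(\overline\Omega)}$, $\|\overline u\|_{C^{1,1}(\overline\Omega)}$ and $\|f^{1/(k-1)}\|_{C^{1,1}(\overline\Omega\times[\inf_{\overline\Omega}u,\,\sup_{\overline\Omega}u])}$. In particular $C$ does not depend on a positive lower bound for $f$. -/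

import Mathlib

open scoped ENNReal NNReal

noncomputable section

namespace KCurvature

section FunctionSpaces

variable {V : Type*} [NormedAddCommGroup V] [NormedSpace ℝ V]

/-- `g ∈ C¹(U) ∩ C¹(closure U)` for an open set `U`: `g` is continuously differentiable in `U`,
and `g` and its derivative extend continuously to the closure of `U`. -/
def IsC1UpToBoundary (U : Set V) (g : V → ℝ) : Prop :=
  ContDiffOn ℝ 1 g U ∧ ContinuousOn g (closure U) ∧
    ∃ G : V → (V →L[ℝ] ℝ), ContinuousOn G (closure U) ∧ ∀ x ∈ U, G x = fderiv ℝ g x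

/-- The `C¹` norm `sup |g| + sup |Dg|` over `S`, with values in `[0, ∞]`. -/
def c1Norm (S : Set V) (g : V → ℝ) : ℝ≥0∞ :=
  (⨆ x ∈ S, ‖g x‖ₑ) + ⨆ x ∈ S, ‖fderiv ℝ g x‖ₑ

/-- The `C^{1,1}` norm over `S`: the `C¹` norm plus the best Lipschitz constant of `Dg` on `S`
(the pairs `x = y` contribute `0 / 0 = 0`). -/
def c11Norm (S : Set V) (g : V → ℝ) : ℝ≥0∞ :=
  c1Norm S g + ⨆ x ∈ S, ⨆ y ∈ S, ‖fderiv ℝ g x - fderiv ℝ g y‖ₑ / edist x y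

end FunctionSpaces

section Garding

variable {n : ℕ}

/-- The `m`-th elementary symmetric function of `κ`. -/
def sigma (m : ℕ) (κ : Fin n → ℝ) : ℝ :=
  ∑ s ∈ Finset.powersetCard m Finset.univ, ∏ i ∈ s, κ i

/-- Gårding's cone `Γ_k`. -/
def gardingCone (n k : ℕ) : Set (Fin n → ℝ) :=
  {κ | ∀ m : ℕ, 1 ≤ m → m ≤ k → 0 < sigma m κ}

open Classical in
/-- The eigenvalues, with multiplicity, of a real symmetric matrix (`0` if `A` is not symmetric;
this does not occur for the Hessian of a function that is differentiable in a neighbourhood). -/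
def eigenvalueVec (A : Matrix (Fin n) (Fin n) ℝ) : Fin n → ℝ :=
  if hA : A.IsHermitian then hA.eigenvalues else 0

end Garding

section Graph

variable {n : ℕ}

/-- The partial derivatives `u_i (x)`. -/
def grad (u : EuclideanSpace ℝ (Fin n) → ℝ) (x : EuclideanSpace ℝ (Fin n)) : Fin n → ℝ :=
  fun i => fderiv ℝ u x (EuclideanSpace.single i 1)

/-- The Hessian matrix `u_{ij} (x)`. -/
def hess (u : EuclideanSpace ℝ (Fin n) → ℝ) (x : EuclideanSpace ℝ (Fin n)) :
    Matrix (Fin n) (Fin n) ℝ :=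
  Matrix.of fun i j =>
    fderiv ℝ (fderiv ℝ u) x (EuclideanSpace.single i 1) (EuclideanSpace.single j 1)

/-- `w = √(1 + |Du|²)`. -/
def slope (u : EuclideanSpace ℝ (Fin n) → ℝ) (x : EuclideanSpace ℝ (Fin n)) : ℝ :=
  √(1 + ∑ i, grad u x i ^ 2)

/-- The second fundamental form `h_{ij} = u_{ij} / w` of the graph of `u` with respect to the
upward unit normal, in the coordinate frame `(ε_i, u_i)`. -/
def secondFundForm (u : EuclideanSpace ℝ (Fin n) → ℝ) (x : EuclideanSpace ℝ (Fin n)) :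
    Matrix (Fin n) (Fin n) ℝ :=
  (slope u x)⁻¹ • hess u x

/-- `γ^{ij} = δ_{ij} - u_i u_j / (w (1 + w))`: the positive square root of the inverse of the
induced metric `g_{ij} = δ_{ij} + u_i u_j`. -/
def invSqrtMetric (u : EuclideanSpace ℝ (Fin n) → ℝ) (x : EuclideanSpace ℝ (Fin n)) :
    Matrix (Fin n) (Fin n) ℝ :=
  1 - (slope u x * (1 + slope u x))⁻¹ • Matrix.vecMulVec (grad u x) (grad u x)

/-- The second fundamental form `γ h γ` in the orthonormal frame
`e_i = ∑ j, γ^{ij} (ε_j + u_j ε_{n+1})` of the graph. -/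
def curvatureMatrix (u : EuclideanSpace ℝ (Fin n) → ℝ) (x : EuclideanSpace ℝ (Fin n)) :
    Matrix (Fin n) (Fin n) ℝ :=
  invSqrtMetric u x * secondFundForm u x * invSqrtMetric u x

/-- The principal curvatures of the graph of `u` at `(x, u x)`. -/
def principalCurvatures (u : EuclideanSpace ℝ (Fin n) → ℝ) (x : EuclideanSpace ℝ (Fin n)) :
    Fin n → ℝ :=
  eigenvalueVec (curvatureMatrix u x)

/-- The norm `|h|` of the second fundamental form of the graph with respect to the induced
metric, at `(x, u x)`. -/
def secondFundFormNorm (u : EuclideanSpace ℝ (Fin n) → ℝ) (x : EuclideanSpace ℝ (Fin n)) : ℝ :=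
  √(∑ i, ∑ j, curvatureMatrix u x i j ^ 2)

/-- `u` is admissible in `Ω`: it is `C²` and the principal curvatures of its graph lie in the
closed cone. -/
def IsAdmissible (k : ℕ) (Ω : Set (EuclideanSpace ℝ (Fin n)))
    (u : EuclideanSpace ℝ (Fin n) → ℝ) : Prop :=
  ContDiffOn ℝ 2 u Ω ∧ ∀ x ∈ Ω, principalCurvatures u x ∈ closure (gardingCone n k)

/-- `m`-convexity of a `C^{1,1}` function: the eigenvalues of its Hessian, which exists almost
everywhere, lie in the closed cone almost everywhere. -/
def IsMConvex (m : ℕ) (Ω : Set (EuclideanSpace ℝ (Fin n)))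
    (v : EuclideanSpace ℝ (Fin n) → ℝ) : Prop :=
  ∀ᵐ x ∂(MeasureTheory.volume.restrict Ω), eigenvalueVec (hess v x) ∈ closure (gardingCone n m)

/-- Convexity of a function on a domain that need not be convex: it is convex on every convex
subset. If `Ω` is convex, this is `ConvexOn ℝ Ω v`. -/
def IsConvexIn (Ω : Set (EuclideanSpace ℝ (Fin n)))
    (v : EuclideanSpace ℝ (Fin n) → ℝ) : Prop :=
  ∀ s ⊆ Ω, Convex ℝ s → ConvexOn ℝ s v

/-- The function `f^{1/(k-1)}` of `(x, z)`. -/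
def rootFun (k : ℕ) (f : EuclideanSpace ℝ (Fin n) → ℝ → ℝ) :
    EuclideanSpace ℝ (Fin n) × ℝ → ℝ :=
  fun p => f p.1 p.2 ^ (1 / ((k : ℝ) - 1))

/-- The closed interval `[inf u, sup u]`, over the closure of `Ω`. -/
def rangeInterval (Ω : Set (EuclideanSpace ℝ (Fin n)))
    (u : EuclideanSpace ℝ (Fin n) → ℝ) : Set ℝ :=
  Set.Icc (sInf (u '' closure Ω)) (sSup (u '' closure Ω))

end Graph

end KCurvature

end

/-! Let `ν = 1 / slope`, let `X` be the position vector from a base point at height zero, and put `η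
= v - u`, with `v` mollified and lowered slightly. The product of the weight `η ^ β * exp (A |X|² /
2) / (ν - a)` and the normal curvature is maximised over base points and tangent directions. If
`κ_o` is the largest curvature at the maximum, the aim is a bound for `κ_o * η`. The weight is
comparable to `η ^ β`, so this bound gives the estimate at every other point. Only `β ≥ 3` enters.

In the lemmas the order of the curvature equation is `k + 2`, with `σ_{k+2} = G ^ (k + 1)`, so `G`
is the root of `f` assumed `C^{1,1}`. Let `F_i = ∂σ_{k+2} / ∂κ_i`. Contracting the second-order
conditions at the maximum with `F_i` and inserting the equation differentiated twice leaves these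
terms.

The commutation of derivatives produces the good term `κ_o * (k + 2) * f`. The weight `1 / (ν - a)`
produces `a * ∑ F_i κ_i²`, and the exponential produces `A * ∑ F_i`. The barrier term `∑ F_i
D²v(b_i, b_i)` is nonnegative by Gårding's inequality: extend `D²v` by zero to `ℝ^{n+1}` and
restrict it to the tangent hyperplane, which costs one order of convexity
(`IsFrame.sum_mul_nonneg`). For `k = n` convexity gives this directly.

Third derivatives: the critical equation expresses `T_i / κ_o` through `η' / η`, `X` and `κ_i`. The
resulting negative squares are absorbed by `a F_i κ_i²` and by the off-diagonal part of the second
derivative of `σ_{k+2}`. The latter suffices for `β ≥ 3` when `F_i` is large compared with `F_o`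
(`third_order_nonneg`).

Degeneracy of `f`: the concavity of `(σ_{k+2} / σ_1) ^ (1 / (k + 1))` (`InCone.concavity`) cancels
all but one multiple of `(G' / G)²` from the differentiated equation (`sum_fourth_ge`). What remains
is `G ^ k * G'² / G`. A positive function with bounded second derivative satisfies `G'² ≤ C * G`
away from the boundary of its domain. Here the second derivative is of size `κ_o`, because
maximality controls the curvature on a whole ball around the maximum point; hence `G'² ≤ C κ_o G`
(`sq_fderiv_le_of_pos`). All error terms are thus multiples of `G ^ k`. They are dominated by `A * ∑
F_i`, since Newton's inequalities give `∑ F_i ≥ G ^ k * κ_o ^ (1 / (k + 1))`. No lower bound of `f`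
is used.

To avoid covariant derivatives the graph is rewritten near the maximum point as a graph over its
tangent plane, and every quantity is expanded to second order along the coordinate axes (`HasJet`).
-/

namespace KCurvature

open Finset Polynomial

/-! ### Elementary symmetric functions and their generating polynomial -/

section ElementarySymmetric

variable {ι : Type*} [DecidableEq ι]

/-- The `m`-th elementary symmetric function of the numbers `κ i`, `i ∈ s`. -/
noncomputable def es (s : Finset ι) (m : ℕ) (κ : ι → ℝ) : ℝ :=
  ∑ t ∈ powersetCard m s, ∏ i ∈ t, κ i

omit [DecidableEq ι] in
@[simp] lemma es_zero (s : Finset ι) (κ : ι → ℝ) : es s 0 κ = 1 := by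
  simp [es]

omit [DecidableEq ι] in
lemma es_one (s : Finset ι) (κ : ι → ℝ) : es s 1 κ = ∑ i ∈ s, κ i := by
  simp [es, powersetCard_one]

lemma es_insert {s : Finset ι} {i : ι} (hi : i ∉ s) (m : ℕ) (κ : ι → ℝ) :
    es (insert i s) (m + 1) κ = es s (m + 1) κ + κ i * es s m κ := by
  unfold es
  rw [powersetCard_succ_insert hi, sum_union, sum_image, mul_sum]
  · congr 1
    refine sum_congr rfl fun t ht => ?_
    rw [prod_insert fun h => hi ((mem_powersetCard.1 ht).1 h)]
  · intro a ha b hb hab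
    have hia : i ∉ a := fun h => hi ((mem_powersetCard.1 ha).1 h)
    have hib : i ∉ b := fun h => hi ((mem_powersetCard.1 hb).1 h)
    have := congrArg (fun t => t.erase i) hab
    simpa [erase_insert hia, erase_insert hib] using this
  · rw [disjoint_left]
    intro t ht ht'
    obtain ⟨r, -, rfl⟩ := mem_image.1 ht'
    exact hi ((mem_powersetCard.1 ht).1 (mem_insert_self _ _))

lemma es_erase {s : Finset ι} {i : ι} (hi : i ∈ s) (m : ℕ) (κ : ι → ℝ) :
    es s (m + 1) κ = es (s.erase i) (m + 1) κ + κ i * es (s.erase i) m κ := by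
  conv_lhs => rw [← insert_erase hi]
  exact es_insert (notMem_erase i s) m κ

omit [DecidableEq ι] in
lemma es_eq_zero_of_card_lt {s : Finset ι} {m : ℕ} (h : s.card < m) (κ : ι → ℝ) :
    es s m κ = 0 := by
  simp [es, powersetCard_eq_empty.2 h]

/-- The generating polynomial of the elementary symmetric functions. -/
noncomputable def esPoly (s : Finset ι) (κ : ι → ℝ) : ℝ[X] := ∏ i ∈ s, (1 + C (κ i) * X)

lemma coeff_esPoly (s : Finset ι) (κ : ι → ℝ) (m : ℕ) : (esPoly s κ).coeff m = es s m κ := by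
  induction s using Finset.induction_on generalizing m with
  | empty =>
    cases m with
    | zero => simp [esPoly]
    | succ m => rw [es_eq_zero_of_card_lt (by simp)]; simp [esPoly, coeff_one]
  | insert i s hi ih =>
    rw [esPoly, prod_insert hi, ← esPoly, add_mul, one_mul, mul_assoc, coeff_add, coeff_C_mul]
    cases m with
    | zero => simp [ih]
    | succ m => rw [coeff_X_mul, ih, ih, es_insert hi]

omit [DecidableEq ι] in
lemma natDegree_esPoly_le (s : Finset ι) (κ : ι → ℝ) : (esPoly s κ).natDegree ≤ s.card := by
  refine (natDegree_prod_le _ _).trans ?_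
  refine (sum_le_sum (g := fun _ => 1) fun i _ => ?_).trans (by simp)
  compute_degree

end ElementarySymmetric

/-! ### Newton's inequalities from real-rootedness -/

section Newton

/-- Rolle's theorem with multiplicities: differentiation loses at most one real root and lowers the
degree by one. -/
lemma splits_derivative {p : ℝ[X]} (hp : p.Splits) : (derivative p).Splits := by
  rcases eq_or_ne (natDegree p) 0 with h0 | h0
  · rw [eq_C_of_natDegree_eq_zero h0]; simp
  rw [splits_iff_card_roots] at hp ⊢
  have h1 := card_roots_le_derivative p
  have h2 := card_roots' (derivative p)
  have h3 : (derivative p).natDegree = p.natDegree - 1 := natDegree_derivative p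
  omega

/-- This is `(log |p|)'' = -∑ (x - a)⁻² ≤ 0` multiplied by `p²`, which makes sense at roots as well;
hence the induction over linear factors. -/
lemma laguerre_of_splits {p : ℝ[X]} (hp : p.Splits) (x : ℝ) :
    p.eval x * (derivative (derivative p)).eval x ≤ (derivative p).eval x ^ 2 := by
  rw [hp.eq_prod_roots]
  generalize p.roots = s
  have key : ∀ s : Multiset ℝ, (s.map (X - C ·)).prod.eval x *
      (derivative (derivative (s.map (X - C ·)).prod)).eval x ≤
      (derivative (s.map (X - C ·)).prod).eval x ^ 2 := by
    intro s
    induction s using Multiset.induction_on with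
    | empty => simp
    | cons a s ih =>
      simp only [Multiset.map_cons, Multiset.prod_cons, derivative_mul, derivative_sub,
        derivative_X, derivative_C, eval_add, eval_mul, eval_sub, eval_X, eval_C, sub_zero,
        one_mul, derivative_add]
      nlinarith [mul_le_mul_of_nonneg_left ih (sq_nonneg (x - a)),
        sq_nonneg ((s.map (X - C ·)).prod.eval x)]
  have := mul_le_mul_of_nonneg_left (key s) (sq_nonneg p.leadingCoeff)
  simp only [derivative_mul, derivative_C, zero_mul, zero_add, eval_mul, eval_C]
  nlinarith

/-- Newton's inequality, without the binomial factors. -/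
lemma es_mul_es_le_sq {ι : Type*} [DecidableEq ι] (s : Finset ι) (κ : ι → ℝ) (m : ℕ) :
    es s m κ * es s (m + 2) κ ≤ es s (m + 1) κ ^ 2 := by
  have h0 : (esPoly s κ).Splits := by
    unfold esPoly
    refine Splits.prod fun i _ => ?_
    refine Splits.of_natDegree_le_one ?_
    compute_degree
  have h1 : ∀ m : ℕ, (derivative^[m] (esPoly s κ)).Splits := by
    intro m
    induction m with
    | zero => simpa
    | succ m ih => rw [Function.iterate_succ_apply']; exact splits_derivative ih
  -- The `m`-th derivative of the generating polynomial at `0` is `m!` times the `m`-th symmetric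
  -- function, so Laguerre's inequality at `0` gives Newton's inequality with the factor `(m + 2) /
  -- (m + 1)`, which is discarded below.
  have h2 := laguerre_of_splits (h1 m) 0
  rw [← Function.iterate_succ_apply' derivative, ← Function.iterate_succ_apply' derivative] at h2
  simp only [← coeff_zero_eq_eval_zero, coeff_iterate_derivative, zero_add,
    Nat.descFactorial_self, coeff_esPoly, nsmul_eq_mul] at h2
  have hm : (0 : ℝ) < m.factorial := by positivity
  simp only [Nat.succ_eq_add_one, Nat.factorial_succ] at h2
  push_cast at h2
  have hm' : (0 : ℝ) ≤ m := by positivity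
  have h3 : (m.factorial : ℝ) ^ 2 * (m + 1) * ((m + 1) * es s (m + 1) κ ^ 2 -
      (m + 2) * (es s m κ * es s (m + 2) κ)) ≥ 0 := by
    have e : m + 1 + 1 = m + 2 := rfl
    rw [e] at h2
    nlinarith
  have h4 : 0 ≤ (m + 1) * es s (m + 1) κ ^ 2 - (m + 2) * (es s m κ * es s (m + 2) κ) := by
    by_contra hc
    push Not at hc
    have : (m.factorial : ℝ) ^ 2 * (m + 1) * ((m + 1) * es s (m + 1) κ ^ 2 -
      (m + 2) * (es s m κ * es s (m + 2) κ)) < 0 := mul_neg_of_pos_of_neg (by positivity) hc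
    linarith
  by_contra hc
  push Not at hc
  have : 0 ≤ es s (m + 1) κ ^ 2 := sq_nonneg _
  nlinarith [mul_lt_mul_of_pos_left hc (show (0 : ℝ) < m + 1 by positivity)]

end Newton

/-! ### Gårding's cone and the Marcus–Lopes inequality -/

section Cone

variable {ι : Type*} [DecidableEq ι]

/-- Gårding's cone for the variables indexed by `s`. -/
def InCone (s : Finset ι) (k : ℕ) (κ : ι → ℝ) : Prop := ∀ m ≤ k, 0 < es s m κ

omit [DecidableEq ι] in
lemma InCone.mono {s : Finset ι} {k l : ℕ} {κ : ι → ℝ} (h : InCone s k κ) (hl : l ≤ k) :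
    InCone s l κ := fun m hm => h m (hm.trans hl)

/-- With `x, y, z` three consecutive symmetric functions without `κ i`: if `x > 0 ≥ y`, then `y + κ
i * x > 0` and `z + κ i * y > 0` combine to `x * z > y²`, against Newton. -/
lemma InCone.erase {s : Finset ι} {k : ℕ} {κ : ι → ℝ} (h : InCone s (k + 1) κ) {i : ι}
    (hi : i ∈ s) : InCone (s.erase i) k κ := by
  intro m hm
  induction m with
  | zero => simp
  | succ m ih =>
    have ihm := ih (by omega)
    have a := h (m + 1) (by omega)
    have b := h (m + 2) (by omega)
    rw [es_erase hi] at a b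
    have N := es_mul_es_le_sq (s.erase i) κ m
    by_contra hc
    push Not at hc
    set x := es (s.erase i) m κ
    set y := es (s.erase i) (m + 1) κ
    set z := es (s.erase i) (m + 2) κ
    nlinarith [mul_nonneg (neg_nonneg.2 hc) a.le, mul_pos ihm b]

lemma sum_mul_es_erase (s : Finset ι) (k : ℕ) (κ : ι → ℝ) :
    ∑ i ∈ s, κ i * es (s.erase i) k κ = (k + 1) * es s (k + 1) κ := by
  induction s using Finset.induction_on generalizing k with
  | empty => rw [es_eq_zero_of_card_lt (by simp)]; simp
  | insert a s ha ih =>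
    rw [sum_insert ha, erase_insert ha, es_insert ha]
    have : ∀ i ∈ s, (insert a s).erase i = insert a (s.erase i) := fun i hi =>
      erase_insert_of_ne (fun h => ha (h ▸ hi))
    cases k with
    | zero =>
      simp only [es_zero, mul_one, es_one, CharP.cast_eq_zero, zero_add, one_mul]
      ring
    | succ k =>
      have e : ∑ i ∈ s, κ i * es ((insert a s).erase i) (k + 1) κ =
          ∑ i ∈ s, κ i * es (s.erase i) (k + 1) κ +
            κ a * ∑ i ∈ s, κ i * es (s.erase i) k κ := by
        rw [mul_sum, ← sum_add_distrib]
        refine sum_congr rfl fun i hi => ?_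
        rw [this i hi, es_insert (fun h => ha (mem_of_mem_erase h))]
        ring
      rw [e, ih, ih]
      push_cast
      ring

lemma sum_es_erase (s : Finset ι) (k : ℕ) (κ : ι → ℝ) :
    ∑ i ∈ s, es (s.erase i) k κ = (s.card - k) * es s k κ := by
  cases k with
  | zero => simp
  | succ k =>
    have : ∀ i ∈ s, es (s.erase i) (k + 1) κ = es s (k + 1) κ - κ i * es (s.erase i) k κ :=
      fun i hi => by rw [es_erase hi]; ring
    rw [sum_congr rfl this, sum_sub_distrib, sum_mul_es_erase, sum_const, nsmul_eq_mul]
    push_cast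
    ring

/-- Euler's identity arranged so that the quotient of order `j + 1` depends on each `x i` and on the
quotients of order `j` without `x i` only through `x² / s`. Superadditivity can then be passed from
one order to the next. -/
lemma quotient_identity {s : Finset ι} {j : ℕ} {x : ι → ℝ} (h : InCone s (j + 1) x)
    (hd : ∀ i ∈ s, 0 < es (s.erase i) j x) :
    (j + 2) * (es s (j + 2) x / es s (j + 1) x) =
      ∑ i ∈ s, (x i - x i ^ 2 / (x i + es (s.erase i) (j + 1) x / es (s.erase i) j x)) := by
  have h1 := h (j + 1) le_rfl
  have e := sum_mul_es_erase s (j + 1) x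
  push_cast at e
  have e' : ((j : ℝ) + 1 + 1) = j + 2 := by ring
  rw [e'] at e
  rw [← mul_div_assoc, ← e, sum_div]
  refine sum_congr rfl fun i hi => ?_
  have hp := hd i hi
  have hs := es_erase hi j x
  rw [hs] at h1 ⊢
  have : x i + es (s.erase i) (j + 1) x / es (s.erase i) j x ≠ 0 := by
    have : x i + es (s.erase i) (j + 1) x / es (s.erase i) j x =
        (es (s.erase i) (j + 1) x + x i * es (s.erase i) j x) / es (s.erase i) j x := by
      field_simp; ring
    rw [this]; positivity
  have h2 : x i * es (s.erase i) j x + es (s.erase i) (j + 1) x ≠ 0 := by linarith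
  field_simp
  ring

/-- The function `x² / s` is convex and homogeneous of degree one, hence subadditive, and it
decreases in `s`. -/
lemma sq_div_add_le {x y s t r : ℝ} (hs : 0 < s) (ht : 0 < t) (hr : s + t ≤ r) :
    (x + y) ^ 2 / r ≤ x ^ 2 / s + y ^ 2 / t := by
  have h1 : (x + y) ^ 2 / r ≤ (x + y) ^ 2 / (s + t) :=
    div_le_div_of_nonneg_left (sq_nonneg _) (by linarith) hr
  refine h1.trans ?_
  rw [div_add_div _ _ hs.ne' ht.ne', div_le_div_iff₀ (by positivity) (by positivity)]
  nlinarith [sq_nonneg (x * t - y * s), mul_pos hs ht]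

/-- Marcus–Lopes: Gårding's cone is closed under addition, and `σ_{j+1} / σ_j` is
superadditive on it. -/
lemma InCone.add_and_quotient (j : ℕ) (s : Finset ι) {x y : ι → ℝ} (hx : InCone s (j + 1) x)
    (hy : InCone s (j + 1) y) :
    InCone s (j + 1) (x + y) ∧
      es s (j + 1) x / es s j x + es s (j + 1) y / es s j y ≤
        es s (j + 1) (x + y) / es s j (x + y) := by
  induction j generalizing s with
  | zero =>
    have e : es s 1 (x + y) = es s 1 x + es s 1 y := by simp [es_one, sum_add_distrib]
    constructor
    · intro m hm
      interval_cases m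
      · simp
      · rw [e]; exact add_pos (hx 1 le_rfl) (hy 1 le_rfl)
    · simp [e]
  | succ j ih =>
    have hx1 : InCone s (j + 1) x := hx.mono (by omega)
    have hy1 : InCone s (j + 1) y := hy.mono (by omega)
    obtain ⟨hs, -⟩ := ih s hx1 hy1
    have hxe := fun i (hi : i ∈ s) => hx.erase hi
    have hye := fun i (hi : i ∈ s) => hy.erase hi
    have hse := fun i (hi : i ∈ s) => ih (s.erase i) (hxe i hi) (hye i hi)
    have ix := quotient_identity hx1 fun i hi => hxe i hi j (by omega)
    have iy := quotient_identity hy1 fun i hi => hye i hi j (by omega)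
    have is := quotient_identity hs fun i hi => (hse i hi).1 j (by omega)
    -- Each summand of `quotient_identity` is superadditive: its denominator is superadditive by the
    -- induction hypothesis on `s.erase i`, and `sq_div_add_le` does the rest.
    have key : es s (j + 2) x / es s (j + 1) x + es s (j + 2) y / es s (j + 1) y ≤
        es s (j + 2) (x + y) / es s (j + 1) (x + y) := by
      have hj : (0 : ℝ) < j + 2 := by positivity
      refine le_of_mul_le_mul_left ?_ hj
      rw [mul_add, ix, iy, is, ← sum_add_distrib]
      refine sum_le_sum fun i hi => ?_
      have pos : ∀ {z : ι → ℝ}, InCone s (j + 2) z → InCone (s.erase i) (j + 1) z →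
          0 < z i + es (s.erase i) (j + 1) z / es (s.erase i) j z := by
        intro z hz hze
        have h1 := hz (j + 1) (by omega)
        rw [es_erase hi] at h1
        have h2 := hze j (by omega)
        have : z i + es (s.erase i) (j + 1) z / es (s.erase i) j z =
          (es (s.erase i) (j + 1) z + z i * es (s.erase i) j z) / es (s.erase i) j z := by
          field_simp; ring
        rw [this]; positivity
      have := sq_div_add_le (x := x i) (y := y i) (pos hx (hxe i hi)) (pos hy (hye i hi))
        (r := (x + y) i + es (s.erase i) (j + 1) (x + y) / es (s.erase i) j (x + y))
        (by have := (hse i hi).2; simp only [Pi.add_apply]; linarith)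
      simp only [Pi.add_apply] at this ⊢
      linarith
    refine ⟨fun m hm => ?_, key⟩
    rcases Nat.lt_or_ge m (j + 2) with h | h
    · exact hs m (by omega)
    · obtain rfl : m = j + 2 := by omega
      have h1 : 0 < es s (j + 2) x / es s (j + 1) x :=
        div_pos (hx _ (by omega)) (hx _ (by omega))
      have h2 : 0 < es s (j + 2) y / es s (j + 1) y :=
        div_pos (hy _ (by omega)) (hy _ (by omega))
      have h3 : 0 < es s (j + 2) (x + y) / es s (j + 1) (x + y) := by linarith
      have h4 := hs (j + 1) le_rfl
      have := mul_pos h3 h4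
      rwa [div_mul_cancel₀ _ h4.ne'] at this

end Cone

end KCurvature

namespace KCurvature

open Finset Filter Topology

/-! ### Calculus of second-order expansions at a point -/

section Jets

/-- `f` is twice differentiable at `0`, with value `a`, derivative `b` and second derivative `c`. -/
def HasJet (f : ℝ → ℝ) (a b c : ℝ) : Prop :=
  ∃ f' : ℝ → ℝ, (∀ᶠ t in 𝓝 0, HasDerivAt f (f' t) t) ∧ HasDerivAt f' c 0 ∧ f 0 = a ∧ f' 0 = b

namespace HasJet

variable {f g : ℝ → ℝ} {a b c a' b' c' : ℝ}

lemma val (h : HasJet f a b c) : f 0 = a := h.choose_spec.2.2.1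

lemma hasDerivAt (h : HasJet f a b c) : HasDerivAt f b 0 := by
  obtain ⟨f', h1, -, -, h4⟩ := h
  exact h4 ▸ h1.self_of_nhds

lemma continuousAt (h : HasJet f a b c) : ContinuousAt f 0 := h.hasDerivAt.continuousAt

lemma congr (h : HasJet f a b c) (hfg : g =ᶠ[𝓝 0] f) : HasJet g a b c := by
  obtain ⟨f', h1, h2, h3, h4⟩ := h
  refine ⟨f', ?_, h2, hfg.self_of_nhds.trans h3, h4⟩
  filter_upwards [h1, hfg.eventuallyEq_nhds] with t ht hg using ht.congr_of_eventuallyEq hg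

lemma congr_val (h : HasJet f a b c) (ha : a' = a) (hb : b' = b) (hc : c' = c) :
    HasJet f a' b' c' := by subst ha hb hc; exact h

lemma unique (h : HasJet f a b c) (h' : HasJet f a' b' c') : a = a' ∧ b = b' ∧ c = c' := by
  refine ⟨h.val.symm.trans h'.val, h.hasDerivAt.unique h'.hasDerivAt, ?_⟩
  obtain ⟨f', h1, h2, -, -⟩ := h
  obtain ⟨g', g1, g2, -, -⟩ := h'
  have : f' =ᶠ[𝓝 0] g' := by filter_upwards [h1, g1] with t ht ht' using ht.unique ht'
  exact (h2.congr_of_eventuallyEq this.symm).unique g2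

lemma const (a : ℝ) : HasJet (fun _ => a) a 0 0 :=
  ⟨fun _ => 0, .of_forall fun t => hasDerivAt_const t a, hasDerivAt_const 0 0, rfl, rfl⟩

lemma add (hf : HasJet f a b c) (hg : HasJet g a' b' c') :
    HasJet (fun t => f t + g t) (a + a') (b + b') (c + c') := by
  obtain ⟨f', h1, h2, h3, h4⟩ := hf
  obtain ⟨g', g1, g2, g3, g4⟩ := hg
  refine ⟨fun t => f' t + g' t, ?_, h2.add g2, by simp [h3, g3], by simp [h4, g4]⟩
  filter_upwards [h1, g1] with t ht ht' using ht.add ht'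

lemma mul (hf : HasJet f a b c) (hg : HasJet g a' b' c') :
    HasJet (fun t => f t * g t) (a * a') (b * a' + a * b') (c * a' + 2 * (b * b') + a * c') := by
  obtain ⟨f', h1, h2, h3, h4⟩ := hf
  obtain ⟨g', g1, g2, g3, g4⟩ := hg
  refine ⟨fun t => f' t * g t + f t * g' t, ?_, ?_, by simp [h3, g3], by simp [h3, h4, g3, g4]⟩
  · filter_upwards [h1, g1] with t ht ht' using ht.mul ht'
  · refine ((h2.mul g1.self_of_nhds).add (h1.self_of_nhds.mul g2)).congr_deriv ?_
    rw [h3, h4, g3, g4]; ring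

lemma const_mul (r : ℝ) (hf : HasJet f a b c) :
    HasJet (fun t => r * f t) (r * a) (r * b) (r * c) :=
  ((const r).mul hf).congr_val rfl (by ring) (by ring)

lemma neg (hf : HasJet f a b c) : HasJet (fun t => - f t) (-a) (-b) (-c) :=
  ((hf.const_mul (-1)).congr (.of_forall fun t => by ring)).congr_val
    (by ring) (by ring) (by ring)

lemma sub (hf : HasJet f a b c) (hg : HasJet g a' b' c') :
    HasJet (fun t => f t - g t) (a - a') (b - b') (c - c') :=
  ((hf.add hg.neg).congr (.of_forall fun t => by ring)).congr_val
    (by ring) (by ring) (by ring)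

lemma sum {ι : Type*} (s : Finset ι) {f : ι → ℝ → ℝ} {a b c : ι → ℝ}
    (h : ∀ i ∈ s, HasJet (f i) (a i) (b i) (c i)) :
    HasJet (fun t => ∑ i ∈ s, f i t) (∑ i ∈ s, a i) (∑ i ∈ s, b i) (∑ i ∈ s, c i) := by
  classical
  induction s using Finset.induction_on with
  | empty => simpa using const 0
  | insert i s hi ih =>
    simp only [sum_insert hi]
    exact (h i (mem_insert_self i s)).add (ih fun j hj => h j (mem_insert_of_mem hj))

lemma sq (hf : HasJet f a b c) :
    HasJet (fun t => f t ^ 2) (a ^ 2) (2 * (a * b)) (2 * (b ^ 2 + a * c)) :=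
  ((hf.mul hf).congr (.of_forall fun t => by ring)).congr_val (by ring) (by ring) (by ring)

lemma comp {φ φ' : ℝ → ℝ} {φ'' : ℝ} (h1 : ∀ᶠ x in 𝓝 a, HasDerivAt φ (φ' x) x)
    (h2 : HasDerivAt φ' φ'' a) (hf : HasJet f a b c) :
    HasJet (fun t => φ (f t)) (φ a) (φ' a * b) (φ'' * b ^ 2 + φ' a * c) := by
  have hc := hf.continuousAt
  have hv := hf.val
  obtain ⟨f', f1, f2, f3, f4⟩ := hf
  refine ⟨fun t => φ' (f t) * f' t, ?_, ?_, by simp [f3], by simp [f3, f4]⟩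
  · rw [ContinuousAt, hv] at hc
    filter_upwards [f1, hc.eventually h1] with t ht ht' using ht'.comp t ht
  · rw [← hv] at h2
    refine ((h2.comp 0 f1.self_of_nhds).mul f2).congr_deriv ?_
    simp only [Function.comp_apply, f3, f4]; ring

lemma log (hf : HasJet f a b c) (ha : a ≠ 0) :
    HasJet (fun t => Real.log (f t)) (Real.log a) (b / a) (c / a - (b / a) ^ 2) := by
  refine (comp (φ := Real.log) (φ' := fun x => x⁻¹) (φ'' := -(a ^ 2)⁻¹) ?_
    (hasDerivAt_inv ha) hf).congr_val rfl (by ring) (by ring)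
  filter_upwards [isOpen_ne.mem_nhds ha] with x hx using Real.hasDerivAt_log hx

lemma exp (hf : HasJet f a b c) :
    HasJet (fun t => Real.exp (f t)) (Real.exp a) (Real.exp a * b)
      (Real.exp a * (b ^ 2 + c)) :=
  (comp (φ := Real.exp) (φ' := Real.exp) (φ'' := Real.exp a)
    (.of_forall fun x => Real.hasDerivAt_exp x) (Real.hasDerivAt_exp a) hf).congr_val
    rfl rfl (by ring)

lemma inv (hf : HasJet f a b c) (ha : a ≠ 0) :
    HasJet (fun t => (f t)⁻¹) a⁻¹ (-b / a ^ 2) (2 * b ^ 2 / a ^ 3 - c / a ^ 2) := by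
  refine (comp (φ := fun x => x⁻¹) (φ' := fun x => -(x ^ 2)⁻¹) (φ'' := 2 / a ^ 3) ?_ ?_
    hf).congr_val rfl (by ring) (by ring)
  · filter_upwards [isOpen_ne.mem_nhds ha] with x hx using hasDerivAt_inv hx
  · refine (((hasDerivAt_pow 2 a).fun_inv (pow_ne_zero 2 ha)).fun_neg).congr_deriv ?_
    field_simp; norm_num; ring

lemma sqrt (hf : HasJet f a b c) (ha : 0 < a) :
    HasJet (fun t => √(f t)) (√a) (b / (2 * √a)) (c / (2 * √a) - b ^ 2 / (4 * √a ^ 3)) := by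
  have hs : √a ≠ 0 := (Real.sqrt_pos.2 ha).ne'
  refine (comp (φ := fun x => √x) (φ' := fun x => 1 / (2 * √x)) (φ'' := -1 / (4 * √a ^ 3)) ?_ ?_
    hf).congr_val rfl (by ring) (by ring)
  · filter_upwards [isOpen_ne.mem_nhds ha.ne'] with x hx using Real.hasDerivAt_sqrt hx
  · refine ((hasDerivAt_const a (1 : ℝ)).fun_div ((Real.hasDerivAt_sqrt ha.ne').const_mul 2)
      (by positivity)).congr_deriv ?_
    field_simp; ring

lemma pow (hf : HasJet f a b c) (m : ℕ) :
    HasJet (fun t => f t ^ m) (a ^ m) (m * a ^ (m - 1) * b)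
      (m * (m - 1 : ℕ) * a ^ (m - 1 - 1) * b ^ 2 + m * a ^ (m - 1) * c) := by
  refine (comp (φ := fun x => x ^ m) (φ' := fun x => m * x ^ (m - 1))
    (φ'' := m * ((m - 1 : ℕ) * a ^ (m - 1 - 1))) ?_ ?_ hf).congr_val rfl (by ring) (by ring)
  · exact .of_forall fun x => hasDerivAt_pow m x
  · exact (hasDerivAt_pow (m - 1) a).const_mul _

lemma comp_neg (hf : HasJet f a b c) : HasJet (fun t => f (-t)) a (-b) c := by
  obtain ⟨f', f1, f2, f3, f4⟩ := hf
  have hn : Tendsto (fun t : ℝ => -t) (𝓝 0) (𝓝 0) := by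
    simpa using (continuous_neg (G := ℝ)).tendsto 0
  refine ⟨fun t => - f' (-t), ?_, ?_, by simpa, by simpa⟩
  · filter_upwards [hn.eventually f1] with t ht
    exact (ht.scomp t (hasDerivAt_neg t)).congr_deriv (by simp)
  · have f2' : HasDerivAt f' c (-0) := by simpa
    exact (f2'.scomp (0 : ℝ) (hasDerivAt_neg 0)).neg.congr_deriv (by simp)

lemma of_isLocalMax (hf : HasJet f a b c) (hm : IsLocalMax f 0) : b = 0 ∧ c ≤ 0 := by
  have hb : b = 0 := hm.hasDerivAt_eq_zero hf.hasDerivAt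
  refine ⟨hb, ?_⟩
  obtain ⟨f', f1, f2, f3, f4⟩ := hf
  by_contra! hc
  have h1 : ∀ᶠ t in 𝓝[>] (0 : ℝ), 0 < f' t := by
    have := f2.tendsto_slope
    have h2 : ∀ᶠ t in 𝓝[≠] (0 : ℝ), 0 < _root_.slope f' 0 t := this.eventually (lt_mem_nhds hc)
    have h3 := h2.filter_mono (nhdsWithin_mono _ fun x (hx : 0 < x) => hx.ne')
    filter_upwards [h3, self_mem_nhdsWithin] with t ht (ht' : 0 < t)
    rw [slope_def_field, f4, hb] at ht
    simpa [ht'] using (div_pos_iff_of_pos_right (by simpa using ht')).1 ht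
  obtain ⟨ε, hε, hsub⟩ := mem_nhdsGT_iff_exists_Ioo_subset.1 h1
  obtain ⟨δ, hδ, hball⟩ := Metric.eventually_nhds_iff.1 (f1.and hm)
  have hε' : (0 : ℝ) < ε := hε
  set r := min ε δ / 2 with hr
  have hr0 : 0 < r := by positivity
  have hrε : r < ε := by have := min_le_left ε δ; have : 0 < min ε δ := by positivity
                         linarith
  have hrδ : r < δ := by have := min_le_right ε δ; have : 0 < min ε δ := by positivity
                         linarith
  have hd : ∀ t ∈ Set.Icc 0 r, HasDerivAt f (f' t) t := fun t ht =>
    (hball (by rw [Real.dist_eq, sub_zero, abs_of_nonneg ht.1]; linarith [ht.2])).1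
  have hmono : StrictMonoOn f (Set.Icc 0 r) := by
    refine strictMonoOn_of_deriv_pos (convex_Icc 0 r)
      (fun t ht => (hd t ht).continuousAt.continuousWithinAt) fun t ht => ?_
    rw [interior_Icc] at ht
    rw [(hd t ⟨ht.1.le, ht.2.le⟩).deriv]
    exact hsub ⟨ht.1, ht.2.trans hrε⟩
  have h3 := hmono ⟨le_rfl, hr0.le⟩ ⟨hr0.le, le_rfl⟩ hr0
  have h4 := (hball (y := r) (by rw [Real.dist_eq, sub_zero, abs_of_pos hr0]; exact hrδ)).2
  linarith

/-- The symmetrised function `f t + f (-t)` has a local maximum at `0`, so midpoint concavity is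
enough. -/
lemma nonpos_of_midpoint (hf : HasJet f a b c) (h : ∀ᶠ t in 𝓝 0, f t + f (-t) ≤ 2 * f 0) :
    c ≤ 0 := by
  have := (hf.add hf.comp_neg).of_isLocalMax (by
    filter_upwards [h] with t ht; simp only [neg_zero]; linarith)
  linarith [this.2]

lemma of_contDiffAt {E : Type*} [NormedAddCommGroup E] [NormedSpace ℝ E] {F : E → ℝ}
    (hF : ContDiffAt ℝ 2 F 0) (e : E) :
    HasJet (fun t : ℝ => F (t • e)) (F 0) (fderiv ℝ F 0 e)
      (fderiv ℝ (fun y => fderiv ℝ F y e) 0 e) := by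
  have hl : ∀ t : ℝ, HasDerivAt (fun t : ℝ => t • e) e t := fun t => by
    simpa using (hasDerivAt_id t).smul_const e
  have hl0 : Tendsto (fun t : ℝ => t • e) (𝓝 0) (𝓝 0) := by
    simpa using (hl 0).continuousAt.tendsto
  refine ⟨fun t => fderiv ℝ F (t • e) e, ?_, ?_, by simp, by simp⟩
  · have h1 : ∀ᶠ y in 𝓝 (0 : E), ContDiffAt ℝ 2 F y := hF.eventually (by simp)
    filter_upwards [hl0.eventually h1] with t ht
    exact (ht.differentiableAt (by norm_num)).hasFDerivAt.comp_hasDerivAt t (hl t)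
  · have h2 : DifferentiableAt ℝ (fun y => fderiv ℝ F y e) 0 := by
      have : DifferentiableAt ℝ (fderiv ℝ F) 0 :=
        (hF.fderiv_right (m := 1) (by norm_num)).differentiableAt (by norm_num)
      exact this.clm_apply (differentiableAt_const e)
    have h3 := h2.hasFDerivAt
    rw [← zero_smul ℝ e] at h3
    refine (h3.comp_hasDerivAt (0 : ℝ) (hl 0)).congr_deriv ?_
    rw [zero_smul]

end HasJet

end Jets

/-! ### Second-order expansion of the determinant at a diagonal matrix -/

section DetJet

variable {n : Type*} [Fintype n] [DecidableEq n]

open Matrix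

lemma hasDerivAt_det {M M' : ℝ → Matrix n n ℝ} {t : ℝ}
    (h : ∀ i j, HasDerivAt (fun t => M t i j) (M' t i j) t) :
    HasDerivAt (fun t => (M t).det) (∑ i, ((M t).updateRow i (M' t i)).det) t := by
  have hM : HasDerivAt (fun t i j => M t i j) (fun i j => M' t i j) t :=
    hasDerivAt_pi.2 fun i => hasDerivAt_pi.2 fun j => h i j
  let D : ContinuousMultilinearMap ℝ (fun _ : n => n → ℝ) ℝ :=
    ⟨(detRowAlternating (R := ℝ) (n := n)).toMultilinearMap, by
      exact Continuous.matrix_det continuous_id⟩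
  have := (D.hasFDerivAt (x := fun i j => M t i j)).comp_hasDerivAt t hM
  refine this.congr_deriv ?_
  rw [ContinuousMultilinearMap.linearDeriv_apply]
  rfl

lemma det_updateRow_diagonal (d r : n → ℝ) (i : n) :
    ((diagonal d).updateRow i r).det = r i * ∏ j ∈ univ.erase i, d j := by
  rw [det_apply', sum_eq_single (1 : Equiv.Perm n)]
  · rw [← mul_prod_erase univ _ (mem_univ i)]
    simp only [Equiv.Perm.sign_one, Units.val_one, Int.cast_one, one_mul, Equiv.Perm.one_apply,
      updateRow_self]
    congr 1
    exact prod_congr rfl fun j hj => by simp [updateRow_ne (ne_of_mem_erase hj)]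
  · intro σ _ hσ
    obtain ⟨j, hj⟩ : ∃ j, σ j ≠ j := by
      by_contra! h
      exact hσ (Equiv.ext h)
    -- The product over `σ` runs through the entries in row `σ j` and column `j`. It vanishes once
    -- such an entry is off the diagonal and outside the replaced row `i`.
    have : ∃ j, σ j ≠ j ∧ σ j ≠ i := by
      by_cases h : σ j = i
      · have : σ i ≠ i := fun h' => hj (by rw [h]; exact σ.injective (h'.trans h.symm))
        exact ⟨i, this, this⟩
      · exact ⟨j, hj, h⟩
    obtain ⟨j, hj1, hj2⟩ := this
    rw [prod_eq_zero (mem_univ j), mul_zero]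
    rw [updateRow_ne hj2, diagonal_apply_ne _ hj1]
  · simp

/-- By linearity in `r` only basis vectors matter: `e_i` reduces to one replaced row, `e_j` does so
after exchanging the two rows, and any other `e_l` is parallel to an untouched row (with `d l`
extracted, so that `d l = 0` is allowed). -/
lemma det_updateRow_updateRow_diagonal (d r r' : n → ℝ) {i j : n} (hij : i ≠ j) :
    (((diagonal d).updateRow i r).updateRow j r').det =
      (r i * r' j - r j * r' i) * ∏ l ∈ (univ.erase i).erase j, d l := by
  have hlin : ∀ r : n → ℝ, (((diagonal d).updateRow i r).updateRow j r').det =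
      ∑ l, r l * (((diagonal d).updateRow i (Pi.single l 1)).updateRow j r').det := by
    intro r
    simp only [updateRow_comm _ hij]
    have : r = ∑ l, r l • (Pi.single l (1 : ℝ) : n → ℝ) := by
      ext m; simp [Finset.sum_apply, Pi.single_apply]
    conv_lhs => rw [this]
    have h2 : ∀ (s : Finset n), (((diagonal d).updateRow j r').updateRow i
        (∑ l ∈ s, r l • (Pi.single l (1 : ℝ) : n → ℝ))).det =
        ∑ l ∈ s, r l * (((diagonal d).updateRow j r').updateRow i (Pi.single l 1)).det := by
      intro s
      induction s using Finset.induction_on with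
      | empty => simpa using det_eq_zero_of_row_eq_zero i (by simp)
      | insert a s ha ih =>
        rw [sum_insert ha, sum_insert ha, det_updateRow_add, det_updateRow_smul, ih]
    exact h2 univ
  have hi : (((diagonal d).updateRow i (Pi.single i 1)).updateRow j r').det =
      r' j * ∏ l ∈ (univ.erase i).erase j, d l := by
    have : (diagonal d).updateRow i (Pi.single i 1) = diagonal (Function.update d i 1) := by
      ext a b
      by_cases ha : a = i
      · subst ha; simp [diagonal_apply, Pi.single_apply, eq_comm]
      · rw [updateRow_ne ha]; simp [diagonal_apply, ha]
    rw [this, det_updateRow_diagonal,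
      ← mul_prod_erase (univ.erase j) _ (mem_erase.2 ⟨hij, mem_univ i⟩), erase_right_comm]
    simp only [Function.update_self, one_mul]
    congr 1
    exact prod_congr rfl fun l hl => by
      rw [Function.update_of_ne (ne_of_mem_erase (mem_of_mem_erase hl))]
  have hj : (((diagonal d).updateRow i (Pi.single j 1)).updateRow j r').det =
      - (r' i * ∏ l ∈ (univ.erase i).erase j, d l) := by
    have : ((diagonal d).updateRow i (Pi.single j 1)).updateRow j r' =
        (((diagonal (Function.update d j 1)).updateRow i r').submatrix (Equiv.swap i j) id) := by
      ext a b
      by_cases ha : a = j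
      · subst ha; simp
      · by_cases ha' : a = i
        · subst ha'
          simp [updateRow_ne ha, updateRow_ne hij.symm, diagonal_apply, Pi.single_apply, eq_comm]
        · simp [updateRow_ne ha', Equiv.swap_apply_of_ne_of_ne ha' ha,
            diagonal_apply, ha]
    rw [this, det_permute, Equiv.Perm.sign_swap hij, det_updateRow_diagonal,
      ← mul_prod_erase (univ.erase i) _ (mem_erase.2 ⟨hij.symm, mem_univ j⟩)]
    simp only [Function.update_self, one_mul, Units.val_neg, Units.val_one, Int.cast_neg,
      Int.cast_one, neg_mul]
    congr 2
    exact prod_congr rfl fun l hl => by rw [Function.update_of_ne (ne_of_mem_erase hl)]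
  have hl : ∀ l, l ≠ i → l ≠ j →
      (((diagonal d).updateRow i (Pi.single l 1)).updateRow j r').det = 0 := by
    intro l hli hlj
    have hlin' : ∀ c : ℝ, (((diagonal d).updateRow i (Pi.single l c)).updateRow j r').det =
        c * (((diagonal d).updateRow i (Pi.single l 1)).updateRow j r').det := by
      intro c
      simp only [updateRow_comm _ hij]
      rw [← det_updateRow_smul]
      congr 2; ext m; simp [Pi.single_apply]
    rw [updateRow_comm _ hij]
    have e : (((diagonal d).updateRow j r').updateRow i (Pi.single l 1)).det =
        ((((diagonal d).updateRow j r').updateRow l (Pi.single l (d l))).updateRow i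
          (Pi.single l 1)).det := by
      congr 2
      ext a b
      by_cases ha : a = l
      · subst ha; simp [updateRow_ne hlj, diagonal_apply, Pi.single_apply, eq_comm]
      · rw [updateRow_ne ha]
    rw [e]
    have h0 : ∀ c : ℝ, ((((diagonal d).updateRow j r').updateRow l (Pi.single l c)).updateRow i
          (Pi.single l 1)).det = c * ((((diagonal d).updateRow j r').updateRow l
          (Pi.single l 1)).updateRow i (Pi.single l 1)).det := by
      intro c
      simp only [updateRow_comm _ hli]
      rw [← det_updateRow_smul]
      congr 2; ext m; simp [Pi.single_apply]
    rw [h0]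
    rw [det_zero_of_row_eq hli, mul_zero]
    rw [updateRow_ne hli, updateRow_self, updateRow_self]
  rw [hlin, ← add_sum_erase univ _ (mem_univ i),
    ← add_sum_erase (univ.erase i) _ (mem_erase.2 ⟨hij.symm, mem_univ j⟩), hi, hj,
    sum_eq_zero fun l hl' => ?_]
  · ring
  · rw [hl l (ne_of_mem_erase (mem_of_mem_erase hl')) (ne_of_mem_erase hl'), mul_zero]

/-- The second-order expansion of the determinant at a diagonal matrix. -/
lemma hasJet_det {M : ℝ → Matrix n n ℝ} {d : n → ℝ} {B C : Matrix n n ℝ}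
    (h : ∀ i j, HasJet (fun t => M t i j) (diagonal d i j) (B i j) (C i j)) :
    HasJet (fun t => (M t).det) (∏ i, d i) (∑ i, B i i * ∏ j ∈ univ.erase i, d j)
      (∑ i, C i i * ∏ j ∈ univ.erase i, d j + ∑ i, ∑ j ∈ univ.erase i,
        (B i i * B j j - B i j * B j i) * ∏ l ∈ (univ.erase i).erase j, d l) := by
  choose M' h1 h2 h3 h4 using h
  have hM0 : M 0 = diagonal d := by ext i j; exact h3 i j
  have hB : (Matrix.of fun i j => M' i j 0) = B := by ext i j; exact h4 i j
  refine ⟨fun t => ∑ i, ((M t).updateRow i fun j => M' i j t).det, ?_, ?_, ?_, ?_⟩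
  · have : ∀ᶠ t in 𝓝 (0 : ℝ), ∀ i j, HasDerivAt (fun t => M t i j) (M' i j t) t :=
      eventually_all.2 fun i => eventually_all.2 fun j => h1 i j
    filter_upwards [this] with t ht
    exact hasDerivAt_det (M' := fun t => Matrix.of fun i j => M' i j t) fun i j => ht i j
  · rw [← sum_add_distrib]
    refine HasDerivAt.fun_sum fun i _ => ?_
    have := hasDerivAt_det (M := fun t => (M t).updateRow i fun j => M' i j t)
      (M' := fun t => Matrix.of fun a b => if a = i then C i b else M' a b t) (t := 0) (by
        intro a b
        by_cases ha : a = i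
        · subst ha; simpa using h2 a b
        · simpa [ha, updateRow_ne ha] using (h1 a b).self_of_nhds)
    refine this.congr_deriv ?_
    rw [← add_sum_erase univ _ (mem_univ i)]
    congr 1
    · simp only [updateRow_idem, hM0]
      rw [det_updateRow_diagonal]
      simp
    · refine sum_congr rfl fun j hj => ?_
      have hji := ne_of_mem_erase hj
      rw [hM0, det_updateRow_updateRow_diagonal _ _ _ hji.symm]
      simp [hji, h4]
  · simp only [hM0, det_diagonal]
  · refine sum_congr rfl fun i _ => ?_
    rw [hM0, det_updateRow_diagonal, h4]

end DetJet

end KCurvature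

namespace KCurvature

open Finset Filter Topology Polynomial

/-! ### Monotonicity, Gårding's inequality and concavity on the cone -/

section ConeConsequences

variable {ι : Type*} [DecidableEq ι]

omit [DecidableEq ι] in
lemma es_smul (s : Finset ι) (m : ℕ) (r : ℝ) (κ : ι → ℝ) :
    es s m (r • κ) = r ^ m * es s m κ := by
  unfold es
  rw [mul_sum]
  refine sum_congr rfl fun t ht => ?_
  simp [prod_mul_distrib, (mem_powersetCard.1 ht).2]

omit [DecidableEq ι] in
lemma InCone.smul {s : Finset ι} {k : ℕ} {κ : ι → ℝ} (h : InCone s k κ) {r : ℝ} (hr : 0 < r) :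
    InCone s k (r • κ) := fun m hm => by
  rw [es_smul]; exact mul_pos (pow_pos hr m) (h m hm)

lemma InCone.add {s : Finset ι} {k : ℕ} {x y : ι → ℝ} (hx : InCone s k x) (hy : InCone s k y) :
    InCone s k (x + y) := by
  cases k with
  | zero => intro m hm; obtain rfl : m = 0 := by omega
            simp
  | succ k => exact (InCone.add_and_quotient k s hx hy).1

lemma InCone.es_le_es_add {s : Finset ι} {k : ℕ} {x y : ι → ℝ} (hx : InCone s k x)
    (hy : InCone s k y) {m : ℕ} (hm : m ≤ k) : es s m x ≤ es s m (x + y) := by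
  induction m with
  | zero => simp
  | succ m ih =>
    have ihm := ih (by omega)
    have hq := (InCone.add_and_quotient m s (hx.mono hm) (hy.mono hm)).2
    have h1 := hx m (by omega)
    have h2 := hx (m + 1) hm
    have h3 : 0 < es s (m + 1) y / es s m y := div_pos (hy _ hm) (hy _ (by omega))
    have h4 := (hx.add hy) m (by omega)
    calc es s (m + 1) x = es s (m + 1) x / es s m x * es s m x := by field_simp
      _ ≤ es s (m + 1) (x + y) / es s m (x + y) * es s m (x + y) := by
        apply mul_le_mul (by linarith) ihm h1.le
        exact (div_pos ((hx.add hy) _ hm) h4).le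
      _ = es s (m + 1) (x + y) := by field_simp

lemma hasDerivAt_es_line (s : Finset ι) (m : ℕ) (a b : ι → ℝ) (t : ℝ) :
    HasDerivAt (fun t => es s (m + 1) (fun i => a i + t * b i))
      (∑ i ∈ s, b i * es (s.erase i) m (fun j => a j + t * b j)) t := by
  have hl : ∀ i, HasDerivAt (fun t => a i + t * b i) (b i) t := fun i => by
    simpa using ((hasDerivAt_id t).mul_const (b i)).const_add (a i)
  induction s using Finset.induction_on generalizing m with
  | empty =>
    simp only [sum_empty]
    refine (hasDerivAt_const t 0).congr_of_eventuallyEq (.of_forall fun t => ?_)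
    exact es_eq_zero_of_card_lt (by simp) _
  | insert i s hi ih =>
    simp only [es_insert hi]
    have he : ∀ j ∈ s, (insert i s).erase j = insert i (s.erase j) := fun j hj =>
      erase_insert_of_ne (fun h => hi (h ▸ hj))
    rw [sum_insert hi, erase_insert hi]
    cases m with
    | zero =>
      refine ((ih 0).add ((hl i).mul (hasDerivAt_const t (1 : ℝ)))).congr_deriv ?_ |>.congr_of_eventuallyEq ?_
      · simp [add_comm]
      · exact .of_forall fun t => by simp
    | succ m =>
      refine ((ih (m + 1)).add ((hl i).mul (ih m))).congr_deriv ?_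
      have : ∀ j ∈ s, b j * es ((insert i s).erase j) (m + 1) (fun j => a j + t * b j) =
          b j * es (s.erase j) (m + 1) (fun j => a j + t * b j) +
            (a i + t * b i) * (b j * es (s.erase j) m (fun j => a j + t * b j)) := by
        intro j hj
        rw [he j hj, es_insert (fun h => hi (mem_of_mem_erase h))]
        ring
      rw [sum_congr rfl this, sum_add_distrib, ← mul_sum]
      ring

lemma hasJet_es_line (s : Finset ι) (m : ℕ) (a b : ι → ℝ) :
    HasJet (fun t => es s (m + 2) (fun i => a i + t * b i)) (es s (m + 2) a)
      (∑ i ∈ s, b i * es (s.erase i) (m + 1) a)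
      (∑ i ∈ s, ∑ j ∈ s.erase i, b i * b j * es ((s.erase i).erase j) m a) := by
  refine ⟨_, .of_forall fun t => hasDerivAt_es_line s (m + 1) a b t, ?_, by simp, by simp⟩
  refine HasDerivAt.fun_sum fun i _ => ?_
  refine ((hasDerivAt_es_line (s.erase i) m a b 0).const_mul (b i)).congr_deriv ?_
  simp [mul_sum, mul_assoc]

lemma hasJet_es_one_line (s : Finset ι) (a b : ι → ℝ) :
    HasJet (fun t => es s 1 (fun i => a i + t * b i)) (es s 1 a) (∑ i ∈ s, b i) 0 := by
  refine ⟨_, .of_forall fun t => hasDerivAt_es_line s 0 a b t, ?_, by simp, by simp⟩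
  simpa using hasDerivAt_const (0 : ℝ) (∑ i ∈ s, b i)

lemma exists_hasJet_es_line (s : Finset ι) (m : ℕ) (a b : ι → ℝ) :
    ∃ b' c', HasJet (fun t => es s m (fun i => a i + t * b i)) (es s m a) b' c' := by
  match m with
  | 0 => exact ⟨0, 0, by simpa using HasJet.const 1⟩
  | 1 => exact ⟨_, _, hasJet_es_one_line s a b⟩
  | m + 2 => exact ⟨_, _, hasJet_es_line s m a b⟩

lemma InCone.eventually_line {s : Finset ι} {k : ℕ} {a : ι → ℝ} (h : InCone s k a) (b : ι → ℝ) :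
    ∀ᶠ t in 𝓝 (0 : ℝ), InCone s k (fun i => a i + t * b i) := by
  have : ∀ᶠ t in 𝓝 (0 : ℝ), ∀ m : Fin (k + 1), 0 < es s m (fun i => a i + t * b i) := by
    refine eventually_all.2 fun m => ?_
    obtain ⟨b', c', hj⟩ := exists_hasJet_es_line s m a b
    have hc := hj.continuousAt
    refine hc.eventually (lt_mem_nhds ?_)
    simpa using h m (by omega)
  filter_upwards [this] with t ht m hm using ht ⟨m, by omega⟩

/-- Gårding's inequality in its linearised form. -/
lemma InCone.sum_mul_es_erase_nonneg {s : Finset ι} {k : ℕ} {a b : ι → ℝ}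
    (ha : InCone s (k + 1) a) (hb : InCone s (k + 1) b) :
    0 ≤ ∑ i ∈ s, b i * es (s.erase i) k a := by
  have hd := hasDerivAt_es_line s k a b 0
  simp only [zero_mul, add_zero] at hd
  -- A negative derivative at `0` in direction `b` contradicts the monotonicity `σ(a) ≤ σ(a + t b)`
  -- for small `t > 0`.
  by_contra! hc
  have h1 := hd.tendsto_slope.mono_left
    (nhdsWithin_mono (t := ({0}ᶜ : Set ℝ)) 0 fun x (hx : x ∈ Set.Ioi (0 : ℝ)) => ne_of_gt hx)
  have h2 := h1.eventually (gt_mem_nhds hc)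
  obtain ⟨t, ht, ht0⟩ := (h2.and self_mem_nhdsWithin).exists
  rw [slope_def_field, sub_zero, div_neg_iff] at ht
  have h3 := ha.es_le_es_add (hb.smul ht0) le_rfl
  have e : a + t • b = fun i => a i + t * b i := by ext; simp
  rw [e] at h3
  simp only [zero_mul, add_zero] at ht
  rcases ht with ht | ht
  · exact absurd ht.2 (not_lt.2 (le_of_lt ht0))
  · linarith [ht.1]

lemma InCone.erase_erase_nonneg {s : Finset ι} {k : ℕ} {a : ι → ℝ}
    (ha : InCone s (k + 2) a) {i j : ι} (hi : i ∈ s) (hj : j ∈ s.erase i) :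
    0 < es ((s.erase i).erase j) k a := (ha.erase hi).erase hj k le_rfl

/-- This relation `F_i - F_j = (κ_j - κ_i) ∂²σ / ∂κ_i ∂κ_j` allows the off-diagonal third-derivative
terms to be compared with `F_i` and `F_o`. -/
lemma es_erase_sub_es_erase {s : Finset ι} (k : ℕ) (a : ι → ℝ) {i j : ι} (hi : i ∈ s)
    (hj : j ∈ s.erase i) :
    es (s.erase i) (k + 1) a - es (s.erase j) (k + 1) a =
      (a j - a i) * es ((s.erase i).erase j) k a := by
  have hi' : i ∈ s.erase j := mem_erase.2 ⟨(ne_of_mem_erase hj).symm, hi⟩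
  rw [es_erase hj, es_erase hi', erase_right_comm (a := j)]
  ring

/-- Iterated Newton inequalities. With `σ_{k+2} = G ^ (k + 1)` this reads `σ_{k+1} ≥ G ^ k * σ_1 ^
(1 / (k + 1))`: the trace of the linearised operator beats `G ^ k` as soon as the curvature is
large, however small `G` is. -/
lemma InCone.es_pow_ge {s : Finset ι} {k : ℕ} {a : ι → ℝ} (ha : InCone s (k + 2) a) :
    es s (k + 2) a ^ k * es s 1 a ≤ es s (k + 1) a ^ (k + 1) := by
  induction k with
  | zero => simp
  | succ k ih =>
    have ih' := ih (ha.mono (by omega))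
    have N := es_mul_es_le_sq s a (k + 1)
    have p1 := ha (k + 1) (by omega)
    have p2 := ha (k + 2) (by omega)
    have p3 := ha (k + 3) (by omega)
    have h1 : (es s (k + 1) a * es s (k + 3) a) ^ (k + 1) ≤ (es s (k + 2) a ^ 2) ^ (k + 1) :=
      pow_le_pow_left₀ (by positivity) N _
    refine le_of_mul_le_mul_left ?_ (pow_pos p2 k)
    calc es s (k + 2) a ^ k * (es s (k + 3) a ^ (k + 1) * es s 1 a)
        = (es s (k + 2) a ^ k * es s 1 a) * es s (k + 3) a ^ (k + 1) := by ring
      _ ≤ es s (k + 1) a ^ (k + 1) * es s (k + 3) a ^ (k + 1) := by gcongr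
      _ ≤ (es s (k + 2) a ^ 2) ^ (k + 1) := by rw [← mul_pow]; exact h1
      _ = es s (k + 2) a ^ k * es s (k + 2) a ^ (k + 2) := by ring

lemma InCone.le_es_one {s : Finset ι} {a : ι → ℝ} (ha : InCone s 2 a) {i : ι} (hi : i ∈ s) :
    a i < es s 1 a := by
  have := ha.erase hi 1 le_rfl
  rw [es_erase hi]
  simp only [es_zero]; linarith

lemma sum_sq_eq (s : Finset ι) (a : ι → ℝ) :
    ∑ i ∈ s, a i ^ 2 = es s 1 a ^ 2 - 2 * es s 2 a := by
  have h := sum_mul_es_erase s 1 a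
  have e : ∀ i ∈ s, a i * es (s.erase i) 1 a = a i * es s 1 a - a i ^ 2 := fun i hi => by
    rw [es_erase (s := s) hi]; simp only [es_zero]; ring
  rw [sum_congr rfl e, sum_sub_distrib, ← sum_mul, ← es_one] at h
  push_cast at h
  linarith

lemma InCone.es_succ_le {s : Finset ι} {k : ℕ} {a : ι → ℝ} (ha : InCone s k a) {m : ℕ}
    (hm : m + 1 ≤ k) : es s (m + 1) a ≤ es s m a * es s 1 a := by
  induction m with
  | zero => simp
  | succ m ih =>
    have ih' := ih (by omega)
    have N := es_mul_es_le_sq s a m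
    have p0 := ha m (by omega)
    have p1 := ha (m + 1) (by omega)
    refine le_of_mul_le_mul_left ?_ p0
    nlinarith

/-- The second-order concavity inequality coming from the concavity of
`(σ_k / σ_1) ^ (1 / (k - 1))` on Gårding's cone. -/
lemma InCone.concavity {s : Finset ι} {k : ℕ} {a : ι → ℝ} (ha : InCone s (k + 2) a)
    (b : ι → ℝ) :
    (∑ i ∈ s, ∑ j ∈ s.erase i, b i * b j * es ((s.erase i).erase j) k a) / es s (k + 2) a
      - ((∑ i ∈ s, b i * es (s.erase i) (k + 1) a) / es s (k + 2) a) ^ 2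
      + ((∑ i ∈ s, b i) / es s 1 a) ^ 2 ≤
    - ((∑ i ∈ s, b i * es (s.erase i) (k + 1) a) / es s (k + 2) a
        - (∑ i ∈ s, b i) / es s 1 a) ^ 2 / (k + 1) := by
  choose B C hJ using fun m => exists_hasJet_es_line s m a b
  set l : ℕ → ℝ := fun m => B m / es s m a with hl
  set L : ℕ → ℝ := fun m => C m / es s m a - (B m / es s m a) ^ 2 with hL
  have hcone := ha.eventually_line b
  have hneg : ∀ᶠ t in 𝓝 (0 : ℝ), InCone s (k + 2) (fun i => a i + -t * b i) := by
    have := ha.eventually_line (-b)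
    filter_upwards [this] with t ht
    simpa using ht
  -- The quotient `q = σ_{j+1} / σ_j` is superadditive and homogeneous of degree one, hence midpoint
  -- concave on lines; `q'' ≤ 0` reads `(log q)'' ≤ -((log q)')²`.
  have step : ∀ j, j + 1 ≤ k + 2 → L (j + 1) - L j ≤ - (l (j + 1) - l j) ^ 2 := by
    intro j hj
    have h0 := ha j (by omega)
    have h1 := ha (j + 1) hj
    have hq := (((hJ (j + 1)).log h1.ne').sub ((hJ j).log h0.ne')).exp
    have hq' : HasJet (fun t => es s (j + 1) (fun i => a i + t * b i) /
        es s j (fun i => a i + t * b i)) _ _ _ := hq.congr (by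
      filter_upwards [hcone] with t ht
      rw [Real.exp_sub, Real.exp_log (ht _ hj), Real.exp_log (ht _ (by omega))])
    have hle := hq'.nonpos_of_midpoint (by
      filter_upwards [hcone, hneg] with t ht ht'
      have := (InCone.add_and_quotient j s (ht.mono hj) (ht'.mono hj)).2
      refine this.trans (le_of_eq ?_)
      have e : ((fun i => a i + t * b i) + fun i => a i + -t * b i) = (2 : ℝ) • a := by
        ext i; simp; ring
      rw [e, es_smul, es_smul]
      simp only [zero_mul, add_zero]
      field_simp
      ring)
    have hE := Real.exp_pos (Real.log (es s (j + 1) a) - Real.log (es s j a))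
    have := nonpos_of_mul_nonpos_right hle hE
    simp only [hL, hl]
    linarith
  have tel : L (k + 2) - L 1 ≤ - ∑ j ∈ range (k + 1), (l (j + 2) - l (j + 1)) ^ 2 := by
    have e : L (k + 2) - L 1 = ∑ j ∈ range (k + 1), (L (j + 1 + 1) - L (j + 1)) :=
      (sum_range_sub (fun j => L (j + 1)) (k + 1)).symm
    rw [e, ← sum_neg_distrib]
    exact sum_le_sum fun j hj => step (j + 1) (by have := mem_range.1 hj; omega)
  -- Cauchy–Schwarz over the `k + 1` quotients whose product is `σ_{k+2} / σ_1`.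
  have cs : (l (k + 2) - l 1) ^ 2 / (k + 1) ≤ ∑ j ∈ range (k + 1), (l (j + 2) - l (j + 1)) ^ 2 := by
    have e : l (k + 2) - l 1 = ∑ j ∈ range (k + 1), (l (j + 1 + 1) - l (j + 1)) :=
      (sum_range_sub (fun j => l (j + 1)) (k + 1)).symm
    rw [e, div_le_iff₀ (by positivity)]
    have := sq_sum_le_card_mul_sum_sq (s := range (k + 1)) (f := fun j => l (j + 1 + 1) - l (j + 1))
    rw [card_range] at this
    push_cast at this
    linarith
  obtain ⟨-, e1, e2⟩ := (hJ (k + 2)).unique (hasJet_es_line s k a b)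
  obtain ⟨-, f1, f2⟩ := (hJ 1).unique (hasJet_es_one_line s a b)
  simp only [hl, hL, e1, e2, f1, f2] at tel cs
  rw [neg_div]
  simp only [zero_div] at tel
  linarith

end ConeConsequences

/-! ### Closed cones and vectors extended by a zero -/

section Sigma

variable {n : ℕ}

lemma sigma_eq_es (m : ℕ) (κ : Fin n → ℝ) : sigma m κ = es univ m κ := rfl

lemma mem_gardingCone_iff {k : ℕ} {κ : Fin n → ℝ} : κ ∈ gardingCone n k ↔ InCone univ k κ := by
  constructor
  · intro h m hm
    rcases Nat.eq_zero_or_pos m with rfl | h0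
    · simp
    · exact h m h0 hm
  · intro h m _ hm
    exact h m hm

lemma continuous_es {ι : Type*} (s : Finset ι) (m : ℕ) :
    Continuous fun κ : ι → ℝ => es s m κ := by
  unfold es
  fun_prop

/-- The inequality `σ_{m+1} ≤ σ_m σ_1` persists on the closed cone, so a vanishing `σ_m` would make
`σ_{m+1}` nonpositive. Positivity thus descends from order `k` to all lower orders. -/
lemma inCone_of_mem_closure {k : ℕ} {κ : Fin n → ℝ} (h : κ ∈ closure (gardingCone n k))
    (hk : 0 < sigma k κ) : InCone univ k κ := by
  have h0 : ∀ m ≤ k, 0 ≤ es univ m κ := fun m hm =>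
    closure_minimal (t := {κ : Fin n → ℝ | 0 ≤ es univ m κ})
      (fun x hx => (mem_gardingCone_iff.1 hx m hm).le)
      (isClosed_le continuous_const (continuous_es _ _)) h
  have h1 : ∀ m, m + 1 ≤ k → es univ (m + 1) κ ≤ es univ m κ * es univ 1 κ := fun m hm =>
    closure_minimal (t := {κ : Fin n → ℝ | es univ (m + 1) κ ≤ es univ m κ * es univ 1 κ})
      (fun x hx => (mem_gardingCone_iff.1 hx).es_succ_le hm)
      (isClosed_le (continuous_es _ _) ((continuous_es _ _).mul (continuous_es _ _))) h
  have h2 : ∀ j ≤ k, 0 < es univ (k - j) κ := by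
    intro j hj
    induction j with
    | zero => exact hk
    | succ j ih =>
      have p := ih (by omega)
      have q := h1 (k - (j + 1)) (by omega)
      rw [show k - (j + 1) + 1 = k - j by omega] at q
      refine lt_of_le_of_ne (h0 _ (by omega)) fun h => ?_
      rw [← h, zero_mul] at q
      linarith
  intro m hm
  have := h2 (k - m) (by omega)
  rwa [show k - (k - m) = m by omega] at this

/-- Gårding's inequality for vectors obtained from a vector of a smaller cone by appending a
zero and dropping an entry. -/
lemma sum_mul_es_erase_nonneg_of_option {k : ℕ} {a b : Fin n → ℝ}
    (ha : InCone univ (k + 1) a) (hb : b ∈ closure (gardingCone n (k + 2)))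
    {f : Fin n → Option (Fin n)} (hf : Function.Injective f) :
    0 ≤ ∑ i, (f i).elim 0 b * es (univ.erase i) k a := by
  refine closure_minimal
    (t := {b : Fin n → ℝ | 0 ≤ ∑ i, (f i).elim 0 b * es (univ.erase i) k a}) ?_ ?_ hb
  · intro b hb
    rw [mem_gardingCone_iff] at hb
    refine InCone.sum_mul_es_erase_nonneg ha ?_
    have h1 : InCone (univ : Finset (Option (Fin n))) (k + 2) (fun o => o.elim 0 b) := by
      intro m hm
      have e : (univ : Finset (Option (Fin n))) = insert none (univ.map Function.Embedding.some) := by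
        ext o; cases o <;> simp
      have e2 : ∀ m, es (univ.map Function.Embedding.some) m (fun o : Option (Fin n) => o.elim 0 b) =
          es univ m b := by
        intro m
        unfold es
        rw [powersetCard_map, sum_map]
        refine sum_congr rfl fun t _ => ?_
        simp
      cases m with
      | zero => simp
      | succ m =>
        rw [e, es_insert (by simp)]
        simp only [Option.elim_none, zero_mul, add_zero]
        rw [e2]
        exact hb _ hm
    -- An injection of `Fin n` into `Option (Fin n)` misses exactly one point, so the vector in
    -- question is `(b, 0)` with one entry erased; erasing lowers the order of the cone by one.
    obtain ⟨o, ho⟩ : ∃ o : Option (Fin n), univ.image f = univ.erase o := by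
      have hc : (univ.image f).card = n := by rw [card_image_of_injective _ hf]; simp
      have : ((univ.image f)ᶜ).card = 1 := by rw [card_compl, hc]; simp
      obtain ⟨o, ho⟩ := card_eq_one.1 this
      refine ⟨o, ?_⟩
      rw [← compl_compl (univ.image f), ho]
      ext x; simp
    have h2 := h1.erase (mem_univ o)
    rw [← ho] at h2
    intro m hm
    have := h2 m hm
    have e : es (univ.image f) m (fun o => o.elim 0 b) = es univ m (fun i => (f i).elim 0 b) := by
      unfold es
      have : univ.image f = univ.map ⟨f, hf⟩ := by ext; simp
      rw [this, powersetCard_map, sum_map]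
      refine sum_congr rfl fun t _ => ?_
      simp
    rwa [e] at this
  · refine isClosed_le continuous_const (continuous_finsetSum _ fun i _ => ?_)
    cases f i with
    | none => simpa using continuous_const
    | some j => exact (continuous_apply j).mul continuous_const

end Sigma

/-! ### Coefficients of a polynomial from its values -/

section Coefficients

/-- Coefficients of polynomials of bounded degree are linear combinations of finitely many
values. -/
lemma exists_coeff_eq_sum_eval (n m : ℕ) : ∃ (w v : Fin (n + 1) → ℝ),
    ∀ P : ℝ[X], P.natDegree ≤ n → P.coeff m = ∑ l, w l * P.eval (v l) := by
  let v : Fin (n + 1) → ℝ := fun l => (l : ℕ)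
  have hv : Set.InjOn v (univ : Finset (Fin (n + 1))) := fun a _ b _ h => by
    simpa [v, Fin.ext_iff] using h
  refine ⟨fun l => (Lagrange.basis univ v l).coeff m, v, fun P hP => ?_⟩
  have h : P = Lagrange.interpolate univ v fun l => P.eval (v l) :=
    Lagrange.eq_interpolate hv (by
      rw [card_univ, Fintype.card_fin]
      exact degree_le_natDegree.trans_lt (by exact_mod_cast Nat.lt_succ_of_le hP))
  conv_lhs => rw [h]
  rw [Lagrange.interpolate_apply, finsetSum_coeff]
  refine sum_congr rfl fun l _ => ?_
  rw [coeff_C_mul, mul_comm]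

end Coefficients

end KCurvature

namespace KCurvature

open Finset Filter Topology Matrix

/-! ### Matrices: eigenvalues, the metric and its inverse square root -/

section MatrixFacts

variable {n : ℕ}

lemma exists_orthogonal {A : Matrix (Fin n) (Fin n) ℝ} (hA : A.IsHermitian) :
    ∃ O : Matrix (Fin n) (Fin n) ℝ, Oᵀ * O = 1 ∧ O * Oᵀ = 1 ∧
      A = O * diagonal (eigenvalueVec A) * Oᵀ := by
  have hst : star (hA.eigenvectorUnitary : Matrix (Fin n) (Fin n) ℝ) =
      (hA.eigenvectorUnitary : Matrix (Fin n) (Fin n) ℝ)ᵀ := by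
    rw [star_eq_conjTranspose, conjTranspose_eq_transpose_of_trivial]
  refine ⟨hA.eigenvectorUnitary, ?_, ?_, ?_⟩
  · rw [← hst]; exact Unitary.coe_star_mul_self _
  · rw [← hst]; exact Unitary.coe_mul_star_self _
  · have h := hA.spectral_theorem
    rw [Unitary.conjStarAlgAut_apply] at h
    rw [← hst, eigenvalueVec, dif_pos hA]
    exact h

lemma det_one_add_smul {A : Matrix (Fin n) (Fin n) ℝ} (hA : A.IsHermitian) (s : ℝ) :
    (1 + s • A).det = (esPoly univ (eigenvalueVec A)).eval s := by
  obtain ⟨O, h1, h2, h3⟩ := exists_orthogonal hA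
  have e : 1 + s • A = O * (diagonal fun i => 1 + eigenvalueVec A i * s) * Oᵀ := by
    conv_lhs => rw [h3, ← h2]
    have : (diagonal fun i => 1 + eigenvalueVec A i * s) =
        1 + s • diagonal (eigenvalueVec A) := by
      ext i j
      by_cases h : i = j
      · subst h; simp [mul_comm]
      · simp [h]
    rw [this]
    simp [Matrix.mul_add, Matrix.add_mul]
  rw [e, det_mul, det_mul, mul_comm O.det, mul_assoc, ← det_mul, h2, det_one, mul_one,
    det_diagonal, esPoly, Polynomial.eval_prod]
  simp

lemma sum_sq_entries {A : Matrix (Fin n) (Fin n) ℝ} (hA : A.IsHermitian) :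
    ∑ i, ∑ j, A i j ^ 2 = ∑ i, eigenvalueVec A i ^ 2 := by
  obtain ⟨O, h1, h2, h3⟩ := exists_orthogonal hA
  have e1 : ∑ i, ∑ j, A i j ^ 2 = (A * Aᵀ).trace := by
    simp [trace, Matrix.mul_apply, sq]
  have hT : Aᵀ = A := by
    have := hA.eq; rwa [conjTranspose_eq_transpose_of_trivial] at this
  have e2 : A * A = O * (diagonal (eigenvalueVec A) * diagonal (eigenvalueVec A)) * Oᵀ := by
    conv_lhs => rw [h3]
    calc O * diagonal (eigenvalueVec A) * Oᵀ * (O * diagonal (eigenvalueVec A) * Oᵀ)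
        = O * diagonal (eigenvalueVec A) * (Oᵀ * O) * diagonal (eigenvalueVec A) * Oᵀ := by
          simp only [Matrix.mul_assoc]
      _ = _ := by rw [h1]; simp only [Matrix.mul_one, Matrix.mul_assoc]
  rw [e1, hT, e2, trace_mul_comm, ← Matrix.mul_assoc, h1, Matrix.one_mul, diagonal_mul_diagonal,
    trace_diagonal]
  exact sum_congr rfl fun i _ => by ring

/-- The matrix `1 - p pᵀ / (w (1 + w))`, the inverse square root of `1 + p pᵀ`. -/
noncomputable def gammaMat (p : Fin n → ℝ) : Matrix (Fin n) (Fin n) ℝ :=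
  1 - (√(1 + ∑ i, p i ^ 2) * (1 + √(1 + ∑ i, p i ^ 2)))⁻¹ • vecMulVec p p

lemma gammaMat_transpose (p : Fin n → ℝ) : (gammaMat p)ᵀ = gammaMat p := by
  simp [gammaMat, transpose_vecMulVec]

lemma gammaMat_mul (p : Fin n → ℝ) : gammaMat p * (1 + vecMulVec p p) * gammaMat p = 1 := by
  unfold gammaMat
  set w := √(1 + ∑ i, p i ^ 2) with hw
  have hS : 0 ≤ ∑ i, p i ^ 2 := sum_nonneg fun i _ => sq_nonneg _
  have hw2 : w ^ 2 = 1 + ∑ i, p i ^ 2 := Real.sq_sqrt (by linarith)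
  have hw0 : 0 < w := Real.sqrt_pos.2 (by linarith)
  have hQ : vecMulVec p p * vecMulVec p p = (w ^ 2 - 1) • vecMulVec p p := by
    rw [vecMulVec_mul_vecMulVec]
    have : p ⬝ᵥ p = w ^ 2 - 1 := by rw [hw2]; simp [dotProduct, sq]
    rw [this, vecMulVec_smul]
  set c := (w * (1 + w))⁻¹ with hc
  have hcw : c * (w * (1 + w)) = 1 := inv_mul_cancel₀ (by positivity)
  have : (1 - c • vecMulVec p p) * (1 + vecMulVec p p) * (1 - c • vecMulVec p p) =
      1 + (1 - 2 * c + (w ^ 2 - 1) * (-2 * c + c ^ 2) + c ^ 2 * (w ^ 2 - 1) ^ 2) •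
        vecMulVec p p := by
    simp only [Matrix.mul_add, Matrix.add_mul, Matrix.sub_mul, Matrix.mul_sub, Matrix.one_mul,
      Matrix.mul_one, Matrix.smul_mul, Matrix.mul_smul, hQ, smul_smul]
    module
  rw [this]
  have : 1 - 2 * c + (w ^ 2 - 1) * (-2 * c + c ^ 2) + c ^ 2 * (w ^ 2 - 1) ^ 2 = 0 := by
    have e : c = (w * (1 + w))⁻¹ := hc
    rw [e]
    field_simp
    ring
  rw [this, zero_smul, add_zero]

/-- The quotient `det (g + s h) / det g` generates the symmetric functions of the principal
curvatures. In this form the square root of the metric never has to be differentiated. -/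
lemma det_metric_add (p : Fin n → ℝ) (h : Matrix (Fin n) (Fin n) ℝ) (s : ℝ) :
    (1 + vecMulVec p p + s • h).det =
      (1 + vecMulVec p p).det * (1 + s • (gammaMat p * h * gammaMat p)).det := by
  have h1 := congrArg det (gammaMat_mul p)
  rw [det_mul, det_mul, det_one] at h1
  have h2 : 1 + s • (gammaMat p * h * gammaMat p) =
      gammaMat p * (1 + vecMulVec p p + s • h) * gammaMat p := by
    rw [Matrix.mul_add, Matrix.add_mul, gammaMat_mul, Matrix.mul_smul, Matrix.smul_mul]
  rw [h2, det_mul, det_mul]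
  linear_combination (-(1 + vecMulVec p p + s • h).det) * h1

lemma det_one_add_vecMulVec (p : Fin n → ℝ) : (1 + vecMulVec p p).det = 1 + ∑ i, p i ^ 2 := by
  rw [vecMulVec_eq Unit, det_one_add_replicateCol_mul_replicateRow]
  simp [dotProduct, sq]

end MatrixFacts

/-! ### Principal frames of a graph and the barrier inequality -/

section Frames

variable {n : ℕ}

local notation "E" => EuclideanSpace ℝ (Fin n)

open scoped RealInnerProductSpace

/-- The gradient as a vector. -/
noncomputable def gradVec (u : E → ℝ) (x : E) : E := WithLp.toLp 2 (grad u x)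

lemma clm_apply_eq_sum {F : Type*} [NormedAddCommGroup F] [NormedSpace ℝ F] (L : E →L[ℝ] F)
    (z : E) : L z = ∑ i, z i • L (EuclideanSpace.single i 1) := by
  conv_lhs => rw [← (EuclideanSpace.basisFun (Fin n) ℝ).sum_repr z]
  simp

lemma fderiv_eq_inner (u : E → ℝ) (x z : E) : fderiv ℝ u x z = ⟪gradVec u x, z⟫ := by
  rw [clm_apply_eq_sum, PiLp.inner_apply]
  simp [gradVec, grad]

lemma slope_eq (u : E → ℝ) (x : E) : slope u x = √(1 + ‖gradVec u x‖ ^ 2) := by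
  rw [slope, EuclideanSpace.norm_sq_eq]
  simp [gradVec]

lemma slope_sq (u : E → ℝ) (x : E) : slope u x ^ 2 = 1 + ‖gradVec u x‖ ^ 2 := by
  rw [slope_eq, Real.sq_sqrt (by positivity)]

lemma one_le_slope (u : E → ℝ) (x : E) : 1 ≤ slope u x := by
  rw [slope_eq, Real.one_le_sqrt]
  nlinarith [sq_nonneg ‖gradVec u x‖]

lemma slope_pos (u : E → ℝ) (x : E) : 0 < slope u x := one_pos.trans_le (one_le_slope u x)

lemma curvatureMatrix_eq (u : E → ℝ) (x : E) : curvatureMatrix u x =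
    gammaMat (grad u x) * secondFundForm u x * gammaMat (grad u x) := rfl

lemma hess_isHermitian {u : E → ℝ} {x : E} (h1 : ∀ᶠ y in 𝓝 x, DifferentiableAt ℝ u y)
    (h2 : DifferentiableAt ℝ (fderiv ℝ u) x) : (hess u x).IsHermitian := by
  refine IsHermitian.ext fun i j => ?_
  simp only [hess, of_apply, star_trivial]
  exact second_derivative_symmetric_of_eventually (𝕜 := ℝ)
    (h1.mono fun y hy => hy.hasFDerivAt) h2.hasFDerivAt _ _

lemma curvatureMatrix_isHermitian {u : E → ℝ} {x : E} (h : (hess u x).IsHermitian) :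
    (curvatureMatrix u x).IsHermitian := by
  have hT : (hess u x)ᵀ = hess u x := by
    have := h.eq; rwa [conjTranspose_eq_transpose_of_trivial] at this
  rw [IsHermitian, conjTranspose_eq_transpose_of_trivial, curvatureMatrix_eq]
  simp [secondFundForm, transpose_mul, gammaMat_transpose, hT, Matrix.mul_assoc]

lemma snd_fderiv_eq_sum (u : E → ℝ) (x y z : E) :
    fderiv ℝ (fderiv ℝ u) x y z = ∑ i, ∑ j, y i * z j * hess u x i j := by
  rw [clm_apply_eq_sum (fderiv ℝ (fderiv ℝ u) x) y, _root_.sum_apply]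
  refine sum_congr rfl fun i _ => ?_
  rw [_root_.smul_apply]
  rw [clm_apply_eq_sum _ z, smul_eq_mul, mul_sum]
  refine sum_congr rfl fun j _ => ?_
  simp only [hess, of_apply, smul_eq_mul]
  ring

/-- `b` is orthonormal for the metric `1 + p pᵀ`. -/
def IsFrame (p : E) (b : Fin n → E) : Prop :=
  ∀ i j, ⟪b i, b j⟫ + ⟪p, b i⟫ * ⟪p, b j⟫ = if i = j then 1 else 0

/-- The principal frame of a graph. -/
lemma exists_frame {u : E → ℝ} {x : E} (h : (hess u x).IsHermitian) :
    ∃ b : Fin n → E, IsFrame (gradVec u x) b ∧ ∀ i j, fderiv ℝ (fderiv ℝ u) x (b i) (b j) =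
      if i = j then slope u x * principalCurvatures u x i else 0 := by
  obtain ⟨O, h1, h2, h3⟩ := exists_orthogonal (curvatureMatrix_isHermitian h)
  set B := gammaMat (grad u x) * O with hB
  have g1 : Bᵀ * (1 + vecMulVec (grad u x) (grad u x)) * B = 1 := by
    have : Bᵀ * (1 + vecMulVec (grad u x) (grad u x)) * B =
        Oᵀ * (gammaMat (grad u x) * (1 + vecMulVec (grad u x) (grad u x)) *
          gammaMat (grad u x)) * O := by
      rw [hB, transpose_mul, gammaMat_transpose]; simp only [Matrix.mul_assoc]
    rw [this, gammaMat_mul, Matrix.mul_one, h1]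
  have g2 : Bᵀ * hess u x * B = slope u x • diagonal (principalCurvatures u x) := by
    have e : hess u x = slope u x • secondFundForm u x := by
      rw [secondFundForm, smul_smul, mul_inv_cancel₀ (slope_pos u x).ne', one_smul]
    have : Bᵀ * hess u x * B = slope u x • (Oᵀ * curvatureMatrix u x * O) := by
      rw [e, curvatureMatrix_eq, hB, transpose_mul, gammaMat_transpose]
      simp only [Matrix.mul_assoc, Matrix.mul_smul, Matrix.smul_mul]
    rw [this, h3]
    congr 1
    calc Oᵀ * (O * diagonal (eigenvalueVec (curvatureMatrix u x)) * Oᵀ) * O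
        = (Oᵀ * O) * diagonal (eigenvalueVec (curvatureMatrix u x)) * (Oᵀ * O) := by
          simp only [Matrix.mul_assoc]
      _ = _ := by rw [h1]; simp [principalCurvatures]
  refine ⟨fun j => WithLp.toLp 2 fun i => B i j, fun i j => ?_, fun i j => ?_⟩
  · have := congrFun (congrFun g1 i) j
    rw [one_apply] at this
    rw [← this, Matrix.mul_add, Matrix.add_mul, Matrix.mul_one]
    rw [Matrix.add_apply]
    simp only [PiLp.inner_apply, gradVec, Matrix.mul_apply, transpose_apply,
      vecMulVec_apply, RCLike.inner_apply, conj_trivial]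
    congr 1
    · exact sum_congr rfl fun _ _ => mul_comm _ _
    · rw [sum_mul_sum, sum_comm]
      refine sum_congr rfl fun a _ => ?_
      rw [sum_mul]
      exact sum_congr rfl fun c _ => by ring
  · have := congrFun (congrFun g2 i) j
    rw [snd_fderiv_eq_sum]
    have e : (slope u x • diagonal (principalCurvatures u x)) i j =
        if i = j then slope u x * principalCurvatures u x i else 0 := by
      simp [diagonal_apply]
    rw [← e, ← this]
    simp only [Matrix.mul_apply, transpose_apply, sum_mul]
    rw [sum_comm]
    exact sum_congr rfl fun a _ => sum_congr rfl fun c _ => by ring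

/-- The lifts `(b i, ⟪p, b i⟫)` and the unit normal `(-p, 1) / √(1 + ‖p‖²)` form an orthonormal
basis of `ℝ^{n+1}`. The identity is Parseval's for the vectors `(z, s)` and `(z', s')`. -/
lemma IsFrame.parseval {p : E} {b : Fin n → E} (h : IsFrame p b) (z z' : E) (s s' : ℝ) :
    ⟪z, z'⟫ + s * s' = ∑ i, (⟪z, b i⟫ + s * ⟪p, b i⟫) * (⟪z', b i⟫ + s' * ⟪p, b i⟫) +
      (1 + ‖p‖ ^ 2)⁻¹ * (s - ⟪p, z⟫) * (s' - ⟪p, z'⟫) := by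
  have hw0 : 0 < 1 + ‖p‖ ^ 2 := by positivity
  set r := (√(1 + ‖p‖ ^ 2))⁻¹ with hr
  have hr2 : r * r = (1 + ‖p‖ ^ 2)⁻¹ := by
    rw [hr, ← mul_inv, Real.mul_self_sqrt hw0.le]
  let c : Option (Fin n) → WithLp 2 (E × ℝ) := fun o =>
    o.elim (WithLp.toLp 2 (-r • p, r)) fun i => WithLp.toLp 2 (b i, ⟪p, b i⟫)
  have hc : Orthonormal ℝ c := by
    rw [orthonormal_iff_ite]
    rintro (_ | i) (_ | j)
    · simp only [c, Option.elim_none, WithLp.prod_inner_apply, inner_smul_left, inner_smul_right,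
        real_inner_self_eq_norm_sq, if_true]
      have e : ‖r‖ ^ 2 = r * r := by rw [Real.norm_eq_abs, sq_abs, sq]
      have : r * r * (1 + ‖p‖ ^ 2) = 1 := by rw [hr2]; exact inv_mul_cancel₀ hw0.ne'
      simp only [conj_trivial, e]
      linarith
    · simp [c, WithLp.prod_inner_apply, inner_smul_left]; ring
    · simp [c, WithLp.prod_inner_apply, inner_smul_right, real_inner_comm]
    · simp only [c, Option.elim_some, WithLp.prod_inner_apply, RCLike.inner_apply, conj_trivial,
        Option.some.injEq]
      rw [← h i j]; ring
  have hcard : Fintype.card (Option (Fin n)) = Module.finrank ℝ (WithLp 2 (E × ℝ)) := by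
    rw [(WithLp.linearEquiv 2 ℝ (E × ℝ)).finrank_eq]; simp
  let ob : OrthonormalBasis (Option (Fin n)) ℝ (WithLp 2 (E × ℝ)) :=
    OrthonormalBasis.mk hc (by
      have := (basisOfOrthonormalOfCardEqFinrank hc hcard).span_eq
      rw [coe_basisOfOrthonormalOfCardEqFinrank] at this
      exact this.ge)
  have hob : ∀ o, ob o = c o := fun o => by simp [ob]
  have := ob.sum_inner_mul_inner (WithLp.toLp 2 (z, s)) (WithLp.toLp 2 (z', s'))
  rw [WithLp.prod_inner_apply] at this
  have e : ⟪z, z'⟫ + s * s' = ⟪z, z'⟫ + ⟪s, s'⟫ := by simp [mul_comm]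
  rw [e]
  refine this.symm.trans ?_
  rw [Fintype.sum_option, add_comm]
  simp only [hob, c, Option.elim_some, Option.elim_none, WithLp.prod_inner_apply,
    RCLike.inner_apply, conj_trivial, inner_smul_left, inner_smul_right]
  rw [← hr2]
  congr 1
  · refine sum_congr rfl fun i _ => ?_
    rw [real_inner_comm z' (b i)]
    ring
  · rw [real_inner_comm p z]; ring

lemma IsFrame.norm_add_sq {p : E} {b : Fin n → E} (h : IsFrame p b) (i : Fin n) :
    ‖b i‖ ^ 2 + ⟪p, b i⟫ ^ 2 = 1 := by
  have := h i i
  rw [if_pos rfl, real_inner_self_eq_norm_sq] at this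
  linarith

lemma IsFrame.norm_le_one {p : E} {b : Fin n → E} (h : IsFrame p b) (i : Fin n) :
    ‖b i‖ ≤ 1 := by
  have := h.norm_add_sq i
  nlinarith [sq_nonneg ⟪p, b i⟫, norm_nonneg (b i)]

lemma IsFrame.abs_inner_le_one {p : E} {b : Fin n → E} (h : IsFrame p b) (i : Fin n) :
    |⟪p, b i⟫| ≤ 1 := by
  have := h.norm_add_sq i
  rw [abs_le_one_iff_mul_self_le_one]
  nlinarith [sq_nonneg ‖b i‖]

/-- Expansion of a vector in a frame, for the metric `1 + p pᵀ`. -/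
lemma IsFrame.expand {p : E} {b : Fin n → E} (h : IsFrame p b) (z : E) :
    z = ∑ i, (⟪z, b i⟫ + ⟪p, z⟫ * ⟪p, b i⟫) • b i := by
  refine ext_inner_right ℝ fun z' => ?_
  have := h.parseval z z' ⟪p, z⟫ 0
  simp only [sub_self, mul_zero, zero_mul, add_zero] at this
  rw [this, sum_inner]
  refine sum_congr rfl fun i _ => ?_
  rw [inner_smul_left, real_inner_comm z' (b i)]; simp

/-- The Rayleigh quotient bound by the largest principal curvature. -/
lemma IsFrame.rayleigh_le {p : E} {b : Fin n → E} (h : IsFrame p b) {B : E →L[ℝ] E →L[ℝ] ℝ}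
    {κ : Fin n → ℝ} (hB : ∀ i j, B (b i) (b j) = if i = j then κ i else 0) {c : ℝ}
    (hκ : ∀ i, κ i ≤ c) (z : E) : B z z ≤ c * (‖z‖ ^ 2 + ⟪p, z⟫ ^ 2) := by
  set a : Fin n → ℝ := fun i => ⟪z, b i⟫ + ⟪p, z⟫ * ⟪p, b i⟫ with ha
  have hz : z = ∑ i, a i • b i := h.expand z
  have h1 : B z z = ∑ i, κ i * a i ^ 2 := by
    conv_lhs => rw [hz]
    simp only [map_sum, _root_.sum_apply, map_smul, _root_.smul_apply,
      hB, smul_eq_mul, mul_ite, mul_zero]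
    refine sum_congr rfl fun i _ => ?_
    rw [sum_eq_single i (fun j _ hj => by rw [if_neg hj]) (by simp)]
    simp; ring
  have h2 : ‖z‖ ^ 2 + ⟪p, z⟫ ^ 2 = ∑ i, a i ^ 2 := by
    have := h.parseval z z ⟪p, z⟫ ⟪p, z⟫
    rw [real_inner_self_eq_norm_sq] at this
    simp only [sub_self, mul_zero, add_zero] at this
    rw [sq ⟪p, z⟫, this]
    exact sum_congr rfl fun i _ => by simp only [ha]; ring
  rw [h1, h2, mul_sum]
  exact sum_le_sum fun i _ => mul_le_mul_of_nonneg_right (hκ i) (sq_nonneg _)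

/-- The contraction of `σ_k^{ij}` with the Hessian of a `(k + 1)`-convex function, restricted to
the tangent space of the graph, is nonnegative. -/
lemma IsFrame.sum_mul_nonneg {p : E} {b : Fin n → E} (h : IsFrame p b) {k : ℕ}
    {κ : Fin n → ℝ} (hκ : InCone univ (k + 1) κ) {V : Matrix (Fin n) (Fin n) ℝ}
    (hV : V.IsHermitian) (hc : eigenvalueVec V ∈ closure (gardingCone n (k + 2))) :
    0 ≤ ∑ i, es (univ.erase i) k κ * ∑ a, ∑ c, b i a * b i c * V a c := by
  obtain ⟨O, h1, h2, h3⟩ := exists_orthogonal hV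
  set l := eigenvalueVec V with hl
  let v : Fin n → E := fun j => WithLp.toLp 2 fun a => O a j
  have hvin : ∀ (z : E) j, ⟪z, v j⟫ = ∑ a, z a * O a j := fun z j => by
    simp [v, PiLp.inner_apply, mul_comm]
  have hvv : ∀ j, ⟪v j, v j⟫ = 1 := fun j => by
    have := congrFun (congrFun h1 j) j
    rw [hvin, ← one_apply_eq (α := ℝ) j, ← this]
    simp [v, Matrix.mul_apply]
  have hpars : ∀ z : E, ∑ j, ⟪z, v j⟫ ^ 2 = ‖z‖ ^ 2 := fun z => by
    have e : ∀ j, ⟪z, v j⟫ ^ 2 = ∑ a, ∑ c, z a * z c * (O a j * O c j) := fun j => by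
      rw [hvin, sq, sum_mul_sum]
      exact sum_congr rfl fun a _ => sum_congr rfl fun c _ => by ring
    rw [sum_congr rfl fun j _ => e j, sum_comm, EuclideanSpace.norm_sq_eq]
    refine sum_congr rfl fun a _ => ?_
    rw [sum_comm]
    have e2 : ∀ c, ∑ j, z a * z c * (O a j * O c j) = z a * z c * if a = c then 1 else 0 := by
      intro c
      have := congrFun (congrFun h2 a) c
      rw [one_apply] at this
      rw [← mul_sum, ← this]
      simp [Matrix.mul_apply]
    simp [e2, sq]
  have hquad : ∀ z : E, ∑ a, ∑ c, z a * z c * V a c = ∑ j, l j * ⟪z, v j⟫ ^ 2 := fun z => by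
    have e : ∀ a c, V a c = ∑ j, O a j * l j * O c j := fun a c => by
      rw [h3]; simp [Matrix.mul_apply, diagonal_apply]
    have e1 : ∀ j, l j * ⟪z, v j⟫ ^ 2 = ∑ a, ∑ c, z a * z c * (O a j * l j * O c j) := fun j => by
      rw [hvin, sq, sum_mul_sum, mul_sum]
      refine sum_congr rfl fun a _ => ?_
      rw [mul_sum]
      exact sum_congr rfl fun c _ => by ring
    symm
    rw [sum_congr rfl fun j _ => e1 j, sum_comm]
    refine sum_congr rfl fun a _ => ?_
    rw [sum_comm]
    refine sum_congr rfl fun c _ => ?_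
    rw [e, mul_sum]
  simp only [hquad]
  set r2 := (1 + ‖p‖ ^ 2)⁻¹ with hr2
  have hr2pos : 0 < r2 := by positivity
  -- Squared inner products of two orthonormal bases of `ℝ^{n+1}`: the frame completed by the normal
  -- (index `none`), and the eigenvectors of `V` extended by zero, completed by the vertical vector.
  -- Such a matrix is doubly stochastic, and it maps `(l, 0)` to the diagonal of the extended form
  -- in the first basis.
  let S : Matrix (Option (Fin n)) (Option (Fin n)) ℝ := of fun o o' =>
    match o, o' with
    | some i, some j => ⟪b i, v j⟫ ^ 2
    | none, some j => r2 * ⟪p, v j⟫ ^ 2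
    | some i, none => ⟪p, b i⟫ ^ 2
    | none, none => r2
  have hS : S ∈ doublyStochastic ℝ (Option (Fin n)) := by
    rw [mem_doublyStochastic_iff_sum]
    refine ⟨?_, ?_, ?_⟩
    · rintro (_ | i) (_ | j) <;> simp only [S, of_apply] <;> positivity
    · rintro (_ | i)
      · simp only [Fintype.sum_option, S, of_apply]
        rw [← mul_sum, hpars, hr2]
        field_simp
      · simp only [Fintype.sum_option, S, of_apply]
        rw [hpars]
        linarith [h.norm_add_sq i]
    · rintro (_ | j)
      · simp only [Fintype.sum_option, S, of_apply]
        have := h.parseval 0 0 1 1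
        simp only [inner_zero_left, inner_zero_right] at this
        have e : ∑ i, ⟪p, b i⟫ ^ 2 = ∑ i, (0 + 1 * ⟪p, b i⟫) * (0 + 1 * ⟪p, b i⟫) :=
          sum_congr rfl fun i _ => by ring
        rw [e]; linarith
      · simp only [Fintype.sum_option, S, of_apply]
        have := h.parseval (v j) (v j) 0 0
        rw [hvv] at this
        have e : ∑ i, ⟪b i, v j⟫ ^ 2 =
            ∑ i, (⟪v j, b i⟫ + 0 * ⟪p, b i⟫) * (⟪v j, b i⟫ + 0 * ⟪p, b i⟫) :=
          sum_congr rfl fun i _ => by rw [real_inner_comm (v j) (b i)]; ring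
        rw [e]; linarith
  -- By Birkhoff's theorem this diagonal is an average of rearrangements of `(l, 0)`. The normal
  -- entry is dropped, and Gårding's inequality applies to each rearrangement.
  obtain ⟨w, hw0, -, hw⟩ := exists_eq_sum_perm_of_mem_doublyStochastic hS
  have hSij : ∀ i j, ⟪b i, v j⟫ ^ 2 =
      ∑ τ : Equiv.Perm (Option (Fin n)), w τ * if τ (some i) = some j then 1 else 0 := by
    intro i j
    have := congrFun (congrFun hw (some i)) (some j)
    simp only [S, of_apply] at this
    rw [← this, Matrix.sum_apply]
    refine sum_congr rfl fun τ _ => ?_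
    simp [Equiv.Perm.permMatrix, Equiv.toPEquiv_apply, eq_comm]
  have key : ∑ i, es (univ.erase i) k κ * ∑ j, l j * ⟪b i, v j⟫ ^ 2 =
      ∑ τ : Equiv.Perm (Option (Fin n)), w τ *
        ∑ i, (τ (some i)).elim 0 l * es (univ.erase i) k κ := by
    have e1 : ∀ (τ : Equiv.Perm (Option (Fin n))) i, (τ (some i)).elim 0 l =
        ∑ j, l j * if τ (some i) = some j then 1 else 0 := by
      intro τ i
      cases τ (some i) with
      | none => simp
      | some m => simp
    simp only [hSij, e1, mul_sum, sum_mul]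
    have e2 : ∀ i, ∑ j, ∑ τ : Equiv.Perm (Option (Fin n)), es (univ.erase i) k κ *
        (l j * (w τ * if τ (some i) = some j then 1 else 0)) =
        ∑ τ : Equiv.Perm (Option (Fin n)), ∑ j, w τ *
          ((l j * if τ (some i) = some j then 1 else 0) * es (univ.erase i) k κ) := by
      intro i
      rw [sum_comm]
      exact sum_congr rfl fun τ _ => sum_congr rfl fun j _ => by ring
    rw [sum_congr rfl fun i _ => e2 i, sum_comm]
  rw [key]
  refine sum_nonneg fun τ _ => mul_nonneg (hw0 τ) ?_
  exact sum_mul_es_erase_nonneg_of_option hκ hc fun i j hij => by simpa using hij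

end Frames

end KCurvature

namespace KCurvature

open Finset Filter Topology Matrix

/-! ### The graph rewritten over its tangent plane -/

section TangentChart

variable {n : ℕ}

local notation "E" => EuclideanSpace ℝ (Fin n)

open scoped RealInnerProductSpace

/-- The linear map with `e_i ↦ b_i`. -/
noncomputable def frameMap (b : Fin n → E) : E →L[ℝ] E :=
  ∑ i, (EuclideanSpace.proj i : E →L[ℝ] ℝ).smulRight (b i)

lemma frameMap_apply (b : Fin n → E) (y : E) : frameMap b y = ∑ i, y i • b i := by
  simp [frameMap, _root_.sum_apply]

lemma frameMap_single (b : Fin n → E) (i : Fin n) :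
    frameMap b (EuclideanSpace.single i 1) = b i := by
  rw [frameMap_apply]
  simp [Finset.sum_ite_eq', PiLp.single_apply]

/-- The horizontal coordinates of the point of the graph lying over the point `y` of the tangent
plane, when the graph is written over its tangent plane as the graph of `U`. -/
noncomputable def chartMap (x₀ p : E) (b : Fin n → E) (U : E → ℝ) (y : E) : E :=
  x₀ + frameMap b y - ((1 + ‖p‖ ^ 2)⁻¹ * √(1 + ‖p‖ ^ 2) * U y) • p

/-- `U` describes the graph of `u` near `x₀` as a graph over its tangent plane. -/
structure IsTangentChart (u : E → ℝ) (x₀ : E) (b : Fin n → E) (U : E → ℝ) : Prop where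
  contDiffAt : ContDiffAt ℝ 4 U 0
  zero : U 0 = 0
  fderiv_zero : fderiv ℝ U 0 = 0
  eq : ∀ᶠ y in 𝓝 0, u (chartMap x₀ (gradVec u x₀) b U y) =
    u x₀ + ⟪gradVec u x₀, frameMap b y⟫ +
      (1 + ‖gradVec u x₀‖ ^ 2)⁻¹ * √(1 + ‖gradVec u x₀‖ ^ 2) * U y

/-- The height `R` of the graph above its tangent plane is a vertical displacement. Its tangential
part has coordinates `R q` in the frame and its normal part is `R / W`. Hence the tangent
coordinates are `Θ y = y + R y • q`, and `U = W⁻¹ R ∘ Θ⁻¹`. The local inverse exists because `R` has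
vanishing derivative at `0`, so that `Θ` has derivative `id`. -/
lemma exists_tangentChart {u : E → ℝ} {x₀ : E} (hu : ContDiffAt ℝ 4 u x₀) {b : Fin n → E}
    (hb : IsFrame (gradVec u x₀) b) : ∃ U, IsTangentChart u x₀ b U := by
  set p := gradVec u x₀ with hp
  have hw0 : 0 < 1 + ‖p‖ ^ 2 := by positivity
  set W := √(1 + ‖p‖ ^ 2) with hW
  have hWpos : 0 < W := Real.sqrt_pos.2 hw0
  have hW2 : W ^ 2 = 1 + ‖p‖ ^ 2 := Real.sq_sqrt hw0.le
  let q : E := WithLp.toLp 2 fun i => ⟪p, b i⟫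
  have hLq : frameMap b q = (W ^ 2)⁻¹ • p := by
    refine ext_inner_right ℝ fun z => ?_
    have := hb.parseval z 0 0 1
    simp only [inner_zero_right, inner_zero_left, zero_mul, zero_add, one_mul, sub_zero, mul_one,
      add_zero, zero_sub] at this
    rw [frameMap_apply, sum_inner, inner_smul_left, hW2]
    simp only [q, inner_smul_left, conj_trivial]
    have e : ∑ i, ⟪p, b i⟫ * ⟪b i, z⟫ = ∑ i, ⟪z, b i⟫ * ⟪p, b i⟫ :=
      sum_congr rfl fun i _ => by rw [real_inner_comm z (b i), mul_comm]
    rw [e]; linarith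
  have hq1 : ⟪p, frameMap b q⟫ = 1 - (W ^ 2)⁻¹ := by
    rw [hLq, inner_smul_right, real_inner_self_eq_norm_sq]
    have : ‖p‖ ^ 2 = W ^ 2 - 1 := by linarith
    rw [this]; field_simp
  let R : E → ℝ := fun y => u (x₀ + frameMap b y) - u x₀ - ⟪p, frameMap b y⟫
  have hR4 : ContDiffAt ℝ 4 R 0 := by
    have h1 : ContDiffAt ℝ 4 (fun y => u (x₀ + frameMap b y)) 0 := by
      refine ContDiffAt.comp (g := u) (0 : E) (by simpa using hu) ?_
      exact (contDiff_const.add (frameMap b).contDiff).contDiffAt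
    exact (h1.sub contDiffAt_const).sub
      ((contDiff_const.inner ℝ (frameMap b).contDiff).contDiffAt)
  have hR0 : R 0 = 0 := by simp [R]
  have hR' : HasFDerivAt R (0 : E →L[ℝ] ℝ) 0 := by
    have h1 : HasFDerivAt (fun y => x₀ + frameMap b y) (frameMap b) 0 :=
      (frameMap b).hasFDerivAt.const_add x₀
    have h2 : HasFDerivAt u (fderiv ℝ u x₀) (x₀ + frameMap b 0) := by
      simpa using (hu.differentiableAt (by norm_num)).hasFDerivAt
    have h3 : HasFDerivAt (fun y => ⟪p, frameMap b y⟫) ((innerSL ℝ p).comp (frameMap b)) 0 :=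
      ((innerSL ℝ p).comp (frameMap b)).hasFDerivAt
    refine (((h2.comp 0 h1).sub_const (u x₀)).sub h3).congr_fderiv ?_
    ext z
    simp [fderiv_eq_inner, ← hp]
  let Θ : E → E := fun y => y + R y • q
  have hΘ4 : ContDiffAt ℝ 4 Θ 0 := contDiffAt_id.add (hR4.smul contDiffAt_const)
  have hΘ' : HasFDerivAt Θ ((ContinuousLinearEquiv.refl ℝ E : E ≃L[ℝ] E) : E →L[ℝ] E) 0 := by
    refine ((hasFDerivAt_id (0 : E)).add (hR'.smul_const q)).congr_fderiv ?_
    ext z; simp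
  have hΘ0 : Θ 0 = 0 := by simp [Θ, hR0]
  let θ : E → E := hΘ4.localInverse hΘ' (by norm_num)
  have hθ4 : ContDiffAt ℝ 4 θ 0 := by
    have := hΘ4.to_localInverse hΘ' (by norm_num)
    rwa [hΘ0] at this
  have hθ0 : θ 0 = 0 := by
    have := hΘ4.localInverse_apply_image hΘ' (by norm_num)
    rwa [hΘ0] at this
  have hinv : ∀ᶠ y in 𝓝 0, Θ (θ y) = y := by
    have := (hΘ4.hasStrictFDerivAt' hΘ' (by norm_num)).eventually_right_inverse
    rwa [hΘ0] at this
  refine ⟨fun y => W⁻¹ * R (θ y), ?_, ?_, ?_, ?_⟩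
  · refine contDiffAt_const.mul (ContDiffAt.comp (g := R) (0 : E) ?_ hθ4)
    rwa [hθ0]
  · simp [hθ0, hR0]
  · have h1 : HasFDerivAt R (0 : E →L[ℝ] ℝ) (θ 0) := by rwa [hθ0]
    have h2 := (h1.comp 0 (hθ4.differentiableAt (by norm_num)).hasFDerivAt).const_mul W⁻¹
    have h3 : HasFDerivAt (fun y => W⁻¹ * R (θ y)) (0 : E →L[ℝ] ℝ) 0 :=
      h2.congr_fderiv (by simp)
    exact h3.fderiv
  · filter_upwards [hinv] with y hy
    have hfy : frameMap b y = frameMap b (θ y) + (R (θ y) * (W ^ 2)⁻¹) • p := by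
      conv_lhs => rw [← hy]
      simp only [Θ, map_add, map_smul, hLq, smul_smul]
    have hc : chartMap x₀ p b (fun y => W⁻¹ * R (θ y)) y = x₀ + frameMap b (θ y) := by
      rw [chartMap, hfy, ← hW2, Real.sqrt_sq hWpos.le]
      have : (W ^ 2)⁻¹ * W * (W⁻¹ * R (θ y)) = R (θ y) * (W ^ 2)⁻¹ := by field_simp
      rw [this]; abel
    rw [hc, ← hW, ← hW2]
    have e1 : ⟪p, frameMap b y⟫ = ⟪p, frameMap b (θ y)⟫ + R (θ y) * (1 - (W ^ 2)⁻¹) := by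
      conv_lhs => rw [← hy]
      simp only [Θ, map_add, map_smul, inner_add_right, inner_smul_right, hq1]
    rw [e1]
    have e2 : u (x₀ + frameMap b (θ y)) = R (θ y) + u x₀ + ⟪p, frameMap b (θ y)⟫ := by
      simp only [R]; ring
    rw [e2]; field_simp; ring

namespace IsTangentChart

variable {u U : EuclideanSpace ℝ (Fin n) → ℝ} {x₀ : EuclideanSpace ℝ (Fin n)}
  {b : Fin n → EuclideanSpace ℝ (Fin n)}

/-- The coordinate vector fields of the chart. -/
noncomputable def chartVec (p : E) (b : Fin n → E) (U : E → ℝ) (y : E) (i : Fin n) : E :=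
  b i - ((1 + ‖p‖ ^ 2)⁻¹ * √(1 + ‖p‖ ^ 2) * grad U y i) • p

lemma chartMap_zero (h : IsTangentChart u x₀ b U) :
    chartMap x₀ (gradVec u x₀) b U 0 = x₀ := by
  simp [chartMap, h.zero]

lemma hasFDerivAt_chartMap {p y : E} (hU : DifferentiableAt ℝ U y) :
    HasFDerivAt (chartMap x₀ p b U) (frameMap b -
      (((1 + ‖p‖ ^ 2)⁻¹ * √(1 + ‖p‖ ^ 2)) • fderiv ℝ U y).smulRight p) y := by
  refine ((frameMap b).hasFDerivAt.const_add x₀).sub ?_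
  refine ((hU.hasFDerivAt.const_mul ((1 + ‖p‖ ^ 2)⁻¹ * √(1 + ‖p‖ ^ 2))).smul_const p)

lemma fderiv_chartMap_single {p y : E} (hU : DifferentiableAt ℝ U y) (i : Fin n) :
    fderiv ℝ (chartMap x₀ p b U) y (EuclideanSpace.single i 1) = chartVec p b U y i := by
  rw [(hasFDerivAt_chartMap hU).fderiv]
  simp [frameMap_single, chartVec, grad]

lemma continuousAt_chartMap (h : IsTangentChart u x₀ b U) :
    ContinuousAt (chartMap x₀ (gradVec u x₀) b U) 0 :=
  (hasFDerivAt_chartMap (h.contDiffAt.differentiableAt (by norm_num))).continuousAt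

lemma tendsto_chartMap (h : IsTangentChart u x₀ b U) :
    Tendsto (chartMap x₀ (gradVec u x₀) b U) (𝓝 0) (𝓝 x₀) := by
  have := h.continuousAt_chartMap.tendsto
  rwa [h.chartMap_zero] at this

lemma eventually_contDiffAt (h : IsTangentChart u x₀ b U) : ∀ᶠ y in 𝓝 0, ContDiffAt ℝ 4 U y :=
  h.contDiffAt.eventually (by norm_num)

/-- Differentiating the chart equation computes the vertical component of a coordinate vector in two
ways. -/
lemma eventually_inner (h : IsTangentChart u x₀ b U) (hu : ContDiffAt ℝ 4 u x₀) :
    ∀ᶠ y in 𝓝 0, ∀ i, ⟪gradVec u (chartMap x₀ (gradVec u x₀) b U y),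
        chartVec (gradVec u x₀) b U y i⟫ = ⟪gradVec u x₀, b i⟫ +
      (1 + ‖gradVec u x₀‖ ^ 2)⁻¹ * √(1 + ‖gradVec u x₀‖ ^ 2) * grad U y i := by
  have h4 : ∀ᶠ x in 𝓝 x₀, ContDiffAt ℝ 4 u x := hu.eventually (by norm_num)
  filter_upwards [h.eq.eventually_nhds, h.tendsto_chartMap.eventually h4,
    h.eventually_contDiffAt] with y hy hux hUy i
  have hUd := hUy.differentiableAt (by norm_num)
  have h1 := (hux.differentiableAt (by norm_num)).hasFDerivAt.comp y
    (hasFDerivAt_chartMap (x₀ := x₀) (p := gradVec u x₀) (b := b) hUd)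
  have h2 : HasFDerivAt (fun y => u x₀ + ⟪gradVec u x₀, frameMap b y⟫ +
      (1 + ‖gradVec u x₀‖ ^ 2)⁻¹ * √(1 + ‖gradVec u x₀‖ ^ 2) * U y)
      ((innerSL ℝ (gradVec u x₀)).comp (frameMap b) +
        ((1 + ‖gradVec u x₀‖ ^ 2)⁻¹ * √(1 + ‖gradVec u x₀‖ ^ 2)) • fderiv ℝ U y) y :=
    (((innerSL ℝ (gradVec u x₀)).comp (frameMap b)).hasFDerivAt.const_add (u x₀)).add
      (hUd.hasFDerivAt.const_mul _)
  have h3 := (h1.congr_of_eventuallyEq (hy.mono fun z hz => hz.symm)).unique h2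
  have h5 := congrArg (fun L : E →L[ℝ] ℝ => L (EuclideanSpace.single i 1)) h3
  have h6 := fderiv_chartMap_single (x₀ := x₀) (p := gradVec u x₀) (b := b) hUd i
  rw [(hasFDerivAt_chartMap hUd).fderiv] at h6
  simp only [ContinuousLinearMap.comp_apply, h6] at h5
  rw [← fderiv_eq_inner, h5]
  simp [frameMap_single, grad]

/-- The factor relating the Hessians of the two graph functions. -/
noncomputable def chartFactor (p P : E) : ℝ :=
  (1 + ‖p‖ ^ 2)⁻¹ * √(1 + ‖p‖ ^ 2) * (1 + ⟪p, P⟫)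

/-- One more differentiation of `eventually_inner`. Second derivatives of the chart are multiples of
the fixed vector `p = gradVec u x₀`; they contribute the summand with `⟪p, P⟫` in `chartFactor`. -/
lemma eventually_hess (h : IsTangentChart u x₀ b U) (hu : ContDiffAt ℝ 4 u x₀) :
    ∀ᶠ y in 𝓝 0, ∀ i j, fderiv ℝ (fderiv ℝ u) (chartMap x₀ (gradVec u x₀) b U y)
        (chartVec (gradVec u x₀) b U y i) (chartVec (gradVec u x₀) b U y j) =
      chartFactor (gradVec u x₀) (gradVec u (chartMap x₀ (gradVec u x₀) b U y)) *
        hess U y i j := by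
  have h4 : ∀ᶠ x in 𝓝 x₀, ContDiffAt ℝ 4 u x := hu.eventually (by norm_num)
  filter_upwards [(h.eventually_inner hu).eventually_nhds, h.tendsto_chartMap.eventually h4,
    h.eventually_contDiffAt] with y hy hux hUy i j
  have hUd := hUy.differentiableAt (by norm_num)
  have hUdd : DifferentiableAt ℝ (fderiv ℝ U) y :=
    (hUy.fderiv_right (m := 3) (by norm_num)).differentiableAt (by norm_num)
  have hudd : DifferentiableAt ℝ (fderiv ℝ u) (chartMap x₀ (gradVec u x₀) b U y) :=
    (hux.fderiv_right (m := 3) (by norm_num)).differentiableAt (by norm_num)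
  set c := (1 + ‖gradVec u x₀‖ ^ 2)⁻¹ * √(1 + ‖gradVec u x₀‖ ^ 2) with hc
  have hg : HasFDerivAt (fun y => grad U y j)
      ((ContinuousLinearMap.apply ℝ ℝ (EuclideanSpace.single j 1)).comp
        (fderiv ℝ (fderiv ℝ U) y)) y :=
    (ContinuousLinearMap.apply ℝ ℝ
      (EuclideanSpace.single j (1 : ℝ))).hasFDerivAt.comp y hUdd.hasFDerivAt
  have hJ : HasFDerivAt (fun y => chartVec (gradVec u x₀) b U y j)
      (-((c • ((ContinuousLinearMap.apply ℝ ℝ (EuclideanSpace.single j 1)).comp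
        (fderiv ℝ (fderiv ℝ U) y))).smulRight (gradVec u x₀))) y := by
    refine (((hg.const_mul c).smul_const (gradVec u x₀)).const_sub (b j))
  have hX := hasFDerivAt_chartMap (x₀ := x₀) (p := gradVec u x₀) (b := b) hUd
  have h1 := (hudd.hasFDerivAt.comp y hX).clm_apply hJ
  have h2 := (hg.const_mul c).const_add ⟪gradVec u x₀, b j⟫
  have h3 := (h1.congr_of_eventuallyEq (hy.mono fun z hz => by
    simp only [Function.comp_apply]
    rw [fderiv_eq_inner, hz j])).unique h2
  have h5 := congrArg (fun L : E →L[ℝ] ℝ => L (EuclideanSpace.single i 1)) h3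
  have h6 := fderiv_chartMap_single (x₀ := x₀) (p := gradVec u x₀) (b := b) hUd i
  rw [hX.fderiv] at h6
  simp only [_root_.add_apply, ContinuousLinearMap.comp_apply, ContinuousLinearMap.flip_apply,
    h6, _root_.neg_apply, ContinuousLinearMap.smulRight_apply, _root_.smul_apply,
    ContinuousLinearMap.apply_apply, map_neg, map_smul, Function.comp_apply, smul_eq_mul] at h5
  rw [fderiv_eq_inner, real_inner_comm] at h5
  rw [chartFactor, ← hc]
  simp only [hess, of_apply]
  linarith

end IsTangentChart

end TangentChart

end KCurvature

namespace KCurvature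

open Finset Filter Topology Matrix

/-! ### Geometric quantities in the tangent chart -/

section ChartGeometry

variable {n : ℕ}

local notation "E" => EuclideanSpace ℝ (Fin n)

open scoped RealInnerProductSpace

lemma contDiffAt_hess_isHermitian {u : E → ℝ} {x : E} (hu : ContDiffAt ℝ 2 u x) :
    (hess u x).IsHermitian := by
  refine hess_isHermitian ?_ ?_
  · have : ∀ᶠ y in 𝓝 x, ContDiffAt ℝ 2 u y := hu.eventually (by norm_num)
    exact this.mono fun y hy => hy.differentiableAt (by norm_num)
  · exact (hu.fderiv_right (m := 1) (by norm_num)).differentiableAt (by norm_num)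

namespace IsTangentChart

lemma coeff_sq (p : E) : ((1 + ‖p‖ ^ 2)⁻¹ * √(1 + ‖p‖ ^ 2)) ^ 2 = (1 + ‖p‖ ^ 2)⁻¹ := by
  have : 0 < 1 + ‖p‖ ^ 2 := by positivity
  rw [mul_pow, Real.sq_sqrt this.le]
  field_simp

lemma coeff_eq (p : E) : (1 + ‖p‖ ^ 2)⁻¹ * √(1 + ‖p‖ ^ 2) = (√(1 + ‖p‖ ^ 2))⁻¹ := by
  have : 0 < 1 + ‖p‖ ^ 2 := by positivity
  have h := Real.mul_self_sqrt this.le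
  have h0 := Real.sqrt_pos.2 this
  rw [inv_mul_eq_iff_eq_mul₀ this.ne']
  field_simp
  linarith

variable {p P : EuclideanSpace ℝ (Fin n)} {b : Fin n → EuclideanSpace ℝ (Fin n)}
  {U : EuclideanSpace ℝ (Fin n) → ℝ} {y : EuclideanSpace ℝ (Fin n)}

lemma inner_sub (h : ∀ i, ⟪P, chartVec p b U y i⟫ = ⟪p, b i⟫ +
    (1 + ‖p‖ ^ 2)⁻¹ * √(1 + ‖p‖ ^ 2) * grad U y i) (i : Fin n) :
    ⟪P, b i⟫ - ⟪p, b i⟫ = chartFactor p P * grad U y i := by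
  have := h i
  rw [chartVec, inner_sub_right, inner_smul_right, real_inner_comm p P] at this
  rw [chartFactor]
  linarith

/-- Parseval's identity for `(-P, 1)` with itself: its frame components are multiples of the `grad U
y i` by `inner_sub`. -/
lemma factor_mul_slope (hb : IsFrame p b) (h : ∀ i, ⟪P, chartVec p b U y i⟫ = ⟪p, b i⟫ +
    (1 + ‖p‖ ^ 2)⁻¹ * √(1 + ‖p‖ ^ 2) * grad U y i) (hm : 0 < chartFactor p P) :
    chartFactor p P * slope U y = √(1 + ‖P‖ ^ 2) := by
  have h1 := hb.parseval (-P) (-P) 1 1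
  simp only [inner_neg_left, inner_neg_right, neg_neg, one_mul, sub_neg_eq_add,
    real_inner_self_eq_norm_sq] at h1
  have e1 : ∀ i, (-⟪P, b i⟫ + ⟪p, b i⟫) * (-⟪P, b i⟫ + ⟪p, b i⟫) =
      chartFactor p P ^ 2 * grad U y i ^ 2 := fun i => by
    have := inner_sub h i
    rw [← mul_pow, ← this]; ring
  rw [sum_congr rfl fun i _ => e1 i, ← mul_sum] at h1
  have e2 : chartFactor p P ^ 2 = (1 + ‖p‖ ^ 2)⁻¹ * (1 + ⟪p, P⟫) * (1 + ⟪p, P⟫) := by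
    rw [chartFactor, mul_pow, coeff_sq]; ring
  rw [← e2] at h1
  symm
  rw [Real.sqrt_eq_iff_mul_self_eq (by positivity) (mul_nonneg hm.le (slope_pos U y).le)]
  have e3 : slope U y ^ 2 = 1 + ∑ i, grad U y i ^ 2 :=
    Real.sq_sqrt (by have := sum_nonneg fun i (_ : i ∈ univ) => sq_nonneg (grad U y i); linarith)
  nlinarith

/-- Parseval's identity for `(-P, 1)` against the vertical vector, divided by the length found in
`factor_mul_slope`: this is the vertical component of the normal. -/
lemma inv_slope_eq (hb : IsFrame p b) (h : ∀ i, ⟪P, chartVec p b U y i⟫ = ⟪p, b i⟫ +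
    (1 + ‖p‖ ^ 2)⁻¹ * √(1 + ‖p‖ ^ 2) * grad U y i) (hm : 0 < chartFactor p P) :
    (√(1 + ‖P‖ ^ 2))⁻¹ = ((√(1 + ‖p‖ ^ 2))⁻¹ - ∑ i, ⟪p, b i⟫ * grad U y i) * (slope U y)⁻¹ := by
  have h1 := hb.parseval (-P) 0 1 1
  simp only [inner_neg_left, inner_neg_right, inner_zero_right, inner_zero_left, one_mul,
    sub_neg_eq_add, zero_add, sub_zero, mul_one] at h1
  have e1 : ∀ i, (-⟪P, b i⟫ + ⟪p, b i⟫) * ⟪p, b i⟫ =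
      -(chartFactor p P * (⟪p, b i⟫ * grad U y i)) := fun i => by
    have := inner_sub h i
    linear_combination (-⟪p, b i⟫) * this
  rw [sum_congr rfl fun i _ => e1 i, sum_neg_distrib, ← mul_sum] at h1
  have hs := slope_pos U y
  have e2 : (1 + ‖p‖ ^ 2)⁻¹ * (1 + ⟪p, P⟫) = chartFactor p P * (√(1 + ‖p‖ ^ 2))⁻¹ := by
    rw [← coeff_eq, chartFactor]
    linear_combination -(1 + ⟪p, P⟫) * coeff_sq p
  rw [e2] at h1
  rw [← factor_mul_slope hb h hm]
  field_simp
  have h0 : 0 < √(1 + ‖p‖ ^ 2) := Real.sqrt_pos.2 (by positivity)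
  field_simp at h1
  linarith

lemma metric_eq (hb : IsFrame p b) (h : ∀ i, ⟪P, chartVec p b U y i⟫ = ⟪p, b i⟫ +
    (1 + ‖p‖ ^ 2)⁻¹ * √(1 + ‖p‖ ^ 2) * grad U y i) (i j : Fin n) :
    ⟪chartVec p b U y i, chartVec p b U y j⟫ +
      ⟪P, chartVec p b U y i⟫ * ⟪P, chartVec p b U y j⟫ =
      (if i = j then 1 else 0) + grad U y i * grad U y j := by
  rw [h i, h j, ← hb i j]
  simp only [chartVec, inner_sub_left, inner_sub_right, inner_smul_left, inner_smul_right,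
    real_inner_self_eq_norm_sq, conj_trivial]
  rw [real_inner_comm p (b i)]
  have hc := coeff_sq p
  set c := (1 + ‖p‖ ^ 2)⁻¹ * √(1 + ‖p‖ ^ 2)
  have : c ^ 2 * (1 + ‖p‖ ^ 2) = 1 := by
    rw [hc]; exact inv_mul_cancel₀ (by positivity)
  linear_combination (grad U y i * grad U y j) * this

end IsTangentChart

/-- The principal curvatures are geometric: their symmetric functions can be computed in any
coordinates. -/
lemma sigma_principalCurvatures_eq {u U : E → ℝ} {x y : E} {J : Fin n → E}
    (hu : (hess u x).IsHermitian) (hU : (hess U y).IsHermitian)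
    (hg : ∀ i j, ⟪J i, J j⟫ + ⟪gradVec u x, J i⟫ * ⟪gradVec u x, J j⟫ =
      (if i = j then 1 else 0) + grad U y i * grad U y j)
    (hh : ∀ i j, (slope u x)⁻¹ * fderiv ℝ (fderiv ℝ u) x (J i) (J j) =
      (slope U y)⁻¹ * hess U y i j) (m : ℕ) :
    sigma m (principalCurvatures u x) = sigma m (principalCurvatures U y) := by
  let M : Matrix (Fin n) (Fin n) ℝ := of fun a i => J i a
  have h1 : Mᵀ * (1 + vecMulVec (grad u x) (grad u x)) * M =
      1 + vecMulVec (grad U y) (grad U y) := by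
    ext i j
    rw [Matrix.add_apply, one_apply, vecMulVec_apply, ← hg i j, Matrix.mul_add, Matrix.add_mul,
      Matrix.mul_one, Matrix.add_apply]
    congr 1
    · simp [M, Matrix.mul_apply, PiLp.inner_apply, mul_comm]
    · rw [Matrix.mul_vecMulVec, Matrix.vecMulVec_mul, vecMulVec_apply]
      simp [M, mulVec, vecMul, dotProduct, gradVec, PiLp.inner_apply, mul_comm]
  have h2 : Mᵀ * secondFundForm u x * M = secondFundForm U y := by
    ext i j
    rw [secondFundForm, secondFundForm, Matrix.mul_smul, Matrix.smul_mul, Matrix.smul_apply,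
      Matrix.smul_apply, smul_eq_mul, smul_eq_mul, ← hh i j, snd_fderiv_eq_sum]
    congr 1
    simp only [Matrix.mul_apply, transpose_apply, sum_mul, M, of_apply]
    rw [sum_comm]
    exact sum_congr rfl fun a _ => sum_congr rfl fun c _ => by ring
  -- Both sides are `det (g + s h)`, in the two coordinate systems. The case `s = 0` compares the
  -- metrics and removes the Jacobian `M.det ^ 2`, leaving equal generating polynomials.
  have h3 : ∀ s : ℝ, M.det ^ 2 * ((1 + vecMulVec (grad u x) (grad u x)).det *
      (1 + s • curvatureMatrix u x).det) =
      (1 + vecMulVec (grad U y) (grad U y)).det * (1 + s • curvatureMatrix U y).det := by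
    intro s
    rw [curvatureMatrix_eq, curvatureMatrix_eq, ← det_metric_add, ← det_metric_add, ← h1, ← h2]
    have : Mᵀ * (1 + vecMulVec (grad u x) (grad u x)) * M + s • (Mᵀ * secondFundForm u x * M) =
        Mᵀ * (1 + vecMulVec (grad u x) (grad u x) + s • secondFundForm u x) * M := by
      simp only [Matrix.mul_add, Matrix.add_mul, Matrix.mul_smul, Matrix.smul_mul]
    rw [this, det_mul, det_mul, det_transpose]
    ring
  have h4 := h3 0
  simp only [zero_smul, add_zero, det_one, mul_one] at h4
  have h5 : 0 < (1 + vecMulVec (grad U y) (grad U y)).det := by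
    rw [det_one_add_vecMulVec]
    have := sum_nonneg fun i (_ : i ∈ univ) => sq_nonneg (grad U y i)
    linarith
  have h6 : esPoly univ (principalCurvatures u x) = esPoly univ (principalCurvatures U y) := by
    refine Polynomial.funext fun s => ?_
    have h7 := h3 s
    rw [← mul_assoc, h4] at h7
    have h8 := mul_left_cancel₀ h5.ne' h7
    rw [det_one_add_smul (curvatureMatrix_isHermitian hu),
      det_one_add_smul (curvatureMatrix_isHermitian hU)] at h8
    exact h8
  rw [sigma_eq_es, sigma_eq_es, ← coeff_esPoly, ← coeff_esPoly, h6]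

namespace IsTangentChart

variable {u U : EuclideanSpace ℝ (Fin n) → ℝ} {x₀ : EuclideanSpace ℝ (Fin n)}
  {b : Fin n → EuclideanSpace ℝ (Fin n)}

lemma eventually_factor_pos (h : IsTangentChart u x₀ b U) (hu : ContDiffAt ℝ 4 u x₀) :
    ∀ᶠ y in 𝓝 0, 0 < chartFactor (gradVec u x₀)
      (gradVec u (chartMap x₀ (gradVec u x₀) b U y)) := by
  have hc : ContinuousAt (fun x => fderiv ℝ u x (gradVec u x₀)) x₀ :=
    ((hu.fderiv_right (m := 3) (by norm_num)).continuousAt.clm_apply continuousAt_const)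
  have h0 : 0 < 1 + fderiv ℝ u x₀ (gradVec u x₀) := by
    rw [fderiv_eq_inner, real_inner_self_eq_norm_sq]; positivity
  have h1 : ∀ᶠ x in 𝓝 x₀, 0 < 1 + fderiv ℝ u x (gradVec u x₀) :=
    (continuousAt_const.add hc).eventually (lt_mem_nhds h0)
  filter_upwards [h.tendsto_chartMap.eventually h1] with y hy
  rw [fderiv_eq_inner, real_inner_comm] at hy
  have : 0 < 1 + ‖gradVec u x₀‖ ^ 2 := by positivity
  exact mul_pos (mul_pos (by positivity) (Real.sqrt_pos.2 this)) hy

/-- The geometric quantities of the graph of `u` expressed through the chart. -/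
lemma eventually_geometry (h : IsTangentChart u x₀ b U) (hu : ContDiffAt ℝ 4 u x₀)
    (hb : IsFrame (gradVec u x₀) b) : ∀ᶠ y in 𝓝 0,
      (slope u (chartMap x₀ (gradVec u x₀) b U y))⁻¹ =
        ((slope u x₀)⁻¹ - ∑ i, ⟪gradVec u x₀, b i⟫ * grad U y i) * (slope U y)⁻¹ ∧
      (∀ m, sigma m (principalCurvatures u (chartMap x₀ (gradVec u x₀) b U y)) =
        sigma m (principalCurvatures U y)) ∧
      ∀ i, ∃ ξ : E, ‖ξ‖ ^ 2 + ⟪gradVec u (chartMap x₀ (gradVec u x₀) b U y), ξ⟫ ^ 2 =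
          1 + grad U y i ^ 2 ∧
        (slope u (chartMap x₀ (gradVec u x₀) b U y))⁻¹ *
          fderiv ℝ (fderiv ℝ u) (chartMap x₀ (gradVec u x₀) b U y) ξ ξ =
          (slope U y)⁻¹ * hess U y i i := by
  have h4 : ∀ᶠ x in 𝓝 x₀, ContDiffAt ℝ 4 u x := hu.eventually (by norm_num)
  filter_upwards [h.eventually_inner hu, h.eventually_hess hu, h.eventually_factor_pos hu,
    h.eventually_contDiffAt, h.tendsto_chartMap.eventually h4] with y h1 h2 h3 hUy hux
  have hs := factor_mul_slope hb h1 h3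
  have hm := metric_eq hb h1
  have hh : ∀ i j, (slope u (chartMap x₀ (gradVec u x₀) b U y))⁻¹ *
      fderiv ℝ (fderiv ℝ u) (chartMap x₀ (gradVec u x₀) b U y)
        (chartVec (gradVec u x₀) b U y i) (chartVec (gradVec u x₀) b U y j) =
      (slope U y)⁻¹ * hess U y i j := by
    intro i j
    rw [h2, slope_eq, ← hs]
    have := slope_pos U y
    field_simp
  refine ⟨?_, fun m => ?_, fun i => ⟨chartVec (gradVec u x₀) b U y i, ?_, hh i i⟩⟩
  · rw [slope_eq, slope_eq u x₀]
    exact inv_slope_eq hb h1 h3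
  · exact sigma_principalCurvatures_eq
      (contDiffAt_hess_isHermitian (hux.of_le (by norm_num)))
      (contDiffAt_hess_isHermitian (hUy.of_le (by norm_num))) hm hh m
  · have := hm i i
    rw [if_pos rfl, real_inner_self_eq_norm_sq] at this
    rw [sq ⟪_, _⟫, this, sq (grad U y i)]

end IsTangentChart

end ChartGeometry

/-! ### Partial derivatives and their commutation -/

section Partials

variable {n : ℕ}

local notation "E" => EuclideanSpace ℝ (Fin n)

/-- The `i`-th partial derivative. -/
noncomputable def pd (i : Fin n) (f : E → ℝ) (y : E) : ℝ :=
  fderiv ℝ f y (EuclideanSpace.single i 1)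

lemma ContDiffAt.pd {m m' : ℕ} {f : E → ℝ} {y : E} (hf : ContDiffAt ℝ m f y) (hm : m' + 1 ≤ m)
    (i : Fin n) : ContDiffAt ℝ m' (KCurvature.pd i f) y :=
  (hf.fderiv_right (m := m') (by exact_mod_cast hm)).clm_apply contDiffAt_const

lemma pd_congr {f g : E → ℝ} {y : E} (h : f =ᶠ[𝓝 y] g) (i : Fin n) : pd i f =ᶠ[𝓝 y] pd i g := by
  filter_upwards [h.eventuallyEq_nhds] with z hz
  rw [pd, pd, hz.fderiv_eq]

lemma pd_pd_eq_hess {f : E → ℝ} {y : E} (hf : ContDiffAt ℝ 2 f y) (i j : Fin n) :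
    pd i (pd j f) y = hess f y i j := by
  have h : DifferentiableAt ℝ (fderiv ℝ f) y :=
    (hf.fderiv_right (m := 1) (by norm_num)).differentiableAt (by norm_num)
  have := (ContinuousLinearMap.apply ℝ ℝ (EuclideanSpace.single j (1 : ℝ))).hasFDerivAt.comp y
    h.hasFDerivAt
  change fderiv ℝ (fun z => fderiv ℝ f z (EuclideanSpace.single j 1)) y _ = _
  have h2 : fderiv ℝ (fun z => fderiv ℝ f z (EuclideanSpace.single j 1)) y = _ := this.fderiv
  rw [h2]
  simp [hess]

lemma pd_comm {f : E → ℝ} {y : E} (hf : ContDiffAt ℝ 2 f y) (i j : Fin n) :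
    pd i (pd j f) =ᶠ[𝓝 y] pd j (pd i f) := by
  have : ∀ᶠ z in 𝓝 y, ContDiffAt ℝ 2 f z := hf.eventually (by norm_num)
  filter_upwards [this] with z hz
  rw [pd_pd_eq_hess hz, pd_pd_eq_hess hz]
  have := (contDiffAt_hess_isHermitian hz).apply j i
  simpa using this

lemma pd_four_comm {f : E → ℝ} {y : E} (hf : ContDiffAt ℝ 4 f y) (i j : Fin n) :
    pd i (pd i (pd j (pd j f))) y = pd j (pd j (pd i (pd i f))) y := by
  have h2 : ContDiffAt ℝ 2 f y := hf.of_le (by norm_num)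
  have h3 : ∀ a, ContDiffAt ℝ 2 (pd a f) y := fun a =>
    (ContDiffAt.pd (m := 4) (m' := 3) hf (by norm_num) a).of_le (by norm_num)
  have h4 : ∀ a c, ContDiffAt ℝ 2 (pd a (pd c f)) y := fun a c =>
    ContDiffAt.pd (m := 3) (m' := 2) (ContDiffAt.pd (m := 4) (m' := 3) hf (by norm_num) c)
      (by norm_num) a
  have e1 : pd i (pd i (pd j (pd j f))) =ᶠ[𝓝 y] pd i (pd j (pd i (pd j f))) :=
    pd_congr (pd_comm (h3 j) i j) i
  have e2 : pd i (pd j (pd i (pd j f))) =ᶠ[𝓝 y] pd j (pd i (pd i (pd j f))) :=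
    pd_comm (h4 i j) i j
  have e3 : pd j (pd i (pd i (pd j f))) =ᶠ[𝓝 y] pd j (pd i (pd j (pd i f))) :=
    pd_congr (pd_congr (pd_comm h2 i j) i) j
  have e4 : pd j (pd i (pd j (pd i f))) =ᶠ[𝓝 y] pd j (pd j (pd i (pd i f))) :=
    pd_congr (pd_comm (h3 i) i j) j
  exact (e1.trans (e2.trans (e3.trans e4))).self_of_nhds

lemma pd_three_comm {f : E → ℝ} {y : E} (hf : ContDiffAt ℝ 4 f y) (a i j : Fin n) :
    pd a (pd i (pd j f)) y = pd i (pd a (pd j f)) y ∧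
      pd a (pd i (pd j f)) y = pd a (pd j (pd i f)) y := by
  have h2 : ContDiffAt ℝ 2 f y := hf.of_le (by norm_num)
  have h3 : ContDiffAt ℝ 2 (pd j f) y :=
    (ContDiffAt.pd (m := 4) (m' := 3) hf (by norm_num) j).of_le (by norm_num)
  exact ⟨(pd_comm h3 a i).self_of_nhds, (pd_congr (pd_comm h2 i j) a).self_of_nhds⟩

lemma HasJet.of_pd {f : E → ℝ} (hf : ContDiffAt ℝ 2 f 0) (i : Fin n) :
    HasJet (fun t : ℝ => f (t • EuclideanSpace.single i 1)) (f 0) (pd i f 0)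
      (pd i (pd i f) 0) :=
  HasJet.of_contDiffAt hf _

end Partials

end KCurvature

namespace KCurvature

open Finset Filter Topology Matrix

/-! ### Second-order expansions of the geometric quantities along the axes -/

section ChartJets

variable {n : ℕ}

local notation "E" => EuclideanSpace ℝ (Fin n)

open scoped RealInnerProductSpace

lemma HasJet.id : HasJet (fun t => t) 0 1 0 :=
  ⟨fun _ => 1, .of_forall fun t => hasDerivAt_id t, hasDerivAt_const 0 1, rfl, rfl⟩

lemma HasJet.comp_curve {ψ : E → ℝ} {γ γ' : ℝ → E} {a : E} (hψ : ContDiffAt ℝ 2 ψ (γ 0))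
    (h1 : ∀ᶠ t in 𝓝 0, HasDerivAt γ (γ' t) t) (h2 : HasDerivAt γ' a 0) :
    HasJet (fun t => ψ (γ t)) (ψ (γ 0)) (fderiv ℝ ψ (γ 0) (γ' 0))
      (fderiv ℝ (fderiv ℝ ψ) (γ 0) (γ' 0) (γ' 0) + fderiv ℝ ψ (γ 0) a) := by
  have hψ' : ∀ᶠ x in 𝓝 (γ 0), ContDiffAt ℝ 2 ψ x := hψ.eventually (by norm_num)
  have hc : Tendsto γ (𝓝 0) (𝓝 (γ 0)) := h1.self_of_nhds.continuousAt.tendsto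
  refine ⟨fun t => fderiv ℝ ψ (γ t) (γ' t), ?_, ?_, rfl, rfl⟩
  · filter_upwards [h1, hc.eventually hψ'] with t ht ht'
    exact (ht'.differentiableAt (by norm_num)).hasFDerivAt.comp_hasDerivAt t ht
  · have h3 : HasFDerivAt (fderiv ℝ ψ) (fderiv ℝ (fderiv ℝ ψ) (γ 0)) (γ 0) :=
      ((hψ.fderiv_right (m := 1) (by norm_num)).differentiableAt (by norm_num)).hasFDerivAt
    exact (h3.comp_hasDerivAt (0 : ℝ) h1.self_of_nhds).clm_apply h2

/-- `U` is `C⁴` near `0` with vanishing gradient and Hessian `diag κ` at `0`. -/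
structure IsNormalized (U : E → ℝ) (κ : Fin n → ℝ) : Prop where
  contDiffAt : ContDiffAt ℝ 4 U 0
  zero : U 0 = 0
  pd_zero : ∀ i, pd i U 0 = 0
  pd_pd_zero : ∀ i j, pd i (pd j U) 0 = if i = j then κ i else 0

namespace IsNormalized

variable {U : EuclideanSpace ℝ (Fin n) → ℝ} {κ : Fin n → ℝ}

lemma tendsto_line (e : Fin n) : Tendsto
    (fun t : ℝ => t • (EuclideanSpace.single e 1 : E)) (𝓝 0) (𝓝 0) := by
  have : Continuous fun t : ℝ => t • (EuclideanSpace.single e 1 : E) := by fun_prop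
  simpa using this.tendsto 0

lemma jet_self (h : IsNormalized U κ) (e : Fin n) :
    HasJet (fun t : ℝ => U (t • EuclideanSpace.single e 1)) 0 0 (κ e) :=
  (HasJet.of_pd (h.contDiffAt.of_le (by norm_num)) e).congr_val h.zero.symm (h.pd_zero e).symm
    (by rw [h.pd_pd_zero, if_pos rfl])

lemma jet_grad (h : IsNormalized U κ) (e j : Fin n) :
    HasJet (fun t : ℝ => grad U (t • EuclideanSpace.single e 1) j) 0 (if e = j then κ e else 0)
      (pd e (pd e (pd j U)) 0) := by
  have h1 : ContDiffAt ℝ 2 (pd j U) 0 :=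
    (ContDiffAt.pd (m := 4) (m' := 3) h.contDiffAt (by norm_num) j).of_le (by norm_num)
  exact (HasJet.of_pd h1 e).congr_val (h.pd_zero j).symm (h.pd_pd_zero e j).symm rfl

lemma jet_hess (h : IsNormalized U κ) (e i j : Fin n) :
    HasJet (fun t : ℝ => hess U (t • EuclideanSpace.single e 1) i j) (if i = j then κ i else 0)
      (pd e (pd i (pd j U)) 0) (pd e (pd e (pd i (pd j U))) 0) := by
  have h1 : ContDiffAt ℝ 2 (pd i (pd j U)) 0 :=
    ContDiffAt.pd (m := 3) (m' := 2) (ContDiffAt.pd (m := 4) (m' := 3) h.contDiffAt (by norm_num) j)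
      (by norm_num) i
  have h4 : ∀ᶠ y in 𝓝 (0 : E), ContDiffAt ℝ 4 U y := h.contDiffAt.eventually (by norm_num)
  refine ((HasJet.of_pd h1 e).congr ?_).congr_val (h.pd_pd_zero i j).symm rfl rfl
  filter_upwards [(tendsto_line e).eventually h4] with t ht
  rw [pd_pd_eq_hess (ht.of_le (by norm_num))]

lemma jet_one_add_sq (h : IsNormalized U κ) (e : Fin n) :
    HasJet (fun t : ℝ => 1 + ∑ j, grad U (t • EuclideanSpace.single e 1) j ^ 2) 1 0
      (2 * κ e ^ 2) :=
  ((HasJet.const 1).add (HasJet.sum univ fun j _ => (h.jet_grad e j).sq)).congr_val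
    (by simp) (by simp) (by simp)

lemma jet_inv_slope (h : IsNormalized U κ) (e : Fin n) :
    HasJet (fun t : ℝ => (slope U (t • EuclideanSpace.single e 1))⁻¹) 1 0 (-κ e ^ 2) := by
  refine (((h.jet_one_add_sq e).sqrt one_pos).inv (by simp)).congr_val (by simp) (by simp) ?_
  simp

lemma jet_sff (h : IsNormalized U κ) (e i j : Fin n) :
    HasJet (fun t : ℝ => secondFundForm U (t • EuclideanSpace.single e 1) i j)
      (if i = j then κ i else 0) (pd e (pd i (pd j U)) 0)
      (pd e (pd e (pd i (pd j U))) 0 - κ e ^ 2 * if i = j then κ i else 0) := by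
  refine (((h.jet_inv_slope e).mul (h.jet_hess e i j)).congr
    (.of_forall fun t => ?_)).congr_val (by ring) (by ring) (by ring)
  simp [secondFundForm]

/-- The second-order expansion of `σ_k` of the principal curvatures along a coordinate axis. -/
lemma jet_sigma (h : IsNormalized U κ) (e : Fin n) (k : ℕ) :
    HasJet (fun t : ℝ => sigma (k + 2) (principalCurvatures U (t • EuclideanSpace.single e 1)))
      (es univ (k + 2) κ)
      (∑ i, pd e (pd i (pd i U)) 0 * es (univ.erase i) (k + 1) κ)
      (∑ i, (pd e (pd e (pd i (pd i U))) 0 - κ e ^ 2 * κ i) * es (univ.erase i) (k + 1) κ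
        - 2 * κ e ^ 3 * es (univ.erase e) (k + 1) κ
        + ∑ i, ∑ j ∈ univ.erase i, (pd e (pd i (pd i U)) 0 * pd e (pd j (pd j U)) 0 -
          pd e (pd i (pd j U)) 0 * pd e (pd j (pd i U)) 0) *
          es ((univ.erase i).erase j) k κ) := by
  -- The curvature function is a coefficient of `s ↦ det (g + s h) / det g`, hence a fixed linear
  -- combination of its values, and only determinants need expanding. The bound `n + 2` on the
  -- degree leaves room for the factor `X²` in the second-order term.
  obtain ⟨w, v, hw⟩ := exists_coeff_eq_sum_eval (n + 2) (k + 2)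
  have hdeg : ∀ s : Finset (Fin n), (esPoly s κ).natDegree ≤ n := fun s =>
    (natDegree_esPoly_le s κ).trans ((card_le_univ s).trans (by simp))
  have hev : ∀ (s : Finset (Fin n)) (r : ℝ), (esPoly s κ).eval r = ∏ i ∈ s, (1 + κ i * r) :=
    fun s r => by simp [esPoly, Polynomial.eval_prod]
  have hdet : ∀ s : ℝ, HasJet (fun t : ℝ => (1 + vecMulVec
      (grad U (t • EuclideanSpace.single e 1)) (grad U (t • EuclideanSpace.single e 1)) +
        s • secondFundForm U (t • EuclideanSpace.single e 1)).det) _ _ _ := fun s =>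
    hasJet_det (d := fun i => 1 + κ i * s) (B := of fun i j => s * pd e (pd i (pd j U)) 0)
      (C := of fun i j => 2 * ((if e = i then κ e else 0) * if e = j then κ e else 0) +
        s * (pd e (pd e (pd i (pd j U))) 0 - κ e ^ 2 * if i = j then κ i else 0))
      (fun i j => by
        refine (((HasJet.const ((1 : Matrix (Fin n) (Fin n) ℝ) i j)).add
          ((h.jet_grad e i).mul (h.jet_grad e j))).add
          ((h.jet_sff e i j).const_mul s)).congr_val ?_ ?_ ?_
        · by_cases hij : i = j
          · subst hij; simp [mul_comm]
          · simp [hij]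
        · simp
        · simp)
  have hphi := fun s : ℝ => (hdet s).mul ((h.jet_one_add_sq e).inv one_ne_zero)
  have hsum := HasJet.sum univ fun l (_ : l ∈ univ) => (hphi (v l)).const_mul (w l)
  have h4 : ∀ᶠ y in 𝓝 (0 : E), ContDiffAt ℝ 4 U y := h.contDiffAt.eventually (by norm_num)
  refine (hsum.congr ?_).congr_val ?_ ?_ ?_
  · filter_upwards [(tendsto_line e).eventually h4] with t ht
    have hA := curvatureMatrix_isHermitian (contDiffAt_hess_isHermitian (ht.of_le (by norm_num)))
    rw [sigma_eq_es, ← coeff_esPoly, hw _ ((natDegree_esPoly_le _ _).trans (by simp))]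
    refine sum_congr rfl fun l _ => ?_
    rw [det_metric_add, ← curvatureMatrix_eq, det_one_add_smul hA, det_one_add_vecMulVec,
      principalCurvatures]
    have := sum_nonneg fun i (_ : i ∈ univ) =>
      sq_nonneg (grad U (t • EuclideanSpace.single e (1 : ℝ)) i)
    have h0 : 1 + ∑ i, grad U (t • EuclideanSpace.single e (1 : ℝ)) i ^ 2 ≠ 0 := by linarith
    field_simp
  · rw [← coeff_esPoly, hw _ ((hdeg _).trans (by omega))]
    exact sum_congr rfl fun l _ => by rw [hev]; simp
  · have hP : (∑ i, Polynomial.X * (Polynomial.C (pd e (pd i (pd i U)) 0) *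
        esPoly (univ.erase i) κ)).coeff (k + 2) =
        ∑ i, pd e (pd i (pd i U)) 0 * es (univ.erase i) (k + 1) κ := by
      rw [Polynomial.finsetSum_coeff]
      exact sum_congr rfl fun i _ => by
        rw [Polynomial.coeff_X_mul, Polynomial.coeff_C_mul, coeff_esPoly]
    rw [← hP, hw]
    · refine sum_congr rfl fun l _ => ?_
      congr 1
      rw [Polynomial.eval_finsetSum]
      simp only [of_apply, inv_one, mul_one, neg_zero, zero_div, mul_zero, add_zero]
      refine sum_congr rfl fun i _ => ?_
      simp only [Polynomial.eval_mul, Polynomial.eval_X, Polynomial.eval_C, hev]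
      ring
    · refine Polynomial.natDegree_sum_le_of_forall_le _ _ fun i _ => ?_
      refine (Polynomial.natDegree_mul_le).trans ?_
      have := Polynomial.natDegree_C_mul_le (pd e (pd i (pd i U)) 0) (esPoly (univ.erase i) κ)
      have := hdeg (univ.erase i)
      have := Polynomial.natDegree_X_le (R := ℝ)
      omega
  · set A : Fin n → ℝ := fun i => pd e (pd e (pd i (pd i U))) 0 - κ e ^ 2 * κ i with hA
    set B : Fin n → Fin n → ℝ := fun i j => pd e (pd i (pd i U)) 0 * pd e (pd j (pd j U)) 0 -
          pd e (pd i (pd j U)) 0 * pd e (pd j (pd i U)) 0 with hB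
    -- A polynomial whose values are the second derivatives of the determinant quotient and whose
    -- coefficient is the claimed expression. The middle term comes from the metric and from `1 /
    -- det g`; by `es_erase` its coefficient is `-2 κ_e³ σ_{k+1}` without `κ_e`.
    have hP : (∑ i, Polynomial.X * (Polynomial.C (A i) * esPoly (univ.erase i) κ) +
        Polynomial.C (2 * κ e ^ 2) * (esPoly (univ.erase e) κ - esPoly univ κ) +
        ∑ i, ∑ j ∈ univ.erase i, Polynomial.X * (Polynomial.X * (Polynomial.C (B i j) *
          esPoly ((univ.erase i).erase j) κ))).coeff (k + 2) =
        ∑ i, A i * es (univ.erase i) (k + 1) κ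
        - 2 * κ e ^ 3 * es (univ.erase e) (k + 1) κ
        + ∑ i, ∑ j ∈ univ.erase i, B i j * es ((univ.erase i).erase j) k κ := by
      rw [Polynomial.coeff_add, Polynomial.coeff_add, Polynomial.finsetSum_coeff,
        Polynomial.finsetSum_coeff, Polynomial.coeff_C_mul, Polynomial.coeff_sub, coeff_esPoly,
        coeff_esPoly, es_erase (mem_univ e)]
      have e1 : ∀ i, (∑ j ∈ univ.erase i, Polynomial.X * (Polynomial.X * (Polynomial.C (B i j) *
          esPoly ((univ.erase i).erase j) κ))).coeff (k + 2) =
          ∑ j ∈ univ.erase i, B i j * es ((univ.erase i).erase j) k κ := fun i => by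
        rw [Polynomial.finsetSum_coeff]
        exact sum_congr rfl fun j _ => by
          rw [Polynomial.coeff_X_mul, Polynomial.coeff_X_mul, Polynomial.coeff_C_mul, coeff_esPoly]
      have e2 : ∀ i, (Polynomial.X * (Polynomial.C (A i) * esPoly (univ.erase i) κ)).coeff (k + 2)
          = A i * es (univ.erase i) (k + 1) κ := fun i => by
        rw [Polynomial.coeff_X_mul, Polynomial.coeff_C_mul, coeff_esPoly]
      rw [sum_congr rfl fun i _ => e1 i, sum_congr rfl fun i _ => e2 i]
      ring
    rw [← hP, hw]
    · refine sum_congr rfl fun l _ => ?_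
      congr 1
      rw [Polynomial.eval_add, Polynomial.eval_add, Polynomial.eval_finsetSum,
        Polynomial.eval_finsetSum]
      have f1 : ∀ i, (∑ j ∈ univ.erase i, Polynomial.X * (Polynomial.X * (Polynomial.C (B i j) *
          esPoly ((univ.erase i).erase j) κ))).eval (v l) = ∑ j ∈ univ.erase i,
          v l ^ 2 * B i j * ∏ m ∈ (univ.erase i).erase j, (1 + κ m * v l) := fun i => by
        rw [Polynomial.eval_finsetSum]
        exact sum_congr rfl fun j _ => by
          simp only [Polynomial.eval_mul, Polynomial.eval_X, Polynomial.eval_C, hev]; ring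
      rw [sum_congr rfl fun i _ => f1 i]
      simp only [Polynomial.eval_mul, Polynomial.eval_X, Polynomial.eval_C, hev,
        Polynomial.eval_sub, of_apply, if_true]
      have f2 : ∑ i, (2 * ((if e = i then κ e else 0) * if e = i then κ e else 0) +
          v l * (pd e (pd e (pd i (pd i U))) 0 - κ e ^ 2 * κ i)) *
            ∏ j ∈ univ.erase i, (1 + κ j * v l) =
          2 * κ e ^ 2 * ∏ j ∈ univ.erase e, (1 + κ j * v l) +
          ∑ i, v l * (A i * ∏ j ∈ univ.erase i, (1 + κ j * v l)) := by
        simp only [add_mul, sum_add_distrib]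
        congr 1
        · rw [sum_eq_single e (fun j _ hj => by simp [hj.symm]) (by simp), if_pos rfl]
          ring
        · exact sum_congr rfl fun i _ => by rw [hA]; ring
      rw [f2]
      have f3 : ∀ i, ∑ j ∈ univ.erase i, (v l * pd e (pd i (pd i U)) 0 *
          (v l * pd e (pd j (pd j U)) 0) - v l * pd e (pd i (pd j U)) 0 *
          (v l * pd e (pd j (pd i U)) 0)) * ∏ m ∈ (univ.erase i).erase j, (1 + κ m * v l) =
          ∑ j ∈ univ.erase i, v l ^ 2 * B i j *
            ∏ m ∈ (univ.erase i).erase j, (1 + κ m * v l) := fun i =>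
        sum_congr rfl fun j _ => by rw [hB]; ring
      rw [sum_congr rfl fun i _ => f3 i]
      ring
    · have hX := Polynomial.natDegree_X_le (R := ℝ)
      refine Polynomial.natDegree_add_le_of_degree_le (Polynomial.natDegree_add_le_of_degree_le
        ?_ ?_) ?_
      · refine Polynomial.natDegree_sum_le_of_forall_le _ _ fun i _ => ?_
        refine (Polynomial.natDegree_mul_le).trans ?_
        have := Polynomial.natDegree_C_mul_le (A i) (esPoly (univ.erase i) κ)
        have := hdeg (univ.erase i)
        omega
      · refine (Polynomial.natDegree_C_mul_le _ _).trans
          ((Polynomial.natDegree_sub_le_of_le (hdeg _) (hdeg _)).trans ?_)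
        simp
      · refine Polynomial.natDegree_sum_le_of_forall_le _ _ fun i _ => ?_
        refine Polynomial.natDegree_sum_le_of_forall_le _ _ fun j _ => ?_
        refine (Polynomial.natDegree_mul_le).trans ?_
        have h1 := Polynomial.natDegree_mul_le (p := (Polynomial.X : Polynomial ℝ))
          (q := Polynomial.C (B i j) * esPoly ((univ.erase i).erase j) κ)
        have := Polynomial.natDegree_C_mul_le (B i j) (esPoly ((univ.erase i).erase j) κ)
        have := hdeg ((univ.erase i).erase j)
        omega

/-- The function is `log (h_oo / g_oo)`, the normal curvature in a coordinate direction; it replaces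
the largest principal curvature, which need not be differentiable. The terms `-κ_e²` and `-2 κ_o²`
come from `1 / slope` and from `g_oo`. -/
lemma jet_log_curvature (h : IsNormalized U κ) (e o : Fin n) (ho : 0 < κ o) :
    HasJet (fun t : ℝ => Real.log ((slope U (t • EuclideanSpace.single e 1))⁻¹ *
        hess U (t • EuclideanSpace.single e 1) o o /
          (1 + grad U (t • EuclideanSpace.single e 1) o ^ 2)))
      (Real.log (κ o)) (pd e (pd o (pd o U)) 0 / κ o)
      (pd e (pd e (pd o (pd o U))) 0 / κ o - (pd e (pd o (pd o U)) 0 / κ o) ^ 2 - κ e ^ 2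
        - 2 * if e = o then κ o ^ 2 else 0) := by
  have h1 := (h.jet_inv_slope e).log one_ne_zero
  have h2 := (h.jet_hess e o o).log (by rw [if_pos rfl]; exact ho.ne')
  have h3 := ((HasJet.const 1).add (h.jet_grad e o).sq).log (by simp)
  have hpos : ∀ᶠ t in 𝓝 (0 : ℝ), 0 < hess U (t • EuclideanSpace.single e 1) o o := by
    have hc := (h.jet_hess e o o)
    have h0 := hc.val
    simp only [if_true] at h0
    exact hc.continuousAt.eventually (lt_mem_nhds (by simp only [h0]; exact ho))
  refine (((h1.add h2).sub h3).congr ?_).congr_val (by simp) (by simp) ?_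
  · filter_upwards [hpos] with t ht
    have := slope_pos U (t • EuclideanSpace.single e 1)
    rw [Real.log_div (by positivity) (by positivity), Real.log_mul (by positivity) ht.ne']
  · by_cases heo : e = o
    · subst heo; simp; ring
    · simp [heo]; ring

lemma jet_normal (h : IsNormalized U κ) (e : Fin n) (r : ℝ) (q : Fin n → ℝ) :
    HasJet (fun t : ℝ => (r - ∑ j, q j * grad U (t • EuclideanSpace.single e 1) j) *
      (slope U (t • EuclideanSpace.single e 1))⁻¹) r (-(q e * κ e))
      (-(∑ j, q j * pd e (pd e (pd j U)) 0) - r * κ e ^ 2) := by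
  refine ((((HasJet.const r).sub (HasJet.sum univ fun j _ =>
    (h.jet_grad e j).const_mul (q j))).mul (h.jet_inv_slope e))).congr_val
      (by simp) (by simp) (by simp; ring)

end IsNormalized

namespace IsTangentChart

variable {u U : EuclideanSpace ℝ (Fin n) → ℝ} {x₀ : EuclideanSpace ℝ (Fin n)}
  {b : Fin n → EuclideanSpace ℝ (Fin n)} {κ : Fin n → ℝ}

lemma isNormalized (h : IsTangentChart u x₀ b U) (hu : ContDiffAt ℝ 4 u x₀)
    (hb : ∀ i j, fderiv ℝ (fderiv ℝ u) x₀ (b i) (b j) =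
      if i = j then slope u x₀ * κ i else 0) : IsNormalized U κ := by
  have hpd : ∀ i, pd i U 0 = 0 := fun i => by rw [pd, h.fderiv_zero]; simp
  refine ⟨h.contDiffAt, h.zero, hpd, fun i j => ?_⟩
  rw [pd_pd_eq_hess (h.contDiffAt.of_le (by norm_num))]
  have h1 := (h.eventually_hess hu).self_of_nhds i j
  rw [h.chartMap_zero] at h1
  have hv : ∀ i, chartVec (gradVec u x₀) b U 0 i = b i := fun i => by
    have : grad U 0 i = 0 := hpd i
    rw [chartVec, this]; simp
  have hf : chartFactor (gradVec u x₀) (gradVec u x₀) = slope u x₀ := by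
    rw [chartFactor, real_inner_self_eq_norm_sq, slope_eq]
    have : 0 < 1 + ‖gradVec u x₀‖ ^ 2 := by positivity
    field_simp
  rw [hv, hv, hf, hb] at h1
  have := slope_pos u x₀
  by_cases hij : i = j
  · rw [if_pos hij] at h1 ⊢
    exact (mul_left_cancel₀ this.ne' h1).symm
  · rw [if_neg hij] at h1 ⊢
    rcases mul_eq_zero.1 h1.symm with h2 | h2
    · exact absurd h2 this.ne'
    · exact h2

lemma chartMap_line (p : E) (e : Fin n) (t : ℝ) :
    chartMap x₀ p b U (t • EuclideanSpace.single e 1) =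
      x₀ + t • b e - ((√(1 + ‖p‖ ^ 2))⁻¹ * U (t • EuclideanSpace.single e 1)) • p := by
  rw [chartMap, map_smul, frameMap_single, coeff_eq]

lemma jet_comp (h : IsTangentChart u x₀ b U) (hU : IsNormalized U κ) {ψ : E → ℝ}
    (hψ : ContDiffAt ℝ 2 ψ x₀) (e : Fin n) :
    HasJet (fun t : ℝ => ψ (chartMap x₀ (gradVec u x₀) b U (t • EuclideanSpace.single e 1)))
      (ψ x₀) (fderiv ℝ ψ x₀ (b e)) (fderiv ℝ (fderiv ℝ ψ) x₀ (b e) (b e)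
        - κ e * (slope u x₀)⁻¹ * fderiv ℝ ψ x₀ (gradVec u x₀)) := by
  obtain ⟨f', h1, h2, h3, h4⟩ := hU.jet_self e
  set p := gradVec u x₀ with hp
  set c := (√(1 + ‖p‖ ^ 2))⁻¹ with hc
  have h0 : chartMap x₀ p b U ((0 : ℝ) • EuclideanSpace.single e 1) = x₀ := by
    rw [zero_smul, h.chartMap_zero]
  have hd : ∀ᶠ t in 𝓝 (0 : ℝ), HasDerivAt
      (fun t : ℝ => chartMap x₀ p b U (t • EuclideanSpace.single e 1))
      (b e - (c * f' t) • p) t := by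
    filter_upwards [h1] with t ht
    simp only [chartMap_line]
    have h5 : HasDerivAt (fun t : ℝ => x₀ + t • b e) (b e) t := by
      simpa using ((hasDerivAt_id t).smul_const (b e)).const_add x₀
    exact h5.sub ((ht.const_mul c).smul_const p)
  have hd2 : HasDerivAt (fun t => b e - (c * f' t) • p) (-((c * κ e) • p)) 0 :=
    ((h2.const_mul c).smul_const p).const_sub (b e)
  have := HasJet.comp_curve (ψ := ψ) (by simpa only [h0] using hψ) hd hd2
  refine this.congr_val ?_ ?_ ?_
  · simp only [h0]
  · simp only [h0]
    simp only [h4, mul_zero, zero_smul, sub_zero]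
  · simp only [h0]
    simp only [h4, mul_zero, zero_smul, sub_zero, map_neg, map_smul, smul_eq_mul]
    rw [slope_eq, ← hp, ← hc]; ring

lemma jet_height (h : IsTangentChart u x₀ b U) (hU : IsNormalized U κ) (e : Fin n) :
    HasJet (fun t : ℝ => u (chartMap x₀ (gradVec u x₀) b U (t • EuclideanSpace.single e 1)))
      (u x₀) ⟪gradVec u x₀, b e⟫ (κ e * (slope u x₀)⁻¹) := by
  have h1 := ((HasJet.const (u x₀)).add (HasJet.id.const_mul ⟪gradVec u x₀, b e⟫)).add
    ((hU.jet_self e).const_mul (slope u x₀)⁻¹)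
  refine (h1.congr ?_).congr_val (by simp) (by simp) (by simp [mul_comm])
  filter_upwards [(IsNormalized.tendsto_line e).eventually h.eq] with t ht
  rw [ht, coeff_eq, slope_eq, map_smul, frameMap_single, inner_smul_right]
  ring

lemma jet_dist (h : IsTangentChart u x₀ b U) (hU : IsNormalized U κ)
    (hb : IsFrame (gradVec u x₀) b) (o : E) (e : Fin n) :
    HasJet (fun t : ℝ =>
      ‖chartMap x₀ (gradVec u x₀) b U (t • EuclideanSpace.single e 1) - o‖ ^ 2 +
        u (chartMap x₀ (gradVec u x₀) b U (t • EuclideanSpace.single e 1)) ^ 2)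
      (‖x₀ - o‖ ^ 2 + u x₀ ^ 2)
      (2 * (⟪x₀ - o, b e⟫ + u x₀ * ⟪gradVec u x₀, b e⟫))
      (2 * (1 + κ e * (slope u x₀)⁻¹ * (u x₀ - ⟪x₀ - o, gradVec u x₀⟫))) := by
  have hr := (hU.jet_self e).const_mul (slope u x₀)⁻¹
  have h1 := (((((HasJet.const (‖x₀ - o‖ ^ 2)).add (HasJet.id.const_mul (2 * ⟪x₀ - o, b e⟫))).sub
    (hr.const_mul (2 * ⟪x₀ - o, gradVec u x₀⟫))).add (HasJet.id.sq.const_mul (‖b e‖ ^ 2))).sub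
    ((HasJet.id.mul hr).const_mul (2 * ⟪gradVec u x₀, b e⟫))).add
    (hr.sq.const_mul (‖gradVec u x₀‖ ^ 2))
  refine ((h1.add (h.jet_height hU e).sq).congr (.of_forall fun t => ?_)).congr_val
    (by simp) (by simp; ring) ?_
  · congr 1
    rw [chartMap_line, slope_eq]
    set r := (√(1 + ‖gradVec u x₀‖ ^ 2))⁻¹ * U (t • EuclideanSpace.single e 1)
    have : x₀ + t • b e - r • gradVec u x₀ - o = (x₀ - o) + t • b e - r • gradVec u x₀ := by abel
    rw [this, ← real_inner_self_eq_norm_sq, inner_sub_left, inner_sub_right, inner_sub_right,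
      inner_add_left, inner_add_right, inner_add_right, inner_add_left]
    simp only [inner_smul_left, inner_smul_right, conj_trivial, inner_add_right,
      real_inner_self_eq_norm_sq]
    rw [real_inner_comm (x₀ - o) (b e), real_inner_comm (x₀ - o) (gradVec u x₀),
      real_inner_comm (gradVec u x₀) (b e)]
    ring
  · have := hb.norm_add_sq e
    simp only [zero_mul, mul_zero, add_zero]
    linear_combination (-2) * this

end IsTangentChart

end ChartJets

end KCurvature

namespace KCurvature

open Finset

/-! ### Algebraic inequalities at the maximum point -/

section MaximumPoint

variable {n k : ℕ}

/-- The differentiated equation, combined with the concavity of the quotient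
`σ_{k+2} / σ_{k+1}`-type terms. -/
lemma sum_fourth_ge {κ : Fin n → ℝ} (hκ : InCone univ (k + 2) κ) {o : Fin n} {G g₁ g₂ : ℝ}
    (hG : 0 < G) (hσ : es univ (k + 2) κ = G ^ (k + 1)) {W T : Fin n → ℝ}
    {M : Fin n → Fin n → ℝ} (hMs : ∀ i j, M i j = M j i) (hMT : ∀ i, M o i = T i)
    (h1 : ∑ i, M i i * es (univ.erase i) (k + 1) κ = G ^ (k + 1) * ((k + 1) * (g₁ / G)))
    (h2 : ∑ i, (W i - κ o ^ 2 * κ i) * es (univ.erase i) (k + 1) κ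
        - 2 * κ o ^ 3 * es (univ.erase o) (k + 1) κ
        + ∑ i, ∑ j ∈ univ.erase i, (M i i * M j j - M i j * M j i) *
          es ((univ.erase i).erase j) k κ =
        G ^ (k + 1) * ((k + 1) * k * (g₁ / G) ^ 2 + (k + 1) * (g₂ / G))) :
    κ o ^ 2 * ((k + 2) * G ^ (k + 1)) + 2 * κ o ^ 3 * es (univ.erase o) (k + 1) κ
      + 2 * ∑ i ∈ univ.erase o, T i ^ 2 * es ((univ.erase o).erase i) k κ
      + G ^ (k + 1) * ((k + 1) * (g₂ / G) - (g₁ / G) ^ 2) ≤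
    ∑ i, W i * es (univ.erase i) (k + 1) κ := by
  have hf : 0 < G ^ (k + 1) := pow_pos hG _
  have hc := hκ.concavity fun i => M i i
  rw [hσ, h1, mul_div_cancel_left₀ _ hf.ne'] at hc
  set S2 := ∑ i, ∑ j ∈ univ.erase i, M i i * M j j * es ((univ.erase i).erase j) k κ
  set N2 := ∑ i, ∑ j ∈ univ.erase i, M i j * M j i * es ((univ.erase i).erase j) k κ with hN2
  set b := (∑ i, M i i) / es univ 1 κ
  set a := g₁ / G
  have hsplit : ∑ i, ∑ j ∈ univ.erase i, (M i i * M j j - M i j * M j i) *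
      es ((univ.erase i).erase j) k κ = S2 - N2 := by
    simp only [sub_mul, sum_sub_distrib, S2, N2]
  have heuler : ∑ i, (W i - κ o ^ 2 * κ i) * es (univ.erase i) (k + 1) κ =
      ∑ i, W i * es (univ.erase i) (k + 1) κ - κ o ^ 2 * ((k + 2) * G ^ (k + 1)) := by
    have := sum_mul_es_erase univ (k + 1) κ
    rw [hσ] at this
    push_cast at this
    rw [show ((k : ℝ) + 2) = k + 1 + 1 by ring, ← this, mul_sum, ← sum_sub_distrib]
    exact sum_congr rfl fun i _ => by ring
  have hterm : ∀ i, ∀ j ∈ univ.erase i,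
      0 ≤ M i j * M j i * es ((univ.erase i).erase j) k κ := fun i j hj => by
    rw [hMs j i]
    exact mul_nonneg (mul_self_nonneg _) (hκ.erase_erase_nonneg (mem_univ i) hj).le
  -- Of the nonnegative off-diagonal squares only those with one index equal to `o` are kept; each
  -- occurs twice.
  have hN : 2 * ∑ i ∈ univ.erase o, T i ^ 2 * es ((univ.erase o).erase i) k κ ≤ N2 := by
    rw [hN2, ← add_sum_erase univ _ (mem_univ o), two_mul]
    refine add_le_add (le_of_eq (sum_congr rfl fun i _ => ?_)) (sum_le_sum fun i hi => ?_)
    · rw [hMs i o, hMT]; ring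
    · have hoi : o ∈ univ.erase i := mem_erase.2 ⟨(ne_of_mem_erase hi).symm, mem_univ o⟩
      refine le_trans (le_of_eq ?_) (single_le_sum (hterm i) hoi)
      rw [hMs i o, hMT, erase_right_comm]; ring
  have hk : (0 : ℝ) ≤ k := Nat.cast_nonneg k
  -- In the concavity inequality the logarithmic derivative of `σ_{k+2}` is `(k + 1) a`. After
  -- expansion, `2 a b - b² ≤ a²` leaves `(k + 1) k a² + a²`; the first part equals the
  -- corresponding term of the equation differentiated twice and cancels.
  have hkey : S2 / G ^ (k + 1) ≤ (k + 1) * k * a ^ 2 + a ^ 2 := by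
    have e : -(((k : ℝ) + 1) * a - b) ^ 2 / (k + 1) =
        -((k + 1) * a ^ 2) + 2 * a * b - b ^ 2 / (k + 1) := by
      field_simp; ring
    have h3 : 0 ≤ b ^ 2 / (k + 1) := by positivity
    nlinarith [sq_nonneg (a - b)]
  have hS2 : S2 ≤ G ^ (k + 1) * ((k + 1) * k * a ^ 2 + a ^ 2) := by
    rw [div_le_iff₀ hf] at hkey; linarith
  rw [hsplit, heuler] at h2
  linarith

/-- Since `t = y - r`, the term `y²` cancels the square of `y` in `-t²`. The cross term `2 y r` is
charged by Young's inequality to half of `a κ²`. -/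
lemma index_lower_bound {a F κ y r s Y D β E z t : ℝ} (ha : 0 < a) (hF : 0 ≤ F) (hY : 0 < Y)
    (hy : y ^ 2 ≤ Y * κ ^ 2) (hr : r ^ 2 ≤ D) (hs : s ^ 2 ≤ D) (hβ : 1 ≤ β)
    (hE : E = (2 * Y / a + 2) * D) (ht : t = y - r) :
    F * (a / 2 * κ ^ 2 - E) ≤ F * (a * κ ^ 2 - t ^ 2 - s ^ 2 / β + y ^ 2 + 2 * z ^ 2) := by
  refine mul_le_mul_of_nonneg_left ?_ hF
  have h1 : s ^ 2 / β ≤ s ^ 2 := div_le_self (sq_nonneg s) hβ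
  have h2 : a / (2 * Y) * y ^ 2 ≤ a / 2 * κ ^ 2 := by
    calc a / (2 * Y) * y ^ 2 ≤ a / (2 * Y) * (Y * κ ^ 2) := by gcongr
      _ = a / 2 * κ ^ 2 := by field_simp
  have h3 : 0 ≤ a / (2 * Y) * y ^ 2 + 2 * y * r + 2 * Y / a * r ^ 2 := by
    have : a / (2 * Y) * y ^ 2 + 2 * y * r + 2 * Y / a * r ^ 2 =
        (a * y + 2 * Y * r) ^ 2 / (2 * Y * a) := by field_simp; ring
    rw [this]; positivity
  have h4 : 2 * Y / a * r ^ 2 ≤ 2 * Y / a * D := by gcongr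
  rw [hE, ht]
  nlinarith [sq_nonneg z]

/-- Three cases. If `F < 12 F₀`, the crude bound costs at most `12 F₀ E`. If `κ` is very negative,
`a κ²` absorbs `E`. Otherwise `F` is controlled by `κ₀ σ`, and the extra term `2 κ₀ σ t²` outweighs
`-F t²`. -/
lemma index_lower_bound_of_ne {a F F₀ κ κ₀ σ y r s Y D β E z t : ℝ} (ha : 0 < a) (hF : 0 < F)
    (hF₀ : 0 < F₀) (hY : 0 < Y) (hκ₀ : 0 < κ₀) (hσ : 0 < σ)
    (hFσ : F - F₀ = (κ₀ - κ) * σ)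
    (hy : y ^ 2 ≤ Y * κ ^ 2) (hr : r ^ 2 ≤ D) (hs : s ^ 2 ≤ D) (hβ : 3 ≤ β)
    (hE : E = (2 * Y / a + 2) * D) (hEκ : 200 * E ≤ a * κ₀ ^ 2) (hrs : r = s + z)
    (ht : t = y - r) :
    -(12 * F₀ * E) ≤
      F * (a * κ ^ 2 - t ^ 2 - s ^ 2 / β + y ^ 2 + 2 * z ^ 2) + 2 * κ₀ * σ * t ^ 2 := by
  have hD : 0 ≤ D := (sq_nonneg r).trans hr
  have hE0 : 0 ≤ E := by rw [hE]; positivity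
  have hβ1 : 1 ≤ β := by linarith
  have hb := index_lower_bound (z := z) ha hF.le hY hy hr hs hβ1 hE ht
  have hσ2 : 0 ≤ 2 * κ₀ * σ * t ^ 2 := by positivity
  rcases lt_or_ge F (12 * F₀) with h1 | h1
  · have : F * E ≤ 12 * F₀ * E := by gcongr
    nlinarith [mul_nonneg hF.le (mul_nonneg ha.le (sq_nonneg κ))]
  rcases lt_or_ge κ (-κ₀ / 10) with h2 | h2
  · have h3 : κ₀ ^ 2 ≤ 100 * κ ^ 2 := by nlinarith
    have h4 : 0 ≤ a / 2 * κ ^ 2 - E := by nlinarith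
    nlinarith [mul_nonneg hF.le h4, mul_nonneg hF₀.le hE0]
  -- From `F₀ ≤ F / 12` and `κ ≥ -κ₀ / 10`: `11 / 12 * F ≤ 11 / 10 * κ₀ * σ`. This leaves a surplus
  -- `2 / 3 * F * t²`, which is what `s² / 3` requires once `s = y - t - z` is inserted; hence `β ≥
  -- 3`.
  · have h3 : 5 / 3 * F ≤ 2 * κ₀ * σ := by nlinarith
    have h4 : 5 / 3 * F * t ^ 2 ≤ 2 * κ₀ * σ * t ^ 2 := by gcongr
    have h5 : s ^ 2 / β ≤ s ^ 2 / 3 := by gcongr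
    have h6 : s = y - t - z := by linarith
    have h7 : s ^ 2 / 3 ≤ 2 / 3 * t ^ 2 + y ^ 2 + 2 * z ^ 2 := by
      rw [h6]
      nlinarith [sq_nonneg (2 * t + 3 * y), sq_nonneg (t - 3 * z), sq_nonneg (y + 2 * z),
        sq_nonneg (2*t+3*y), sq_nonneg (2 * t - 6 * z), sq_nonneg (3 * y + 6 * z)]
    have h8 : 0 ≤ F * (a * κ ^ 2 + (2 / 3 * t ^ 2 + y ^ 2 + 2 * z ^ 2 - s ^ 2 / β)) :=
      mul_nonneg hF.le (by linarith [mul_nonneg ha.le (sq_nonneg κ)])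
    linarith [mul_nonneg hF₀.le hE0]

/-- The terms quadratic in the first derivatives of the test function are nonnegative up to the
contribution of the auxiliary weight. -/
lemma third_order_nonneg {κ : Fin n → ℝ} (hκ : InCone univ (k + 2) κ) {o : Fin n}
    (ho : 0 < κ o) {a Y D β E : ℝ} (ha : 0 < a) (hY : 0 < Y) (hβ : 3 ≤ β)
    (hE : E = (2 * Y / a + 2) * D) (hEκ : (200 + 24 * n) * E ≤ a * κ o ^ 2)
    {T y r s z : Fin n → ℝ}
    (hy : ∀ i, y i ^ 2 ≤ Y * κ i ^ 2) (hr : ∀ i, r i ^ 2 ≤ D) (hs : ∀ i, s i ^ 2 ≤ D)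
    (hrs : ∀ i, r i = s i + z i) (ht : ∀ i, T i / κ o = y i - r i) :
    0 ≤ ∑ i, es (univ.erase i) (k + 1) κ *
        (a * κ i ^ 2 - (T i / κ o) ^ 2 - s i ^ 2 / β + y i ^ 2 + 2 * z i ^ 2) +
      2 / κ o * ∑ i ∈ univ.erase o, T i ^ 2 * es ((univ.erase o).erase i) k κ := by
  have hF : ∀ i, 0 < es (univ.erase i) (k + 1) κ := fun i =>
    hκ.erase (mem_univ i) (k + 1) le_rfl
  have hD : 0 ≤ D := (sq_nonneg _).trans (hr o)
  have hE0 : 0 ≤ E := by rw [hE]; positivity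
  have hn : (0 : ℝ) ≤ n := Nat.cast_nonneg n
  have hE' : 200 * E ≤ a * κ o ^ 2 := by nlinarith [mul_nonneg hn hE0]
  rw [← add_sum_erase univ _ (mem_univ o), mul_sum, add_assoc, ← sum_add_distrib]
  have hβ1 : 1 ≤ β := by linarith
  have h1 := index_lower_bound (z := z o) ha (hF o).le hY (hy o) (hr o) (hs o) hβ1 hE
    (ht o)
  have h2 : ∑ i ∈ univ.erase o, -(12 * es (univ.erase o) (k + 1) κ * E) ≤
      ∑ i ∈ univ.erase o, (es (univ.erase i) (k + 1) κ *
        (a * κ i ^ 2 - (T i / κ o) ^ 2 - s i ^ 2 / β + y i ^ 2 + 2 * z i ^ 2) +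
        2 / κ o * (T i ^ 2 * es ((univ.erase o).erase i) k κ)) := by
    refine sum_le_sum fun i hi => ?_
    have hoi : o ∈ univ.erase i := mem_erase.2 ⟨(ne_of_mem_erase hi).symm, mem_univ o⟩
    have hd := es_erase_sub_es_erase k κ (mem_univ i) hoi
    have hp := hκ.erase_erase_nonneg (mem_univ i) hoi
    refine (index_lower_bound_of_ne ha (hF i) (hF o) hY ho hp hd (hy i) (hr i) (hs i) hβ hE hE'
      (hrs i) (ht i)).trans (le_of_eq ?_)
    rw [erase_right_comm]
    congr 1
    field_simp
  have h3 : -(n * (12 * es (univ.erase o) (k + 1) κ * E)) ≤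
      ∑ i ∈ univ.erase o, -(12 * es (univ.erase o) (k + 1) κ * E) := by
    rw [sum_const, nsmul_eq_mul, mul_neg, neg_le_neg_iff]
    have : ((univ.erase o).card : ℝ) ≤ n := by
      exact_mod_cast (card_le_univ _).trans (by simp)
    have := hF o
    gcongr
  -- The index `o` pays for the losses `12 F_o E` of all others; this fixes the factor `200 + 24 n`.
  have h4 : 0 ≤ es (univ.erase o) (k + 1) κ * (a / 2 * κ o ^ 2 - E - 12 * n * E) :=
    mul_nonneg (hF o).le (by nlinarith)
  linarith

/-- The weighted sum of the second-order conditions at a maximum of the test function. -/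
lemma sum_second_order {F κ W T V η' q : Fin n → ℝ} {P : Fin n → Fin n → ℝ} {o : Fin n}
    {β η m ν a A e : ℝ} (hF : ∀ i, 0 ≤ F i) (ha : 0 < a) (haν : a < ν) (hν : ν ≤ 1)
    (hS : ∀ i, W i / κ o - (T i / κ o) ^ 2 - κ i ^ 2 - 2 * (if i = o then κ o ^ 2 else 0)
      + β * ((V i - κ i * m) / η - (η' i / η) ^ 2)
      - ((-(∑ j, q j * P i j) - ν * κ i ^ 2) / (ν - a) - (-(q i * κ i) / (ν - a)) ^ 2)
      + A * (1 + κ i * e) ≤ 0) :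
    (∑ i, W i * F i) / κ o + ∑ i, F i * (a * κ i ^ 2 - (T i / κ o) ^ 2 - β * (η' i / η) ^ 2
      + (-(q i * κ i) / (ν - a)) ^ 2) + A * ∑ i, F i + β / η * ∑ i, F i * V i ≤
    2 * κ o ^ 2 * F o + (β * m / η - A * e) * ∑ i, κ i * F i
      - 1 / (ν - a) * ∑ j, q j * ∑ i, P i j * F i := by
  have hd : 0 < ν - a := by linarith
  -- Here `ν / (ν - a) = 1 + a / (ν - a)`: the weight compensates the negative term `-κ_i²`, and
  -- since `ν - a ≤ 1` a surplus `a κ_i²` remains.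
  have h1 : ∀ i, F i * (a * κ i ^ 2) ≤ F i * (ν / (ν - a) * κ i ^ 2 - κ i ^ 2) := fun i => by
    refine mul_le_mul_of_nonneg_left ?_ (hF i)
    have h2 : a ≤ a / (ν - a) := by rw [le_div_iff₀ hd]; nlinarith
    have h3 : ν / (ν - a) = 1 + a / (ν - a) := by field_simp; ring
    rw [h3]
    nlinarith [sq_nonneg (κ i)]
  have h2 : ∑ i, (W i * F i / κ o + F i * (a * κ i ^ 2 - (T i / κ o) ^ 2 - β * (η' i / η) ^ 2
      + (-(q i * κ i) / (ν - a)) ^ 2) + A * F i + β / η * (F i * V i)) ≤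
      ∑ i, ((2 * if i = o then κ o ^ 2 * F o else 0) + (β * m / η - A * e) * (κ i * F i)
        - 1 / (ν - a) * ∑ j, q j * (P i j * F i)) := by
    refine sum_le_sum fun i _ => ?_
    have h3 := mul_nonpos_of_nonneg_of_nonpos (hF i) (hS i)
    have e1 : (if i = o then κ o ^ 2 * F o else 0) = F i * (if i = o then κ o ^ 2 else 0) := by
      split_ifs with h
      · rw [h]; ring
      · ring
    have e2 : ∑ j, q j * (P i j * F i) = F i * ∑ j, q j * P i j := by
      rw [mul_sum]; exact sum_congr rfl fun j _ => by ring
    have e3 : W i * F i / κ o = F i * (W i / κ o) := by ring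
    rw [e1, e2, e3]
    have h4 := h1 i
    set Q := ∑ j, q j * P i j
    set N := -(q i * κ i) / (ν - a)
    set R := (if i = o then κ o ^ 2 else 0)
    have e4 : (-Q - ν * κ i ^ 2) / (ν - a) = -(1 / (ν - a) * Q) - ν / (ν - a) * κ i ^ 2 := by
      ring
    have e5 : (V i - κ i * m) / η = V i / η - κ i * m / η := by ring
    rw [e4, e5] at h3
    have e6 : β / η * (F i * V i) = β * (F i * (V i / η)) := by ring
    have e7 : (β * m / η - A * e) * (κ i * F i) =
      β * (F i * (κ i * m / η)) - A * e * (κ i * F i) := by ring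
    rw [e6, e7]
    nlinarith
  simp only [sum_add_distrib, sum_sub_distrib, ← mul_sum, ← sum_div, sum_ite_eq', mem_univ,
    if_true] at h2
  have e8 : ∑ j, q j * ∑ i, P i j * F i = ∑ i, ∑ j, q j * (P i j * F i) := by
    simp only [mul_sum]
    exact sum_comm
  rw [e8]
  linarith

end MaximumPoint

end KCurvature

namespace KCurvature

open Finset

/-! ### The curvature bound from the conditions at the maximum -/

section MaximumPoint

set_option maxHeartbeats 1000000 in
/-- The curvature bound at a maximum point of the test function, from the first and second order
conditions there. -/
lemma curvature_mul_le_of_max (n k : ℕ) (hn : k + 2 ≤ n) {β B B' : ℝ} (hβ : 3 ≤ β) (hB : 1 ≤ B)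
    (hB' : 0 ≤ B') :
    ∃ C : ℝ, ∀ (κ : Fin n → ℝ) (o : Fin n) (G g₂ : ℝ) (g W T V X η' q : Fin n → ℝ)
      (M P : Fin n → Fin n → ℝ) (η m ν e : ℝ),
      InCone univ (k + 2) κ → 0 < κ o → 0 < G → es univ (k + 2) κ = G ^ (k + 1) →
      (∀ i j, M i j = M j i) → (∀ i, M o i = T i) →
      (∑ i, M i i * es (univ.erase i) (k + 1) κ = G ^ (k + 1) * ((k + 1) * (g o / G))) →
      (∑ i, (W i - κ o ^ 2 * κ i) * es (univ.erase i) (k + 1) κ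
        - 2 * κ o ^ 3 * es (univ.erase o) (k + 1) κ
        + ∑ i, ∑ j ∈ univ.erase i, (M i i * M j j - M i j * M j i) *
          es ((univ.erase i).erase j) k κ =
        G ^ (k + 1) * ((k + 1) * k * (g o / G) ^ 2 + (k + 1) * (g₂ / G))) →
      (∀ j, ∑ i, P i j * es (univ.erase i) (k + 1) κ = (k + 1) * G ^ k * g j) →
      (∀ j, |g j| ≤ B) → -(B * (1 + κ o)) ≤ g₂ → g o ^ 2 ≤ B' * κ o * G →
      0 < η → η ≤ B → (∀ i, |η' i| ≤ B) → (0 ≤ ∑ i, es (univ.erase i) (k + 1) κ * V i) →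
      |m| ≤ B → (∀ i, |q i| ≤ 1) → 1 / B ≤ ν → ν ≤ 1 → (∀ i, |X i| ≤ B) → |e| ≤ B →
      (∀ i, T i / κ o + β * (η' i / η) - -(q i * κ i) / (ν - 1 / (2 * B))
        + 1 / (4 * B ^ 2) * X i = 0) →
      (∀ i, W i / κ o - (T i / κ o) ^ 2 - κ i ^ 2 - 2 * (if i = o then κ o ^ 2 else 0)
        + β * ((V i - κ i * m) / η - (η' i / η) ^ 2)
        - ((-(∑ j, q j * P i j) - ν * κ i ^ 2) / (ν - 1 / (2 * B))
          - (-(q i * κ i) / (ν - 1 / (2 * B))) ^ 2)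
        + 1 / (4 * B ^ 2) * (1 + κ i * e) ≤ 0) →
      κ o * η ≤ C := by
  set E₀ : ℝ := (2 * (4 * B ^ 2) / (1 / (2 * B)) + 2) * ((β + 1) * B) ^ 2 with hE₀
  set C₃ : ℝ := (B * (2 * k + 2) + B') + 2 * B ^ 2 * n * (k + 1) with hC₃
  set A : ℝ := 1 / (4 * B ^ 2) with hA
  set a : ℝ := 1 / (2 * B) with ha
  set L : ℝ := C₃ * 2 / A with hL
  have hB0 : 0 < B := by linarith
  have hA0 : 0 < A := by positivity
  have ha0 : 0 < a := by positivity
  have hE₀0 : 0 ≤ E₀ := by positivity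
  have hC₃0 : 0 ≤ C₃ := by positivity
  have hL0 : 0 ≤ L := by positivity
  -- The three summands give in turn, if the bound fails: `κ o` so large that `A * ∑ F_i` beats all
  -- multiples of `G ^ k`; the inequality `κ o * η > (β + 1) * B` that is finally contradicted; and
  -- the smallness of `E` required by `third_order_nonneg`.
  refine ⟨B * (1 + L ^ (k + 1)) + (β + 1) * B + (1 + 2 * B * (200 + 24 * n) * E₀), ?_⟩
  intro κ o G g₂ g W T V X η' q M P η m ν e hκ ho hG hσ hMs hMT h1 h2 hP hg hg₂ hgo hη hηB hη' hV
    hm hq hνB hν1 hX he hcrit hS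
  by_contra! hbig
  have hLk : 0 ≤ L ^ (k + 1) := by positivity
  have hn0 : (0 : ℝ) ≤ n := Nat.cast_nonneg n
  have hk0 : (0 : ℝ) ≤ k := Nat.cast_nonneg k
  have hr0 : 0 ≤ 2 * B * (200 + 24 * n) * E₀ := by positivity
  have hβB : 0 ≤ (β + 1) * B := by positivity
  have hκo1 : 1 + L ^ (k + 1) ≤ κ o := by
    have : B * (1 + L ^ (k + 1)) ≤ κ o * B := by
      have : κ o * η ≤ κ o * B := by gcongr
      linarith
    exact le_of_mul_le_mul_left (by linarith) hB0
  have hB1 : 0 ≤ B * (1 + L ^ (k + 1)) := by positivity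
  have hκη1 : (β + 1) * B < κ o * η := by linarith
  have hκη2 : 1 + 2 * B * (200 + 24 * n) * E₀ ≤ κ o * η := by linarith
  have hf : 0 < G ^ (k + 1) := pow_pos hG _
  have hGk : 0 < G ^ k := pow_pos hG _
  have hF : ∀ i, 0 < es (univ.erase i) (k + 1) κ := fun i =>
    hκ.erase (mem_univ i) (k + 1) le_rfl
  have haν : a ≤ ν - a := by
    have : (2 : ℝ) * a = 1 / B := by rw [ha]; field_simp
    linarith
  have hd : 0 < ν - a := by linarith
  have hdinv : 1 / (ν - a) ≤ 2 * B := by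
    rw [div_le_iff₀ hd]
    have : 2 * B * a = 1 := by rw [ha]; field_simp
    have := mul_le_mul_of_nonneg_left haν (by positivity : 0 ≤ 2 * B)
    linarith
  have hBη : 1 ≤ B / η := by rwa [le_div_iff₀ hη, one_mul]
  have hAX : ∀ c : ℝ, |c| ≤ B → |A * c| ≤ B / η := fun c hc => by
    rw [abs_mul, abs_of_pos hA0]
    calc A * |c| ≤ A * B := by gcongr
      _ = 1 / (4 * B) := by rw [hA]; field_simp
      _ ≤ 1 := by rw [div_le_one (by positivity)]; linarith
      _ ≤ B / η := hBη
  have fourth := sum_fourth_ge hκ hG hσ hMs hMT h1 h2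
  have second := sum_second_order (fun i => (hF i).le) ha0 (by linarith) hν1 hS
  have hs : ∀ i, |β * (η' i / η)| ≤ β * (B / η) := fun i => by
    rw [abs_mul, abs_div, abs_of_pos hη, abs_of_pos (by linarith : 0 < β)]
    have := hη' i
    gcongr
  have third := third_order_nonneg (Y := 4 * B ^ 2) (D := ((β + 1) * B / η) ^ 2) (β := β)
    (E := E₀ / η ^ 2) (T := T) (y := fun i => -(q i * κ i) / (ν - a))
    (r := fun i => β * (η' i / η) + A * X i) (s := fun i => β * (η' i / η))
    (z := fun i => A * X i) hκ ho ha0 (by positivity) hβ (by rw [hE₀, div_pow, mul_div_assoc])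
    (by
      rw [← mul_div_assoc, div_le_iff₀ (by positivity)]
      have e1 : (1 + 2 * B * (200 + 24 * n) * E₀) ≤ (κ o * η) ^ 2 :=
        hκη2.trans (le_self_pow₀ (by linarith) two_ne_zero)
      have e2 : a * κ o ^ 2 * η ^ 2 = (κ o * η) ^ 2 / (2 * B) := by rw [ha]; field_simp
      rw [e2, le_div_iff₀ (by positivity)]
      linarith)
    (fun i => by
      rw [div_pow, div_le_iff₀ (by positivity), neg_sq, mul_pow]
      have h3 : q i ^ 2 ≤ 1 := (sq_le_one_iff_abs_le_one _).2 (hq i)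
      have h4 : 1 ≤ 4 * B ^ 2 * (ν - a) ^ 2 := by
        have : 1 ≤ 2 * B * (ν - a) := by rwa [div_le_iff₀ hd] at hdinv
        have := one_le_pow₀ this (n := 2)
        linarith [show (2 * B * (ν - a)) ^ 2 = 4 * B ^ 2 * (ν - a) ^ 2 by ring]
      calc q i ^ 2 * κ i ^ 2 ≤ 1 * κ i ^ 2 := by gcongr
        _ ≤ 4 * B ^ 2 * (ν - a) ^ 2 * κ i ^ 2 := by gcongr
        _ = _ := by ring)
    (fun i => by
      refine sq_le_sq' ?_ ?_ <;>
      · have := abs_le.1 (hs i)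
        have := abs_le.1 (hAX _ (hX i))
        have : (β + 1) * B / η = β * (B / η) + B / η := by ring
        linarith)
    (fun i => by
      refine sq_le_sq' ?_ ?_ <;>
      · have := abs_le.1 (hs i)
        have : (β + 1) * B / η = β * (B / η) + B / η := by ring
        linarith)
    (fun i => rfl)
    (fun i => by have := hcrit i; linarith)
  -- The choice `A = 1 / (4 B²)` makes the squares of `A * X i` cost only half of `A * ∑ F_i`; the
  -- other half is spent in `hsumF'`.
  have hz : ∑ i, es (univ.erase i) (k + 1) κ * (2 * (A * X i) ^ 2) ≤
      A / 2 * ∑ i, es (univ.erase i) (k + 1) κ := by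
    rw [mul_sum]
    refine sum_le_sum fun i _ => ?_
    rw [mul_comm (A / 2)]
    refine mul_le_mul_of_nonneg_left ?_ (hF i).le
    have h3 : X i ^ 2 ≤ B ^ 2 := sq_le_sq' (by linarith [abs_le.1 (hX i)]) (abs_le.1 (hX i)).2
    have h4 : A * B ^ 2 = 1 / 4 := by rw [hA]; field_simp
    calc 2 * (A * X i) ^ 2 = 2 * A * (A * X i ^ 2) := by ring
      _ ≤ 2 * A * (A * B ^ 2) := by gcongr
      _ = A / 2 := by rw [h4]; ring
  have hsum : ∑ i, es (univ.erase i) (k + 1) κ *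
        (a * κ i ^ 2 - (T i / κ o) ^ 2 - (β * (η' i / η)) ^ 2 / β
          + (-(q i * κ i) / (ν - a)) ^ 2 + 2 * (A * X i) ^ 2) =
      ∑ i, es (univ.erase i) (k + 1) κ * (a * κ i ^ 2 - (T i / κ o) ^ 2 - β * (η' i / η) ^ 2
      + (-(q i * κ i) / (ν - a)) ^ 2) + ∑ i, es (univ.erase i) (k + 1) κ * (2 * (A * X i) ^ 2) := by
    rw [← sum_add_distrib]
    refine sum_congr rfl fun i _ => ?_
    have : (β * (η' i / η)) ^ 2 / β = β * (η' i / η) ^ 2 := by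
      have : β ≠ 0 := by linarith
      field_simp
    rw [this]; ring
  rw [hsum] at third
  set S₁ := ∑ i, es (univ.erase i) (k + 1) κ * (a * κ i ^ 2 - (T i / κ o) ^ 2 -
    β * (η' i / η) ^ 2 + (-(q i * κ i) / (ν - a)) ^ 2)
  -- After division by `κ o` the derivatives of `G` cost only a multiple of `G ^ k`: `g₂` is at
  -- least `-2 B κ o`, and `g o ^ 2 / G` is at most `B' κ o`.
  have fourth' : κ o * ((k + 2) * G ^ (k + 1)) + 2 * κ o ^ 2 * es (univ.erase o) (k + 1) κ
      + 2 / κ o * ∑ i ∈ univ.erase o, T i ^ 2 * es ((univ.erase o).erase i) k κ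
      - G ^ k * ((B * (2 * k + 2) + B')) ≤ (∑ i, W i * es (univ.erase i) (k + 1) κ) / κ o := by
    rw [le_div_iff₀ ho]
    refine le_trans ?_ fourth
    have e1 : G ^ (k + 1) * ((k + 1) * (g₂ / G) - (g o / G) ^ 2) =
        G ^ k * ((k + 1) * g₂ - g o ^ 2 / G) := by
      rw [pow_succ]; field_simp
    have e2 : g o ^ 2 / G ≤ B' * κ o := by rwa [div_le_iff₀ hG]
    have e3 : -((B * (2 * k + 2) + B') * κ o) ≤ (k + 1) * g₂ - g o ^ 2 / G := by
      have : (k + 1) * -(B * (1 + κ o)) ≤ (k + 1) * g₂ := by gcongr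
      have : 0 ≤ (k + 1) * (B * (κ o - 1)) := by
        have : 0 ≤ κ o - 1 := by linarith
        positivity
      linarith
    rw [e1]
    have e4 := mul_le_mul_of_nonneg_left e3 hGk.le
    have e5 : 2 / κ o * (∑ i ∈ univ.erase o, T i ^ 2 * es ((univ.erase o).erase i) k κ) * κ o =
      2 * ∑ i ∈ univ.erase o, T i ^ 2 * es ((univ.erase o).erase i) k κ := by field_simp
    rw [sub_mul, add_mul, add_mul, e5]
    linarith
  have heuler : ∑ i, κ i * es (univ.erase i) (k + 1) κ = (k + 2) * G ^ (k + 1) := by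
    have := sum_mul_es_erase univ (k + 1) κ
    rw [hσ] at this
    push_cast at this
    rw [this]; ring
  have hm' : (β * m / η - A * e) ≤ (β + 1) * B / η := by
    have e1 : β * m / η ≤ β * B / η := by
      have := (abs_le.1 hm).2
      gcongr
    have e2 := (abs_le.1 (hAX e he)).1
    have : (β + 1) * B / η = β * B / η + B / η := by ring
    linarith
  have hP' : -(1 / (ν - a) * ∑ j, q j * ∑ i, P i j * es (univ.erase i) (k + 1) κ) ≤
      G ^ k * (2 * B ^ 2 * n * (k + 1)) := by
    have e1 : -(∑ j, q j * ∑ i, P i j * es (univ.erase i) (k + 1) κ) ≤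
        ∑ j : Fin n, G ^ k * ((k + 1) * B) := by
      rw [← sum_neg_distrib]
      refine sum_le_sum fun j _ => ?_
      rw [hP j]
      have e2 : -(q j * g j) ≤ B := by
        refine (neg_le_abs _).trans ?_
        rw [abs_mul]
        exact (mul_le_mul (hq j) (hg j) (abs_nonneg _) zero_le_one).trans_eq (one_mul B)
      have e3 : 0 ≤ (k + 1) * G ^ k := by positivity
      have := mul_le_mul_of_nonneg_left e2 e3
      linarith
    rw [sum_const, card_univ, Fintype.card_fin, nsmul_eq_mul] at e1
    have e2 : 0 ≤ (n : ℝ) * (G ^ k * ((k + 1) * B)) := by positivity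
    have e3 : 0 < 1 / (ν - a) := by positivity
    calc -(1 / (ν - a) * ∑ j, q j * ∑ i, P i j * es (univ.erase i) (k + 1) κ)
        = 1 / (ν - a) * -(∑ j, q j * ∑ i, P i j * es (univ.erase i) (k + 1) κ) := by ring
      _ ≤ 1 / (ν - a) * (n * (G ^ k * ((k + 1) * B))) := by gcongr
      _ ≤ 2 * B * (n * (G ^ k * ((k + 1) * B))) := by gcongr
      _ = _ := by ring
  have hsumF : G ^ k * (C₃ * 2 / A) ≤ ∑ i, es (univ.erase i) (k + 1) κ := by
    have e1 := hκ.es_pow_ge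
    have e2 := (hκ.mono (by omega : 2 ≤ k + 2)).le_es_one (mem_univ o)
    have e3 : (G ^ k * L) ^ (k + 1) ≤ es univ (k + 1) κ ^ (k + 1) := by
      refine le_trans ?_ e1
      rw [hσ, mul_pow, ← pow_mul, ← pow_mul, mul_comm (k + 1) k]
      have : L ^ (k + 1) ≤ es univ 1 κ := by linarith
      gcongr
    have e4 := le_of_pow_le_pow_left₀ (by omega) (hκ (k + 1) (by omega)).le e3
    rw [sum_es_erase, card_univ, Fintype.card_fin]
    have e5 : (1 : ℝ) ≤ (n : ℝ) - ((k + 1 : ℕ) : ℝ) := by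
      have : ((k + 2 : ℕ) : ℝ) ≤ n := by exact_mod_cast hn
      push_cast at this ⊢
      linarith
    exact e4.trans (le_mul_of_one_le_left (hκ (k + 1) (by omega)).le e5)
  have hsumF' : G ^ k * C₃ ≤ A / 2 * ∑ i, es (univ.erase i) (k + 1) κ := by
    have := mul_le_mul_of_nonneg_left hsumF (by positivity : 0 ≤ A / 2)
    have e1 : A / 2 * (G ^ k * (C₃ * 2 / A)) = G ^ k * C₃ := by field_simp
    linarith
  have hβη : 0 ≤ β / η * ∑ i, es (univ.erase i) (k + 1) κ * V i := by positivity
  rw [heuler] at second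
  -- On adding everything the terms `2 κ_o² F_o` cancel, the third-order and barrier terms are
  -- nonnegative, and `A * ∑ F_i` covers the multiples of `G ^ k`. Only multiples of `G ^ (k + 1)`
  -- remain, and this power divides out.
  have hfin : κ o * ((k + 2) * G ^ (k + 1)) ≤ (β + 1) * B / η * ((k + 2) * G ^ (k + 1)) := by
    have e1 := mul_le_mul_of_nonneg_right hm' (by positivity : 0 ≤ ((k : ℝ) + 2) * G ^ (k + 1))
    have e2 : G ^ k * C₃ = G ^ k * ((B * (2 * k + 2) + B')) + G ^ k * (2 * B ^ 2 * n * (k + 1)) := by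
      rw [hC₃]; ring
    linarith
  have hfin2 := le_of_mul_le_mul_right hfin (by positivity)
  rw [le_div_iff₀ hη] at hfin2
  linarith

end MaximumPoint

end KCurvature

namespace KCurvature

open Finset Filter Topology Matrix

/-! ### The test function and its first and second order conditions -/

section LocalEstimate

/-- The function `ft` is merely `C^{1,1}`, but along a curve in the graph it is a root of the twice
differentiable positive curvature function, so it has a second derivative there. -/
lemma HasJet.of_pow_eq {S g : ℝ → ℝ} {a b c : ℝ} {k : ℕ} (hS : HasJet S a b c)
    (hg : ∀ᶠ t in 𝓝 0, 0 < g t ∧ S t = g t ^ (k + 1)) :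
    ∃ g₁ g₂ : ℝ, HasJet g (g 0) g₁ g₂ ∧ a = g 0 ^ (k + 1) ∧
      b = g 0 ^ (k + 1) * ((k + 1) * (g₁ / g 0)) ∧
      c = g 0 ^ (k + 1) * ((k + 1) * k * (g₁ / g 0) ^ 2 + (k + 1) * (g₂ / g 0)) := by
  obtain ⟨h0, h0'⟩ := hg.self_of_nhds
  have ha : a = g 0 ^ (k + 1) := by rw [← hS.val, h0']
  have ha0 : a ≠ 0 := by rw [ha]; positivity
  have hJ := ((hS.log ha0).const_mul ((k : ℝ) + 1)⁻¹).exp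
  have hJ' : HasJet g _ _ _ := hJ.congr <| by
    filter_upwards [hg] with t ⟨ht, ht'⟩
    rw [ht', Real.log_pow]
    push_cast
    rw [← mul_assoc, inv_mul_cancel₀ (by positivity), one_mul, Real.exp_log ht]
  obtain ⟨g₁, g₂, hJg⟩ : ∃ g₁ g₂, HasJet g (g 0) g₁ g₂ :=
    ⟨_, _, hJ'.congr_val hJ'.val rfl rfl⟩
  refine ⟨g₁, g₂, hJg, ha, ?_⟩
  have hp := (hJg.pow (k + 1)).congr (g := S) (by filter_upwards [hg] with t ht using ht.2)
  obtain ⟨-, h2, h3⟩ := hS.unique hp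
  rw [h2, h3]
  clear hJ hJ' hp h2 h3
  constructor
  · rw [pow_succ]; push_cast; field_simp
  · cases k with
    | zero => push_cast; field_simp; simp
    | succ k => simp only [Nat.add_sub_cancel]; push_cast; field_simp; ring

lemma HasJet.eventually_pos {f : ℝ → ℝ} {a b c : ℝ} (h : HasJet f a b c) (ha : 0 < a) :
    ∀ᶠ t in 𝓝 0, 0 < f t :=
  h.continuousAt.eventually (lt_mem_nhds (by rw [h.val]; exact ha))

/-- Difference quotients of `fderiv ft (Z t) (Z' t)` at `0` need only the Lipschitz bound on the
derivative of `ft`; their limit exists by `hJ`. -/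
lemma abs_snd_jet_le {V : Type*} [NormedAddCommGroup V] [NormedSpace ℝ V] {ft : V → ℝ}
    {S : Set V} {K : ℝ} {Z Z' : ℝ → V} {a : V} {g₀ g₁ g₂ : ℝ}
    (hft : ∀ᶠ t in 𝓝 0, Z t ∈ S ∧ DifferentiableAt ℝ ft (Z t))
    (hL : ∀ p ∈ S, ∀ q ∈ S, ‖fderiv ℝ ft p - fderiv ℝ ft q‖ ≤ K * ‖p - q‖)
    (hK : ‖fderiv ℝ ft (Z 0)‖ ≤ K) (h1 : ∀ᶠ t in 𝓝 0, HasDerivAt Z (Z' t) t)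
    (h2 : HasDerivAt Z' a 0) (hJ : HasJet (fun t => ft (Z t)) g₀ g₁ g₂) :
    g₁ = fderiv ℝ ft (Z 0) (Z' 0) ∧ |g₂| ≤ K * (‖Z' 0‖ ^ 2 + ‖a‖) := by
  obtain ⟨f', j1, j2, j3, j4⟩ := hJ
  have hf' : ∀ᶠ t in 𝓝 0, f' t = fderiv ℝ ft (Z t) (Z' t) := by
    filter_upwards [hft, h1, j1] with t ht h1t jt
    exact jt.unique (ht.2.hasFDerivAt.comp_hasDerivAt t h1t)
  refine ⟨j4 ▸ hf'.self_of_nhds, ?_⟩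
  have hs1 := (hasDerivAt_iff_tendsto_slope.1 j2).abs
  have hs2 := (hasDerivAt_iff_tendsto_slope.1 h1.self_of_nhds).norm
  have hs3 := (hasDerivAt_iff_tendsto_slope.1 h2).norm
  have hs4 := (h2.continuousAt.tendsto.mono_left (nhdsWithin_le_nhds (s := {0}ᶜ))).norm
  have hs5 := ((hs2.const_mul K).mul hs4).add (hs3.const_mul K)
  refine (le_of_tendsto_of_tendsto hs1 hs5 ?_).trans_eq (by ring)
  have hfw := hf'.filter_mono (nhdsWithin_le_nhds (s := {0}ᶜ))
  have hftw := hft.filter_mono (nhdsWithin_le_nhds (s := {0}ᶜ))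
  filter_upwards [hfw, hftw] with t ht htS
  rw [_root_.slope_def_module, _root_.slope_def_module, _root_.slope_def_module, sub_zero,
    smul_eq_mul, abs_mul, norm_smul, norm_smul, Real.norm_eq_abs, ht, hf'.self_of_nhds]
  have e1 : fderiv ℝ ft (Z t) (Z' t) - fderiv ℝ ft (Z 0) (Z' 0) =
      (fderiv ℝ ft (Z t) - fderiv ℝ ft (Z 0)) (Z' t) + fderiv ℝ ft (Z 0) (Z' t - Z' 0) := by
    simp
  have e2 : |fderiv ℝ ft (Z t) (Z' t) - fderiv ℝ ft (Z 0) (Z' 0)| ≤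
      K * ‖Z t - Z 0‖ * ‖Z' t‖ + K * ‖Z' t - Z' 0‖ := by
    rw [e1, ← Real.norm_eq_abs]
    refine (norm_add_le _ _).trans (add_le_add ?_ ?_)
    · refine (ContinuousLinearMap.le_opNorm _ _).trans ?_
      have := hL _ htS.1 _ hft.self_of_nhds.1
      gcongr
    · refine (ContinuousLinearMap.le_opNorm _ _).trans ?_
      gcongr
  calc |t⁻¹| * |fderiv ℝ ft (Z t) (Z' t) - fderiv ℝ ft (Z 0) (Z' 0)|
      ≤ |t⁻¹| * (K * ‖Z t - Z 0‖ * ‖Z' t‖ + K * ‖Z' t - Z' 0‖) := by gcongr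
    _ = _ := by ring

variable {n : ℕ}

local notation "E" => EuclideanSpace ℝ (Fin n)

open scoped RealInnerProductSpace

/-- The quadratic form of the second fundamental form, normalised by the metric. -/
noncomputable def normalCurvature (u : E → ℝ) (x ξ : E) : ℝ :=
  (slope u x)⁻¹ * fderiv ℝ (fderiv ℝ u) x ξ ξ / (‖ξ‖ ^ 2 + ⟪gradVec u x, ξ⟫ ^ 2)

/-- The weight of the test function. -/
noncomputable def testWeight (u ψ : E → ℝ) (β : ℕ) (B : ℝ) (z x : E) : ℝ :=
  (ψ x - u x) ^ β * Real.exp (1 / (8 * B ^ 2) * (‖x - z‖ ^ 2 + u x ^ 2)) /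
    ((slope u x)⁻¹ - 1 / (2 * B))

namespace IsTangentChart

variable {u U ψ : EuclideanSpace ℝ (Fin n) → ℝ} {x₀ : EuclideanSpace ℝ (Fin n)}
  {b : Fin n → EuclideanSpace ℝ (Fin n)} {κ : Fin n → ℝ}

lemma tendsto_chartMap_line (h : IsTangentChart u x₀ b U) (e : Fin n) :
    Tendsto (fun t : ℝ => chartMap x₀ (gradVec u x₀) b U (t • EuclideanSpace.single e 1)) (𝓝 0)
      (𝓝 x₀) :=
  h.tendsto_chartMap.comp (IsNormalized.tendsto_line e)

/-- The first and second order conditions at a maximum of the test function. -/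
lemma conditions_of_max (h : IsTangentChart u x₀ b U) (hU : IsNormalized U κ)
    (hu : ContDiffAt ℝ 4 u x₀) (hb : IsFrame (gradVec u x₀) b) (hψ : ContDiffAt ℝ 2 ψ x₀)
    {β : ℕ} {B : ℝ} (hB : 0 < B) {o : Fin n} (ho : 0 < κ o) (hη : 0 < ψ x₀ - u x₀)
    (hs : slope u x₀ ≤ B) (z : E)
    (hmax : ∀ᶠ x in 𝓝 x₀, ∀ ξ : E, ξ ≠ 0 →
      testWeight u ψ β B z x * normalCurvature u x ξ ≤ testWeight u ψ β B z x₀ * κ o)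
    (e : Fin n) :
    pd e (pd o (pd o U)) 0 / κ o
      + β * ((fderiv ℝ ψ x₀ (b e) - ⟪gradVec u x₀, b e⟫) / (ψ x₀ - u x₀))
      - -(⟪gradVec u x₀, b e⟫ * κ e) / ((slope u x₀)⁻¹ - 1 / (2 * B))
      + 1 / (4 * B ^ 2) * (⟪x₀ - z, b e⟫ + u x₀ * ⟪gradVec u x₀, b e⟫) = 0 ∧
    pd e (pd e (pd o (pd o U))) 0 / κ o - (pd e (pd o (pd o U)) 0 / κ o) ^ 2 - κ e ^ 2
      - 2 * (if e = o then κ o ^ 2 else 0)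
      + β * ((fderiv ℝ (fderiv ℝ ψ) x₀ (b e) (b e)
          - κ e * ((slope u x₀)⁻¹ * (fderiv ℝ ψ x₀ (gradVec u x₀) + 1))) / (ψ x₀ - u x₀)
        - ((fderiv ℝ ψ x₀ (b e) - ⟪gradVec u x₀, b e⟫) / (ψ x₀ - u x₀)) ^ 2)
      - ((-(∑ j, ⟪gradVec u x₀, b j⟫ * pd e (pd e (pd j U)) 0) - (slope u x₀)⁻¹ * κ e ^ 2)
          / ((slope u x₀)⁻¹ - 1 / (2 * B))
        - (-(⟪gradVec u x₀, b e⟫ * κ e) / ((slope u x₀)⁻¹ - 1 / (2 * B))) ^ 2)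
      + 1 / (4 * B ^ 2) *
        (1 + κ e * ((slope u x₀)⁻¹ * (u x₀ - ⟪x₀ - z, gradVec u x₀⟫))) ≤ 0 := by
  set X := fun t : ℝ => chartMap x₀ (gradVec u x₀) b U (t • EuclideanSpace.single e 1) with hX
  have hX0 : X 0 = x₀ := by simp [hX, h.chartMap_zero]
  have hXt : Tendsto X (𝓝 0) (𝓝 x₀) := h.tendsto_chartMap_line e
  have hd : 0 < (slope u x₀)⁻¹ - 1 / (2 * B) := by
    have h1 : B⁻¹ ≤ (slope u x₀)⁻¹ := inv_anti₀ (slope_pos u x₀) hs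
    have h2 : 1 / (2 * B) = B⁻¹ / 2 := by field_simp
    have h3 : 0 < B⁻¹ := by positivity
    rw [h2]; linarith
  have j1 := hU.jet_log_curvature e o ho
  have j2 := ((h.jet_comp hU hψ e).sub (h.jet_height hU e))
  have j3 := hU.jet_normal e (slope u x₀)⁻¹ fun j => ⟪gradVec u x₀, b j⟫
  have hgeo := (IsNormalized.tendsto_line (n := n) e).eventually (h.eventually_geometry hu hb)
  have j3' : HasJet (fun t => (slope u (X t))⁻¹) _ _ _ := j3.congr <| by
    filter_upwards [hgeo] with t ht using ht.1
  have j4 := (j3'.sub (HasJet.const (1 / (2 * B)))).log hd.ne'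
  have j5 := h.jet_dist hU hb z e
  have jQ := ((j1.add ((j2.log hη.ne').const_mul (β : ℝ))).add
    (j5.const_mul (1 / (8 * B ^ 2)))).sub j4
  have hη' := j2.eventually_pos hη
  have hd' := (j3'.sub (HasJet.const (1 / (2 * B)))).eventually_pos hd
  have hhess := (hU.jet_hess e o o).eventually_pos (by rw [if_pos rfl]; exact ho)
  have hmaxt := hXt.eventually hmax
  -- The logarithm of the test function along a chart axis, with `h_oo / g_oo` as the curvature.
  -- This is the normal curvature of the `o`-th coordinate vector, hence a competitor in `hmax`,
  -- with equality at `t = 0`.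
  have hloc := jQ.of_isLocalMax (by
    rw [IsLocalMax, IsMaxFilter]
    filter_upwards [hη', hd', hhess, hmaxt, hgeo] with t h1 h2 h3 h4 h5
    refine le_of_le_of_eq ?_ jQ.val.symm
    beta_reduce
    obtain ⟨ξ, hξ1, hξ2⟩ := h5.2.2 o
    have hg : 0 < 1 + grad U (t • EuclideanSpace.single e 1) o ^ 2 := by positivity
    have hξ : ξ ≠ 0 := by
      rintro rfl
      rw [inner_zero_right, norm_zero] at hξ1
      simp only [ne_eq, OfNat.ofNat_ne_zero, not_false_eq_true, zero_pow, add_zero] at hξ1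
      linarith
    have h6 := h4 ξ hξ
    have hc : 0 < (slope U (t • EuclideanSpace.single e 1))⁻¹ *
        hess U (t • EuclideanSpace.single e 1) o o /
          (1 + grad U (t • EuclideanSpace.single e 1) o ^ 2) := by
      have := slope_pos U (t • EuclideanSpace.single e 1)
      positivity
    rw [normalCurvature, hξ2, hξ1, testWeight, testWeight] at h6
    have h1' : 0 < ψ (X t) - u (X t) := h1
    have h2' : 0 < (slope u (X t))⁻¹ - 1 / (2 * B) := h2
    have h7 := Real.log_le_log (by positivity) h6
    rw [Real.log_mul (by positivity) hc.ne', Real.log_mul (by positivity) ho.ne',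
      Real.log_div (by positivity) h2'.ne', Real.log_div (by positivity) hd.ne',
      Real.log_mul (by positivity) (by positivity), Real.log_mul (by positivity) (by positivity),
      Real.log_exp, Real.log_exp, Real.log_pow, Real.log_pow] at h7
    linarith)
  obtain ⟨hc1, hc2⟩ := hloc
  constructor
  · rw [← hc1]
    field_simp
    ring
  · refine le_trans (le_of_eq ?_) hc2
    have e1 : (1 : ℝ) / (8 * B ^ 2) = 1 / (4 * B ^ 2) / 2 := by field_simp; norm_num
    rw [e1]
    generalize 1 / (4 * B ^ 2) = A
    generalize ψ x₀ - u x₀ = η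
    simp only [sub_zero]
    generalize (slope u x₀)⁻¹ - 1 / (2 * B) = d
    ring

end IsTangentChart

end LocalEstimate

end KCurvature

namespace KCurvature

open Finset Filter Topology Matrix

/-! ### The curvature bound at an interior maximum -/

section LocalEstimate

variable {n : ℕ}

local notation "E" => EuclideanSpace ℝ (Fin n)

open scoped RealInnerProductSpace

namespace IsTangentChart

variable {u U : EuclideanSpace ℝ (Fin n) → ℝ} {x₀ : EuclideanSpace ℝ (Fin n)}
  {b : Fin n → EuclideanSpace ℝ (Fin n)} {κ : Fin n → ℝ}

lemma exists_curve_deriv (h : IsTangentChart u x₀ b U) (hU : IsNormalized U κ) (e : Fin n) :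
    ∃ Z' : ℝ → E × ℝ, (∀ᶠ t in 𝓝 0, HasDerivAt (fun t : ℝ =>
        (chartMap x₀ (gradVec u x₀) b U (t • EuclideanSpace.single e 1),
          u (chartMap x₀ (gradVec u x₀) b U (t • EuclideanSpace.single e 1)))) (Z' t) t) ∧
      Z' 0 = (b e, fderiv ℝ u x₀ (b e)) ∧
      HasDerivAt Z' (-(((slope u x₀)⁻¹ * κ e) • gradVec u x₀), (slope u x₀)⁻¹ * κ e) 0 := by
  obtain ⟨f', h1, h2, h3, h4⟩ := hU.jet_self e
  rw [slope_eq]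
  set p := gradVec u x₀ with hp
  set c := (√(1 + ‖p‖ ^ 2))⁻¹ with hc
  refine ⟨fun t => (b e - (c * f' t) • p, ⟪p, b e⟫ + c * f' t), ?_, ?_, ?_⟩
  · have heq := ((IsNormalized.tendsto_line e).eventually h.eq).eventually_nhds
    filter_upwards [h1, heq] with t ht heqt
    refine HasDerivAt.prodMk ?_ ?_
    · simp only [chartMap_line]
      have h5 : HasDerivAt (fun t : ℝ => x₀ + t • b e) (b e) t := by
        simpa using ((hasDerivAt_id t).smul_const (b e)).const_add x₀
      exact h5.sub ((ht.const_mul c).smul_const p)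
    · have h5 : HasDerivAt (fun t : ℝ => u x₀ + t * ⟪p, b e⟫) ⟪p, b e⟫ t := by
        simpa using ((hasDerivAt_id t).mul_const ⟪p, b e⟫).const_add (u x₀)
      refine (h5.add (ht.const_mul c)).congr_of_eventuallyEq ?_
      filter_upwards [heqt] with s hs
      rw [hs, coeff_eq, map_smul, frameMap_single, inner_smul_right]
      rfl
  · simp [h4, fderiv_eq_inner, hp]
  · have h5 := ((h2.const_mul c).smul_const p).const_sub (b e)
    have h6 := (h2.const_mul c).const_add ⟪p, b e⟫
    exact h5.prodMk h6

lemma norm_curve_snd_le (κ : ℝ) :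
    ‖((-(((slope u x₀)⁻¹ * κ) • gradVec u x₀), (slope u x₀)⁻¹ * κ) : E × ℝ)‖ ≤ |κ| := by
  have hs := slope_pos u x₀
  have h1 := one_le_slope u x₀
  have hp : ‖gradVec u x₀‖ ≤ slope u x₀ := by
    have := slope_sq u x₀
    nlinarith [norm_nonneg (gradVec u x₀)]
  rw [Prod.norm_def, norm_neg, norm_smul, norm_mul, norm_inv, Real.norm_eq_abs, Real.norm_eq_abs,
    abs_of_pos hs]
  refine max_le ?_ ?_
  · rw [mul_right_comm]
    refine mul_le_of_le_one_left (abs_nonneg κ) ?_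
    rwa [inv_mul_le_iff₀ hs, mul_one]
  · exact mul_le_of_le_one_left (abs_nonneg κ) (inv_le_one_of_one_le₀ h1)

end IsTangentChart

/-- The curvature bound at an interior maximum of the test function. -/
theorem curvature_mul_le_of_isLocalMax (n k : ℕ) (hn : k + 2 ≤ n) {β : ℕ} (hβ : 3 ≤ β) {B B' : ℝ}
    (hB : 1 ≤ B) (hB' : 0 ≤ B') : ∃ C : ℝ, ∀ (u ψ : EuclideanSpace ℝ (Fin n) → ℝ)
      (x₀ z : EuclideanSpace ℝ (Fin n)) (ft : EuclideanSpace ℝ (Fin n) × ℝ → ℝ)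
      (S : Set (EuclideanSpace ℝ (Fin n) × ℝ)) (b : Fin n → EuclideanSpace ℝ (Fin n))
      (o : Fin n), ContDiffAt ℝ 4 u x₀ → ContDiffAt ℝ 2 ψ x₀ →
      (∀ᶠ x in 𝓝 x₀, (x, u x) ∈ S ∧ DifferentiableAt ℝ ft (x, u x) ∧ 0 < ft (x, u x) ∧
        sigma (k + 2) (principalCurvatures u x) = ft (x, u x) ^ (k + 1)) →
      (∀ p ∈ S, ∀ q ∈ S, ‖fderiv ℝ ft p - fderiv ℝ ft q‖ ≤ B * ‖p - q‖) →
      ‖fderiv ℝ ft (x₀, u x₀)‖ ≤ B →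
      InCone univ (k + 2) (principalCurvatures u x₀) →
      IsFrame (gradVec u x₀) b → (∀ i j, fderiv ℝ (fderiv ℝ u) x₀ (b i) (b j) =
        if i = j then slope u x₀ * principalCurvatures u x₀ i else 0) →
      0 < principalCurvatures u x₀ o →
      fderiv ℝ ft (x₀, u x₀) (b o, fderiv ℝ u x₀ (b o)) ^ 2 ≤
        B' * principalCurvatures u x₀ o * ft (x₀, u x₀) →
      0 < ψ x₀ - u x₀ → ψ x₀ - u x₀ ≤ B → ‖fderiv ℝ ψ x₀‖ + 1 ≤ B →
      ‖x₀ - z‖ + |u x₀| ≤ B → slope u x₀ ≤ B →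
      (0 ≤ ∑ i, es (univ.erase i) (k + 1) (principalCurvatures u x₀) *
        fderiv ℝ (fderiv ℝ ψ) x₀ (b i) (b i)) →
      (∀ᶠ x in 𝓝 x₀, ∀ ξ : EuclideanSpace ℝ (Fin n), ξ ≠ 0 →
        testWeight u ψ β B z x * normalCurvature u x ξ ≤
          testWeight u ψ β B z x₀ * principalCurvatures u x₀ o) →
      principalCurvatures u x₀ o * (ψ x₀ - u x₀) ≤ C := by
  obtain ⟨C, hC⟩ := curvature_mul_le_of_max n k hn (β := β) (B := B) (B' := B')
    (by exact_mod_cast hβ) hB hB'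
  refine ⟨C, ?_⟩
  intro u ψ x₀ z ft S b o hu hψ hft hL hK hκ hb hbd ho hgo hη hηB hψB hz hs hV hmax
  set κ := principalCurvatures u x₀
  obtain ⟨U, hU⟩ := exists_tangentChart hu hb
  have hUn : IsNormalized U κ := hU.isNormalized hu hbd
  have hB0 : 0 < B := by linarith
  have hsp := slope_pos u x₀
  have hs1 := one_le_slope u x₀
  have hp : (slope u x₀)⁻¹ * ‖gradVec u x₀‖ ≤ 1 := by
    rw [inv_mul_le_iff₀ hsp, mul_one]
    have := slope_sq u x₀
    nlinarith [norm_nonneg (gradVec u x₀)]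
  have hq : ∀ i, |⟪gradVec u x₀, b i⟫| ≤ 1 := fun i => hb.abs_inner_le_one i
  have hbn : ∀ i, ‖b i‖ ≤ 1 := fun i => hb.norm_le_one i
  have hinner : ∀ (y : EuclideanSpace ℝ (Fin n)) i, |⟪y, b i⟫| ≤ ‖y‖ := fun y i =>
    (abs_real_inner_le_norm _ _).trans (mul_le_of_le_one_right (norm_nonneg _) (hbn i))
  have hjets : ∀ e, ∃ g₁ g₂ : ℝ, g₁ = fderiv ℝ ft (x₀, u x₀) (b e, fderiv ℝ u x₀ (b e)) ∧
      |g₂| ≤ B * (1 + |κ e|) ∧ es univ (k + 2) κ = ft (x₀, u x₀) ^ (k + 1) ∧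
      (∑ i, pd e (pd i (pd i U)) 0 * es (univ.erase i) (k + 1) κ =
        ft (x₀, u x₀) ^ (k + 1) * ((k + 1) * (g₁ / ft (x₀, u x₀)))) ∧
      (∑ i, (pd e (pd e (pd i (pd i U))) 0 - κ e ^ 2 * κ i) * es (univ.erase i) (k + 1) κ
        - 2 * κ e ^ 3 * es (univ.erase e) (k + 1) κ
        + ∑ i, ∑ j ∈ univ.erase i, (pd e (pd i (pd i U)) 0 * pd e (pd j (pd j U)) 0 -
          pd e (pd i (pd j U)) 0 * pd e (pd j (pd i U)) 0) *
          es ((univ.erase i).erase j) k κ = ft (x₀, u x₀) ^ (k + 1) *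
            ((k + 1) * k * (g₁ / ft (x₀, u x₀)) ^ 2 + (k + 1) * (g₂ / ft (x₀, u x₀)))) := by
    intro e
    have hx := (hU.tendsto_chartMap_line e).eventually hft
    have hgeo := (IsNormalized.tendsto_line (n := n) e).eventually (hU.eventually_geometry hu hb)
    obtain ⟨g₁, g₂, hJ, h1, h2, h3⟩ := (hUn.jet_sigma e k).of_pow_eq (k := k)
      (g := fun t => ft (chartMap x₀ (gradVec u x₀) b U (t • EuclideanSpace.single e 1),
          u (chartMap x₀ (gradVec u x₀) b U (t • EuclideanSpace.single e 1)))) <| by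
        filter_upwards [hx, hgeo] with t ht ht'
        exact ⟨ht.2.2.1, by rw [← ht'.2.1, ht.2.2.2]⟩
    simp only [zero_smul, hU.chartMap_zero] at h1 h2 h3
    obtain ⟨Z', hZ1, hZ2, hZ3⟩ := hU.exists_curve_deriv hUn e
    have hest := abs_snd_jet_le (by filter_upwards [hx] with t ht using ⟨ht.1, ht.2.1⟩) hL
      (by simpa only [zero_smul, hU.chartMap_zero] using hK) hZ1 hZ3 hJ
    simp only [zero_smul, hU.chartMap_zero, hZ2] at hest
    refine ⟨g₁, g₂, hest.1, hest.2.trans ?_, h1, h2, h3⟩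
    have e1 : ‖(b e, fderiv ℝ u x₀ (b e))‖ ≤ 1 := by
      rw [Prod.norm_def, fderiv_eq_inner]
      exact max_le (hbn e) (hq e)
    have e2 := IsTangentChart.norm_curve_snd_le (u := u) (x₀ := x₀) (κ e)
    have e3 : ‖(b e, fderiv ℝ u x₀ (b e))‖ ^ 2 ≤ 1 := pow_le_one₀ (norm_nonneg _) e1
    gcongr
  choose g₁ g₂ hg1 hg2 hσ hj1 hj2 using hjets
  have hft0 := hft.self_of_nhds.2.2.1
  have hc := fun e => hU.conditions_of_max hUn hu hb hψ hB0 ho hη hs z hmax e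
  have hpd3 := pd_three_comm hU.contDiffAt
  -- Equality of mixed partials of `U` plays the part of the Codazzi equations.
  have hT : ∀ i, pd o (pd o (pd i U)) 0 = pd i (pd o (pd o U)) 0 := fun i => by
    rw [(hpd3 i o o).1, (hpd3 o i o).2]
  have hP : ∀ e j, pd e (pd e (pd j U)) 0 = pd j (pd e (pd e U)) 0 := fun e j => by
    rw [(hpd3 j e e).1, (hpd3 e j e).2]
  refine hC κ o (ft (x₀, u x₀)) (g₂ o) g₁ (fun i => pd o (pd o (pd i (pd i U))) 0)
    (fun i => pd i (pd o (pd o U)) 0) (fun i => fderiv ℝ (fderiv ℝ ψ) x₀ (b i) (b i))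
    (fun i => ⟪x₀ - z, b i⟫ + u x₀ * ⟪gradVec u x₀, b i⟫)
    (fun i => fderiv ℝ ψ x₀ (b i) - ⟪gradVec u x₀, b i⟫) (fun i => ⟪gradVec u x₀, b i⟫)
    (fun i j => pd o (pd i (pd j U)) 0) (fun i j => pd j (pd i (pd i U)) 0)
    (ψ x₀ - u x₀) ((slope u x₀)⁻¹ * (fderiv ℝ ψ x₀ (gradVec u x₀) + 1)) (slope u x₀)⁻¹
    ((slope u x₀)⁻¹ * (u x₀ - ⟪x₀ - z, gradVec u x₀⟫))
    hκ ho hft0 (hσ o) (fun i j => (hpd3 o i j).2) hT (hj1 o) (hj2 o) ?_ ?_ ?_ ?_ hη hηB ?_ hV ?_ hq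
    ?_ (inv_le_one_of_one_le₀ hs1) ?_ ?_ (fun i => (hc i).1) ?_
  · intro j
    rw [hj1 j, pow_succ]
    field_simp
  · intro j
    rw [hg1, ← Real.norm_eq_abs]
    refine (ContinuousLinearMap.le_opNorm _ _).trans ?_
    have e1 : ‖(b j, fderiv ℝ u x₀ (b j))‖ ≤ 1 := by
      rw [Prod.norm_def, fderiv_eq_inner]
      exact max_le (hbn j) (hq j)
    exact (mul_le_of_le_one_right (norm_nonneg _) e1).trans hK
  · have := (abs_le.1 (hg2 o)).1
    rwa [abs_of_pos ho] at this
  · rw [hg1]; exact hgo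
  · intro i
    refine (abs_sub _ _).trans (le_trans (add_le_add ?_ (hq i)) hψB)
    rw [← Real.norm_eq_abs]
    exact (ContinuousLinearMap.le_opNorm _ _).trans
      (mul_le_of_le_one_right (norm_nonneg _) (hbn i))
  · rw [abs_mul, abs_of_pos (inv_pos.2 hsp)]
    have e1 : |fderiv ℝ ψ x₀ (gradVec u x₀) + 1| ≤ ‖fderiv ℝ ψ x₀‖ * ‖gradVec u x₀‖ + 1 := by
      refine (abs_add_le _ _).trans ?_
      rw [abs_one, ← Real.norm_eq_abs]
      gcongr
      exact ContinuousLinearMap.le_opNorm _ _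
    have e2 : (slope u x₀)⁻¹ ≤ 1 := inv_le_one_of_one_le₀ hs1
    calc (slope u x₀)⁻¹ * |fderiv ℝ ψ x₀ (gradVec u x₀) + 1|
        ≤ (slope u x₀)⁻¹ * (‖fderiv ℝ ψ x₀‖ * ‖gradVec u x₀‖ + 1) := by gcongr
      _ = ‖fderiv ℝ ψ x₀‖ * ((slope u x₀)⁻¹ * ‖gradVec u x₀‖) + (slope u x₀)⁻¹ := by ring
      _ ≤ ‖fderiv ℝ ψ x₀‖ * 1 + 1 := by gcongr
      _ ≤ B := by linarith
  · rw [one_div]; exact inv_anti₀ hsp hs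
  · intro i
    refine (abs_add_le _ _).trans (le_trans (add_le_add (hinner _ i) ?_) hz)
    rw [abs_mul]
    exact mul_le_of_le_one_right (abs_nonneg _) (hq i)
  · rw [abs_mul, abs_of_pos (inv_pos.2 hsp)]
    have e1 : |u x₀ - ⟪x₀ - z, gradVec u x₀⟫| ≤ |u x₀| + ‖x₀ - z‖ * ‖gradVec u x₀‖ :=
      (abs_sub _ _).trans (add_le_add le_rfl (abs_real_inner_le_norm _ _))
    have e2 : (slope u x₀)⁻¹ ≤ 1 := inv_le_one_of_one_le₀ hs1
    calc (slope u x₀)⁻¹ * |u x₀ - ⟪x₀ - z, gradVec u x₀⟫|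
        ≤ (slope u x₀)⁻¹ * (|u x₀| + ‖x₀ - z‖ * ‖gradVec u x₀‖) := by gcongr
      _ = ‖x₀ - z‖ * ((slope u x₀)⁻¹ * ‖gradVec u x₀‖) + (slope u x₀)⁻¹ * |u x₀| := by ring
      _ ≤ ‖x₀ - z‖ * 1 + 1 * |u x₀| := by gcongr
      _ ≤ B := by linarith
  · intro i
    have h := (hc i).2
    have e1 : ∑ j, ⟪gradVec u x₀, b j⟫ * pd i (pd i (pd j U)) 0 =
        ∑ j, ⟪gradVec u x₀, b j⟫ * pd j (pd i (pd i U)) 0 :=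
      sum_congr rfl fun j _ => by rw [hP]
    rw [e1, pd_four_comm hU.contDiffAt i o] at h
    exact h

end LocalEstimate

end KCurvature

namespace KCurvature

open Filter Topology MeasureTheory Metric

/-! ### Interpolation for positive functions -/

section GradientBound

/-- Interpolation for positive functions: the first derivative is controlled by the value and the
Lipschitz constant of the first derivative. -/
lemma sq_deriv_le_of_pos {φ φ' : ℝ → ℝ} {r N : ℝ} (hr : 0 < r) (hN : 0 < N)
    (hφ : ∀ s, |s| ≤ r → 0 < φ s) (hd : ∀ s, |s| ≤ r → HasDerivAt φ (φ' s) s)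
    (hL : ∀ s, |s| ≤ r → |φ' s - φ' 0| ≤ N * |s|) :
    φ' 0 ^ 2 ≤ 4 * N * φ 0 ∨ N * r ^ 2 ≤ φ 0 := by
  have key : ∀ s, |s| ≤ r → -(φ' 0 * s) ≤ φ 0 + N * s ^ 2 := by
    intro s hs
    have h1 := (convex_Icc (-|s|) |s|).norm_image_sub_le_of_norm_hasDerivWithin_le
      (f := fun t => φ t - φ' 0 * t) (f' := fun t => φ' t - φ' 0) (C := N * |s|) (x := 0) (y := s)
      (fun t ht => ((hd t ((abs_le.2 ht).trans hs)).sub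
        (by simpa using (hasDerivAt_id t).const_mul (φ' 0))).hasDerivWithinAt)
      (fun t ht => (hL t ((abs_le.2 ht).trans hs)).trans
        (by have := abs_le.2 ht; gcongr)) ⟨neg_nonpos.2 (abs_nonneg s), abs_nonneg s⟩
      (abs_le.1 le_rfl)
    have h2 := hφ s hs
    rw [Real.norm_eq_abs, sub_zero, Real.norm_eq_abs, mul_assoc, ← sq, sq_abs, mul_zero,
      sub_zero] at h1
    have := (abs_le.1 h1).2
    linarith
  have h0 := hφ 0 (by simpa using hr.le)
  rcases le_or_gt (N * r ^ 2) (φ 0) with h | h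
  · exact .inr h
  refine .inl ?_
  -- Both summands of `key` equal `φ 0` at this `s`, which balances them. It is admissible exactly
  -- when `N * r² ≥ φ 0`; the failure is covered by the second alternative.
  set s := √(φ 0 / N) with hs
  have hs0 : 0 < s := Real.sqrt_pos.2 (by positivity)
  have hs2 : N * s ^ 2 = φ 0 := by rw [hs, Real.sq_sqrt (by positivity)]; field_simp
  have hsr : s ≤ r := by
    refine Real.sqrt_le_iff.2 ⟨hr.le, ?_⟩
    rw [div_le_iff₀ hN]; linarith
  have k1 := key s (by rwa [abs_of_pos hs0])
  have k2 := key (-s) (by rwa [abs_neg, abs_of_pos hs0])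
  rw [neg_sq] at k2
  have k3 : (φ' 0 * s) ^ 2 ≤ (2 * φ 0) ^ 2 := sq_le_sq' (by linarith) (by linarith)
  have k4 : s ^ 2 * φ' 0 ^ 2 ≤ s ^ 2 * (4 * N * φ 0) := by
    calc s ^ 2 * φ' 0 ^ 2 = (φ' 0 * s) ^ 2 := by ring
      _ ≤ (2 * φ 0) ^ 2 := k3
      _ = 4 * φ 0 * (N * s ^ 2) := by rw [hs2]; ring
      _ = _ := by ring
  exact le_of_mul_le_mul_left k4 (by positivity)

end GradientBound

/-! ### Mollification of the barrier -/

section Mollification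

variable {n : ℕ}

local notation "E" => EuclideanSpace ℝ (Fin n)

/-- Differentiation along a line of a convolution with a compactly supported kernel, for a
function that is Lipschitz near the point and almost everywhere differentiable along the line. -/
lemma hasDerivAt_integral_mul_sub {ρ G D : E → ℝ} (hρc : Continuous ρ) {δ ε L : ℝ}
    (hρ : ∀ t, δ ≤ ‖t‖ → ρ t = 0) (hG : Measurable G) (hD : Measurable D) {x z : E} (hδ : 0 < δ)
    (hδε : δ < ε) (hL : ∀ y ∈ ball x ε, ∀ y' ∈ ball x ε, |G y - G y'| ≤ L * ‖y - y'‖)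
    (hd : ∀ᵐ y : E, y ∈ ball x ε → HasDerivAt (fun h : ℝ => G (y + h • z)) (D y) 0) :
    HasDerivAt (fun h : ℝ => ∫ t, ρ t * G (x + h • z - t)) (∫ t, ρ t * D (x - t)) 0 := by
  have hρi : Integrable ρ := hρc.integrable_of_hasCompactSupport <|
    HasCompactSupport.of_support_subset_isCompact (isCompact_closedBall 0 δ) fun t ht => by
      by_contra hc
      rw [mem_closedBall, dist_zero_right, not_le] at hc
      exact ht (hρ t hc.le)
  have hε : 0 < ε := hδ.trans hδε
  have hx : x ∈ ball x ε := mem_ball_self hε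
  have hs : ∀ᶠ h : ℝ in 𝓝 0, ‖h • z‖ < ε - δ := by
    have : Continuous fun h : ℝ => ‖h • z‖ := by fun_prop
    exact this.continuousAt.eventually (gt_mem_nhds (by simpa using sub_pos.2 hδε))
  have hmem : ∀ h : ℝ, ‖h • z‖ < ε - δ → ∀ t : E, ‖t‖ < δ → x + h • z - t ∈ ball x ε := by
    intro h hh t ht
    rw [mem_ball_iff_norm, show x + h • z - t - x = h • z - t by abel]
    exact (norm_sub_le _ _).trans_lt (by linarith)
  have hx0 : ∀ t : E, ‖t‖ < δ → x - t ∈ ball x ε := fun t ht => by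
    simpa using hmem 0 (by simpa using sub_pos.2 hδε) t ht
  have hmeas : ∀ h : ℝ, AEStronglyMeasurable (fun t => ρ t * G (x + h • z - t)) volume := fun h =>
    (hρc.measurable.mul (hG.comp (measurable_const.sub measurable_id))).aestronglyMeasurable
  refine (hasDerivAt_integral_of_dominated_loc_of_lip (s := {h : ℝ | ‖h • z‖ < ε - δ})
    (F := fun h t => ρ t * G (x + h • z - t)) (F' := fun t => ρ t * D (x - t)) (bound := fun t => |ρ t| * (L * ‖z‖))
    hs (.of_forall hmeas) ?_
    (hρc.measurable.mul (hD.comp (measurable_const.sub measurable_id))).aestronglyMeasurable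
    (.of_forall fun t => ?_) (hρi.abs.mul_const _) ?_).2
  · refine (hρi.abs.mul_const (|G x| + |L| * δ)).mono' (hmeas 0) (.of_forall fun t => ?_)
    rw [norm_mul, Real.norm_eq_abs, Real.norm_eq_abs]
    rcases lt_or_ge ‖t‖ δ with ht | ht
    · gcongr
      have h1 := hL _ (hx0 t ht) x hx
      rw [zero_smul, add_zero]
      rw [show x - t - x = -t by abel, norm_neg] at h1
      have h2 : |G (x - t)| ≤ |G (x - t) - G x| + |G x| := by
        simpa using abs_add_le (G (x - t) - G x) (G x)
      have h3 : L * ‖t‖ ≤ |L| * δ := by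
        have := le_abs_self L
        gcongr
      linarith
    · simp [hρ t ht]
  · rw [lipschitzOnWith_iff_norm_sub_le]
    intro h hh h' hh'
    simp only [Set.mem_ofPred_eq] at hh hh'
    rw [Real.coe_nnabs]
    rcases lt_or_ge ‖t‖ δ with ht | ht
    · have h1 := hL _ (hmem h hh t ht) _ (hmem h' hh' t ht)
      rw [show x + h • z - t - (x + h' • z - t) = (h - h') • z by rw [sub_smul]; abel,
        norm_smul] at h1
      rw [← mul_sub, norm_mul, Real.norm_eq_abs, Real.norm_eq_abs]
      calc |ρ t| * |G (x + h • z - t) - G (x + h' • z - t)|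
          ≤ |ρ t| * (L * (‖h - h'‖ * ‖z‖)) := by gcongr
        _ = |ρ t| * (L * ‖z‖) * ‖h - h'‖ := by ring
        _ ≤ _ := by
          have := le_abs_self (|ρ t| * (L * ‖z‖))
          gcongr
    · simp only [hρ t ht, zero_mul, sub_zero, norm_zero]
      positivity
  · have hq := (volume : Measure E).measurePreserving_sub_left x
    filter_upwards [hq.quasiMeasurePreserving.ae hd] with t ht
    rcases lt_or_ge ‖t‖ δ with htδ | htδ
    · have := (ht (hx0 t htδ)).const_mul (ρ t)
      refine this.congr_of_eventuallyEq (.of_forall fun h => ?_)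
      simp only
      rw [show x + h • z - t = x - t + h • z by abel]
    · simp only [hρ t htδ, zero_mul]
      exact hasDerivAt_const (0 : ℝ) (0 : ℝ)

/-- Mollification of a `C^{1,1}` function. -/
theorem exists_mollification {Ω : Set E} (hΩ : IsOpen Ω) {v : E → ℝ} (hv : ContDiffOn ℝ 1 v Ω)
    {K : ℝ} (hv0 : ∀ x ∈ Ω, |v x| ≤ K) (hv1 : ∀ x ∈ Ω, ‖fderiv ℝ v x‖ ≤ K)
    (hv2 : ∀ x ∈ Ω, ∀ y ∈ Ω, ‖fderiv ℝ v x - fderiv ℝ v y‖ ≤ K * ‖x - y‖) {ε : ℝ} (hε : 0 < ε) :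
    ∃ ψ : E → ℝ, ContDiff ℝ 2 ψ ∧ ∀ x, ball x ε ⊆ Ω → |ψ x - v x| ≤ K * ε ∧
      ‖fderiv ℝ ψ x‖ ≤ K ∧ ∀ (c : Fin n → ℝ) (b : Fin n → E),
        (∀ᵐ y ∂(volume.restrict Ω), 0 ≤ ∑ i, c i * fderiv ℝ (fderiv ℝ v) y (b i) (b i)) →
        0 ≤ ∑ i, c i * fderiv ℝ (fderiv ℝ ψ) x (b i) (b i) := by
  -- The outer radius `ε / 2` keeps the mollifier inside `ball x ε` with room to move `x`, as
  -- differentiation at `x` requires.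
  set φ : ContDiffBump (0 : E) := ⟨ε / 4, ε / 2, by positivity, by linarith⟩ with hφ
  set ρ : E → ℝ := φ.normed volume with hρdef
  have hρc : Continuous ρ := φ.continuous_normed
  have hρ : ∀ t, ε / 2 ≤ ‖t‖ → ρ t = 0 := fun t ht => by
    by_contra hc
    have : t ∈ Function.support ρ := hc
    rw [hρdef, φ.support_normed_eq, mem_ball_zero_iff] at this
    exact absurd this (not_lt.2 ht)
  have hρ0 : ∀ t, 0 ≤ ρ t := φ.nonneg_normed
  have hρ1 : ∫ t, ρ t = 1 := φ.integral_normed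
  have hρi : Integrable ρ := φ.integrable_normed
  set G : E → ℝ := Ω.indicator v with hG
  have hGm : Measurable G := by
    classical
    rw [hG, ← Set.piecewise_eq_indicator]
    exact hv.continuousOn.measurable_piecewise continuousOn_const hΩ.measurableSet
  have hGΩ : ∀ y ∈ Ω, G =ᶠ[𝓝 y] v := fun y hy => by
    filter_upwards [hΩ.mem_nhds hy] with w hw using Set.indicator_of_mem hw v
  have hGb : ∀ y, ‖G y‖ ≤ |K| := fun y => by
    by_cases hy : y ∈ Ω
    · rw [hG, Set.indicator_of_mem hy]
      exact (hv0 y hy).trans (le_abs_self K)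
    · rw [hG, Set.indicator_of_notMem hy, norm_zero]; exact abs_nonneg K
  have hGl : LocallyIntegrable G := by
    refine (locallyIntegrable_const |K|).mono hGm.aestronglyMeasurable (.of_forall fun y => ?_)
    rw [Real.norm_of_nonneg (abs_nonneg K)]
    exact hGb y
  have hvd : ∀ y ∈ Ω, DifferentiableAt ℝ v y := fun y hy =>
    (hv.contDiffAt (hΩ.mem_nhds hy)).differentiableAt one_ne_zero
  set ψ : E → ℝ := fun x => ∫ t, ρ t * G (x - t) with hψ
  have hψc : ContDiff ℝ 2 ψ := by
    have := (φ.hasCompactSupport_normed (μ := volume)).contDiff_convolution_left (μ := volume)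
      (n := 2) (ContinuousLinearMap.lsmul ℝ ℝ) φ.contDiff_normed hGl
    exact this
  have hψd : Differentiable ℝ ψ := hψc.differentiable (by norm_num)
  have hline : ∀ {F : E → ℝ} {F' : E →L[ℝ] ℝ} {y : E} (z : E), HasFDerivAt F F' y →
      HasDerivAt (fun h : ℝ => F (y + h • z)) (F' z) 0 := fun z hF => by
    exact hF.hasLineDerivAt z
  have first : ∀ x, ball x (3 / 4 * ε) ⊆ Ω → ∀ z,
      fderiv ℝ ψ x z = ∫ t, ρ t * fderiv ℝ v (x - t) z := by
    intro x hx z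
    refine (hline z (hψd x).hasFDerivAt).unique ?_
    refine hasDerivAt_integral_mul_sub (δ := ε / 2) (ε := 3 / 4 * ε) (L := K) hρc hρ hGm
      (D := fun y => fderiv ℝ v y z)
      (measurable_fderiv_apply_const ℝ v z) (by positivity) (by linarith) ?_
      (.of_forall fun y hy => ?_)
    · intro y hy y' hy'
      rw [(hGΩ y (hx hy)).self_of_nhds, (hGΩ y' (hx hy')).self_of_nhds]
      exact (convex_ball x _).norm_image_sub_le_of_norm_fderiv_le (fun w hw => hvd w (hx hw))
        (fun w hw => hv1 w (hx hw)) hy' hy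
    · exact hline z ((hvd y (hx hy)).hasFDerivAt.congr_of_eventuallyEq (hGΩ y (hx hy)))
  refine ⟨ψ, hψc, fun x hx => ⟨?_, ?_, fun c b hcb => ?_⟩⟩
  · have hxΩ : x ∈ Ω := hx (mem_ball_self hε)
    have hK : 0 ≤ K := (abs_nonneg _).trans (hv0 x hxΩ)
    have := φ.dist_normed_convolution_le (x₀ := x) (ε := K * ε) (g := G) (μ := volume)
      hGm.aestronglyMeasurable fun y hy => by
        have hy' : y ∈ ball x ε := ball_subset_ball (by simp [hφ]; linarith) hy
        rw [(hGΩ y (hx hy')).self_of_nhds, (hGΩ x hxΩ).self_of_nhds, dist_eq_norm]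
        refine ((convex_ball x ε).norm_image_sub_le_of_norm_fderiv_le (fun w hw => hvd w (hx hw))
          (fun w hw => hv1 w (hx hw)) (mem_ball_self hε) hy').trans ?_
        rw [mem_ball_iff_norm] at hy'
        gcongr
    rw [(hGΩ x hxΩ).self_of_nhds] at this
    exact this
  · have hxΩ : x ∈ Ω := hx (mem_ball_self hε)
    have hK : 0 ≤ K := (abs_nonneg _).trans (hv0 x hxΩ)
    refine ContinuousLinearMap.opNorm_le_bound _ hK fun z => ?_
    rw [first x ((ball_subset_ball (by linarith)).trans hx) z]
    refine (norm_integral_le_of_norm_le (g := fun t => ρ t * (K * ‖z‖)) (hρi.mul_const _)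
      (.of_forall fun t => ?_)).trans_eq (by rw [integral_mul_const, hρ1, one_mul])
    rw [norm_mul, Real.norm_of_nonneg (hρ0 t)]
    rcases lt_or_ge ‖t‖ (ε / 2) with ht | ht
    · refine mul_le_mul_of_nonneg_left ?_ (hρ0 t)
      have hxt : x - t ∈ Ω := hx (by rw [mem_ball_iff_norm]; simp; linarith)
      refine (ContinuousLinearMap.le_opNorm _ _).trans ?_
      have := hv1 _ hxt
      gcongr
    · simp [hρ t ht]
  · have hxΩ : x ∈ Ω := hx (mem_ball_self hε)
    have hK : 0 ≤ K := (abs_nonneg _).trans (hv0 x hxΩ)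
    -- Rademacher's theorem for the Lipschitz derivative of `v`.
    have hrad : ∀ᵐ y : E, y ∈ Ω → DifferentiableAt ℝ (fderiv ℝ v) y := by
      have hlip : LipschitzOnWith (Real.nnabs K) (fderiv ℝ v) Ω := by
        rw [lipschitzOnWith_iff_norm_sub_le]
        intro y hy y' hy'
        rw [Real.coe_nnabs, abs_of_nonneg hK]
        exact hv2 y hy y' hy'
      filter_upwards [hlip.ae_differentiableWithinAt_of_mem (μ := volume)] with y hy hyΩ
      exact (hy hyΩ).differentiableAt (hΩ.mem_nhds hyΩ)
    have hD2m : ∀ z, Measurable fun y => fderiv ℝ (fderiv ℝ v) y z z := fun z =>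
      (ContinuousLinearMap.apply ℝ ℝ z).continuous.measurable.comp
        (measurable_fderiv_apply_const ℝ (fderiv ℝ v) z)
    have second : ∀ z, fderiv ℝ (fderiv ℝ ψ) x z z =
        ∫ t, ρ t * fderiv ℝ (fderiv ℝ v) (x - t) z z := by
      intro z
      have h1 : HasFDerivAt (fderiv ℝ ψ) (fderiv ℝ (fderiv ℝ ψ) x) x :=
        ((hψc.fderiv_right (m := 1) (by norm_num)).differentiable one_ne_zero x).hasFDerivAt
      have h2 : HasDerivAt (fun h : ℝ => fderiv ℝ ψ (x + h • z) z)
          (fderiv ℝ (fderiv ℝ ψ) x z z) 0 := by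
        have := (h1.hasLineDerivAt z : HasDerivAt (fun h : ℝ => fderiv ℝ ψ (x + h • z)) _ 0)
        simpa using this.clm_apply (hasDerivAt_const (0 : ℝ) z)
      refine h2.unique ?_
      have h3 := hasDerivAt_integral_mul_sub (δ := ε / 2) (ε := 3 / 4 * ε) (L := K * ‖z‖) hρc hρ
        (G := fun y => fderiv ℝ v y z) (D := fun y => fderiv ℝ (fderiv ℝ v) y z z) (x := x) (z := z)
        (measurable_fderiv_apply_const ℝ v z) (hD2m z) (by positivity) (by linarith) ?_ ?_
      · refine h3.congr_of_eventuallyEq ?_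
        have : Continuous fun h : ℝ => ‖h • z‖ := by fun_prop
        have hev : ∀ᶠ h : ℝ in 𝓝 0, ‖h • z‖ < ε / 4 :=
          this.continuousAt.eventually (gt_mem_nhds (by simpa using hε))
        filter_upwards [hev] with h hh
        refine first _ (fun y hy => hx ?_) z
        rw [mem_ball_iff_norm] at hy ⊢
        calc ‖y - x‖ = ‖(y - (x + h • z)) + h • z‖ := by congr 1; abel
          _ ≤ ‖y - (x + h • z)‖ + ‖h • z‖ := norm_add_le _ _
          _ < ε := by linarith
      · intro y hy y' hy'
        have e1 := hv2 y (hx (ball_subset_ball (by linarith) hy)) y'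
          (hx (ball_subset_ball (by linarith) hy'))
        calc |fderiv ℝ v y z - fderiv ℝ v y' z| = ‖(fderiv ℝ v y - fderiv ℝ v y') z‖ := by
              simp
          _ ≤ ‖fderiv ℝ v y - fderiv ℝ v y'‖ * ‖z‖ := ContinuousLinearMap.le_opNorm _ _
          _ ≤ K * ‖y - y'‖ * ‖z‖ := by gcongr
          _ = _ := by ring
      · filter_upwards [hrad] with y hy hyb
        have h4 := hy (hx (ball_subset_ball (by linarith) hyb))
        have := (h4.hasFDerivAt.hasLineDerivAt z :
          HasDerivAt (fun h : ℝ => fderiv ℝ v (y + h • z)) _ 0)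
        simpa using this.clm_apply (hasDerivAt_const (0 : ℝ) z)
    have hq := (volume : Measure E).measurePreserving_sub_left x
    have hint : ∀ z, Integrable fun t => ρ t * fderiv ℝ (fderiv ℝ v) (x - t) z z := by
      intro z
      refine (hρi.mul_const (K * ‖z‖ * ‖z‖)).mono'
        (hρc.measurable.mul ((hD2m z).comp
          (measurable_const.sub measurable_id))).aestronglyMeasurable (.of_forall fun t => ?_)
      rw [norm_mul, Real.norm_of_nonneg (hρ0 t)]
      rcases lt_or_ge ‖t‖ (ε / 2) with ht | ht
      · refine mul_le_mul_of_nonneg_left ?_ (hρ0 t)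
        have hxt : x - t ∈ Ω := hx (by rw [mem_ball_iff_norm]; simp; linarith)
        have e1 : ‖fderiv ℝ (fderiv ℝ v) (x - t)‖ ≤ K := by
          refine norm_fderiv_le_of_lip' ℝ hK ?_
          filter_upwards [hΩ.mem_nhds hxt] with y hy using hv2 y hy _ hxt
        refine (ContinuousLinearMap.le_opNorm _ _).trans ?_
        gcongr
        refine (ContinuousLinearMap.le_opNorm _ _).trans ?_
        gcongr
      · simp [hρ t ht]
    simp only [second]
    -- The coefficients `c` and `b` are constant, so the almost everywhere inequality survives
    -- averaging against `ρ ≥ 0`.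
    have e1 : ∑ i, c i * ∫ t, ρ t * fderiv ℝ (fderiv ℝ v) (x - t) (b i) (b i) =
        ∫ t, ∑ i, c i * (ρ t * fderiv ℝ (fderiv ℝ v) (x - t) (b i) (b i)) := by
      rw [integral_finsetSum _ fun i _ => (hint (b i)).const_mul (c i)]
      exact Finset.sum_congr rfl fun i _ => (integral_const_mul _ _).symm
    rw [e1]
    refine integral_nonneg_of_ae ?_
    rw [ae_restrict_iff' hΩ.measurableSet] at hcb
    filter_upwards [hq.quasiMeasurePreserving.ae hcb] with t ht
    rcases lt_or_ge ‖t‖ (ε / 2) with htδ | htδ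
    · have := mul_nonneg (hρ0 t) (ht (hx (by rw [mem_ball_iff_norm]; simp; linarith)))
      rw [Finset.mul_sum] at this
      refine this.trans_eq (Finset.sum_congr rfl fun i _ => by ring)
    · simp [hρ t htδ]

end Mollification

end KCurvature

namespace KCurvature

open Finset Filter Topology Metric

/-! ### Pointwise bounds from the norms -/

section Norms

variable {V : Type*} [NormedAddCommGroup V] [NormedSpace ℝ V] {S : Set V} {g : V → ℝ} {K : ℝ≥0}

lemma bounds_of_c1Norm_le (h : c1Norm S g ≤ K) {x : V} (hx : x ∈ S) :
    |g x| ≤ K ∧ ‖fderiv ℝ g x‖ ≤ K := by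
  have h1 : ‖g x‖ₑ ≤ K :=
    ((le_iSup₂ (f := fun x (_ : x ∈ S) => ‖g x‖ₑ) x hx).trans le_self_add).trans h
  have h2 : ‖fderiv ℝ g x‖ₑ ≤ K :=
    ((le_iSup₂ (f := fun x (_ : x ∈ S) => ‖fderiv ℝ g x‖ₑ) x hx).trans le_add_self).trans h
  rw [enorm_le_coe] at h1 h2
  exact ⟨by exact_mod_cast h1, by exact_mod_cast h2⟩

lemma c1Norm_le_c11Norm (S : Set V) (g : V → ℝ) : c1Norm S g ≤ c11Norm S g := le_self_add

lemma norm_fderiv_sub_le_of_c11Norm_le (h : c11Norm S g ≤ K) {x y : V} (hx : x ∈ S) (hy : y ∈ S) :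
    ‖fderiv ℝ g x - fderiv ℝ g y‖ ≤ K * ‖x - y‖ := by
  rcases eq_or_ne x y with rfl | hxy
  · simp
  have h1 : ‖fderiv ℝ g x - fderiv ℝ g y‖ₑ / edist x y ≤ K := by
    refine le_trans ?_ (le_add_self.trans h)
    refine le_trans ?_ (le_iSup₂ (f := fun x (_ : x ∈ S) => ⨆ y ∈ S,
      ‖fderiv ℝ g x - fderiv ℝ g y‖ₑ / edist x y) x hx)
    exact le_iSup₂ (f := fun y (_ : y ∈ S) => ‖fderiv ℝ g x - fderiv ℝ g y‖ₑ / edist x y) y hy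
  rw [ENNReal.div_le_iff (edist_pos.2 hxy).ne' (edist_ne_top x y)] at h1
  have h2 := ENNReal.toReal_mono (ENNReal.mul_ne_top ENNReal.coe_ne_top (edist_ne_top x y)) h1
  simpa [ENNReal.toReal_mul, edist_dist, dist_eq_norm] using h2

end Norms

/-! ### Distance to the boundary and normal curvatures -/

section Geometry

/-- The segment to a nearest boundary point lies in `Ω` up to its endpoint, where `w = 0`; the
gradient bound along it gives `w x ≤ L * dist`. -/
lemma ball_subset_of_fderiv_le {V : Type*} [NormedAddCommGroup V] [NormedSpace ℝ V]
    [FiniteDimensional ℝ V] {Ω : Set V} (hΩ : IsOpen Ω) {w : V → ℝ} (hc : ContinuousOn w (closure Ω))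
    (hd : ∀ x ∈ Ω, DifferentiableAt ℝ w x) {L : ℝ} (hL : 0 < L)
    (hb : ∀ x ∈ Ω, ‖fderiv ℝ w x‖ ≤ L) (h0 : ∀ x ∈ frontier Ω, w x = 0) {x : V} (hx : x ∈ Ω) :
    ball x (w x / L) ⊆ Ω := by
  rcases (Ωᶜ).eq_empty_or_nonempty with h | h
  · rw [Set.compl_empty_iff.1 h]; exact Set.subset_univ _
  have : ProperSpace V := FiniteDimensional.proper ℝ V
  obtain ⟨z, hz, hzd⟩ := hΩ.isClosed_compl.exists_infDist_eq_dist h x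
  have hball : ball x (infDist x Ωᶜ) ⊆ Ω := ball_infDist_compl_subset
  refine (ball_subset_ball ?_).trans hball
  have hxz : 0 < dist x z := dist_pos.2 fun e => hz (e ▸ hx)
  have hcb : closure (ball x (infDist x Ωᶜ)) ⊆ closure Ω := closure_mono hball
  have hzc : z ∈ closure (ball x (infDist x Ωᶜ)) := by
    rw [hzd, closure_ball x hxz.ne', mem_closedBall, dist_comm]
  have hlip : LipschitzOnWith (Real.nnabs L) w (ball x (infDist x Ωᶜ)) := by
    rw [lipschitzOnWith_iff_norm_sub_le]
    intro y hy y' hy'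
    rw [Real.coe_nnabs, abs_of_pos hL]
    exact (convex_ball x _).norm_image_sub_le_of_norm_fderiv_le (fun y hy => hd y (hball hy))
      (fun y hy => hb y (hball hy)) hy' hy
  have h1 := (hlip.closure (hc.mono hcb)).dist_le_mul x
    (subset_closure (mem_ball_self (by rw [hzd]; exact hxz))) z hzc
  rw [h0 z ⟨hcb hzc, fun h => hz (interior_subset h)⟩, Real.coe_nnabs, abs_of_pos hL,
    Real.dist_eq, sub_zero] at h1
  rw [div_le_iff₀ hL, hzd]
  linarith [le_abs_self (w x)]

variable {n : ℕ}

local notation "E" => EuclideanSpace ℝ (Fin n)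

open scoped RealInnerProductSpace

lemma metric_pos (p : E) {ξ : E} (hξ : ξ ≠ 0) : 0 < ‖ξ‖ ^ 2 + ⟪p, ξ⟫ ^ 2 := by
  have := norm_pos_iff.2 hξ
  positivity

lemma normalCurvature_smul (u : E → ℝ) (x ξ : E) {r : ℝ} (hr : r ≠ 0) :
    normalCurvature u x (r • ξ) = normalCurvature u x ξ := by
  have e1 : ‖r • ξ‖ ^ 2 = r ^ 2 * ‖ξ‖ ^ 2 := by
    rw [norm_smul, mul_pow, Real.norm_eq_abs, sq_abs]
  simp only [normalCurvature, e1, inner_smul_right, map_smul, _root_.smul_apply, smul_eq_mul,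
    mul_pow, ← mul_add]
  rw [show (slope u x)⁻¹ * (r * (r * fderiv ℝ (fderiv ℝ u) x ξ ξ)) =
    r ^ 2 * ((slope u x)⁻¹ * fderiv ℝ (fderiv ℝ u) x ξ ξ) by ring,
    mul_div_mul_left _ _ (pow_ne_zero 2 hr)]

lemma normalCurvature_frame {u : E → ℝ} {x : E} {b : Fin n → E} (hb : IsFrame (gradVec u x) b)
    (hbd : ∀ i j, fderiv ℝ (fderiv ℝ u) x (b i) (b j) =
      if i = j then slope u x * principalCurvatures u x i else 0) (i : Fin n) :
    normalCurvature u x (b i) = principalCurvatures u x i := by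
  rw [normalCurvature, hb.norm_add_sq, hbd, if_pos rfl, div_one,
    inv_mul_cancel_left₀ (slope_pos u x).ne']

lemma IsFrame.ne_zero {p : E} {b : Fin n → E} (hb : IsFrame p b) (i : Fin n) : b i ≠ 0 := by
  intro h
  have := hb.norm_add_sq i
  simp [h] at this

lemma normalCurvature_le {u : E → ℝ} {x : E} (hu : ContDiffAt ℝ 2 u x) {c : ℝ}
    (hc : ∀ i, principalCurvatures u x i ≤ c) {ξ : E} (hξ : ξ ≠ 0) :
    normalCurvature u x ξ ≤ c := by
  obtain ⟨b, hb, hbd⟩ := exists_frame (contDiffAt_hess_isHermitian hu)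
  have hs := slope_pos u x
  rw [normalCurvature, div_le_iff₀ (metric_pos _ hξ), inv_mul_le_iff₀ hs, ← mul_assoc]
  exact hb.rayleigh_le hbd (fun i => mul_le_mul_of_nonneg_left (hc i) hs.le) ξ

/-- As `σ_2 > 0`, the sum of squares `σ_1² - 2 σ_2` is below `σ_1²`: the largest curvature controls
the negative ones too. -/
lemma InCone.abs_le {k : ℕ} {κ : Fin n → ℝ} (hκ : InCone univ (k + 2) κ) {c : ℝ}
    (hc : ∀ i, κ i ≤ c) : ∑ i, κ i ^ 2 ≤ (n * c) ^ 2 := by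
  have h1 := sum_sq_eq univ κ
  have h2 := hκ 2 (by omega)
  have h3 := hκ 1 (by omega)
  have h4 : es univ 1 κ ≤ n * c := by
    rw [es_one]
    refine (sum_le_card_nsmul univ κ c fun i _ => hc i).trans_eq (by simp)
  have : es univ 1 κ ^ 2 ≤ (n * c) ^ 2 := by gcongr
  linarith

/-- The Hessian is controlled by the largest normal curvature. -/
lemma abs_snd_fderiv_le {k : ℕ} {u : E → ℝ} {x : E} (hu : ContDiffAt ℝ 2 u x)
    (hκ : InCone univ (k + 2) (principalCurvatures u x)) {c : ℝ} (hc0 : 0 ≤ c)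
    (hc : ∀ ξ : E, ξ ≠ 0 → normalCurvature u x ξ ≤ c) (ξ : E) :
    |fderiv ℝ (fderiv ℝ u) x ξ ξ| ≤ slope u x * (n * c) * (‖ξ‖ ^ 2 + ⟪gradVec u x, ξ⟫ ^ 2) := by
  obtain ⟨b, hb, hbd⟩ := exists_frame (contDiffAt_hess_isHermitian hu)
  have hs := slope_pos u x
  have h1 : ∀ i, principalCurvatures u x i ≤ c := fun i => by
    rw [← normalCurvature_frame hb hbd]; exact hc _ (hb.ne_zero i)
  have h2 : ∀ i, |principalCurvatures u x i| ≤ n * c := fun i => by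
    refine abs_le_of_sq_le_sq ?_ (by positivity)
    exact (single_le_sum (f := fun i => principalCurvatures u x i ^ 2)
      (fun i _ => sq_nonneg _) (mem_univ i)).trans (hκ.abs_le h1)
  refine _root_.abs_le.2 ⟨?_, ?_⟩
  · have := hb.rayleigh_le (B := -fderiv ℝ (fderiv ℝ u) x)
      (κ := fun i => slope u x * -principalCurvatures u x i) (c := slope u x * (n * c))
      (fun i j => by
        rw [_root_.neg_apply, _root_.neg_apply, hbd]
        split_ifs <;> simp)
      (fun i => mul_le_mul_of_nonneg_left ((neg_le_abs _).trans (h2 i)) hs.le) ξ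
    rw [_root_.neg_apply, _root_.neg_apply] at this
    linarith
  · exact hb.rayleigh_le hbd
      (fun i => mul_le_mul_of_nonneg_left ((le_abs_self _).trans (h2 i)) hs.le) ξ

lemma secondFundFormNorm_le {k : ℕ} {u : E → ℝ} {x : E} (hu : ContDiffAt ℝ 2 u x)
    (hκ : InCone univ (k + 2) (principalCurvatures u x)) {c : ℝ} (hc0 : 0 ≤ c)
    (hc : ∀ i, principalCurvatures u x i ≤ c) : secondFundFormNorm u x ≤ n * c := by
  rw [secondFundFormNorm, Real.sqrt_le_iff]
  refine ⟨by positivity, ?_⟩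
  rw [sum_sq_entries (curvatureMatrix_isHermitian (contDiffAt_hess_isHermitian hu))]
  exact hκ.abs_le hc

end Geometry

end KCurvature

namespace KCurvature

open Finset Filter Topology Metric MeasureTheory

/-! ### The test function and the gradient of the right-hand side -/

section InteriorEstimate

variable {n : ℕ}

local notation "E" => EuclideanSpace ℝ (Fin n)

open scoped RealInnerProductSpace

lemma norm_gradVec_le (u : E → ℝ) (x : E) : ‖gradVec u x‖ ≤ ‖fderiv ℝ u x‖ := by
  rcases eq_or_ne (gradVec u x) 0 with h | h
  · rw [h, norm_zero]; exact norm_nonneg _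
  have h1 := (fderiv ℝ u x).le_opNorm (gradVec u x)
  rw [fderiv_eq_inner, real_inner_self_eq_norm_sq, Real.norm_of_nonneg (sq_nonneg _), sq] at h1
  exact le_of_mul_le_mul_right h1 (norm_pos_iff.2 h)

lemma slope_le {u : E → ℝ} {x : E} {K : ℝ} (h : ‖fderiv ℝ u x‖ ≤ K) : slope u x ≤ 1 + K := by
  have h1 := (norm_gradVec_le u x).trans h
  have h0 := norm_nonneg (gradVec u x)
  rw [slope_eq, Real.sqrt_le_iff]
  exact ⟨by linarith, by nlinarith⟩

/-- The exponential lies in `[1, 2]` and the denominator in `[1 / (2 B), 1]`. The weight is thus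
comparable to a power of `ψ - u`, which transfers bounds between the maximum and other points. -/
lemma testWeight_bounds {u ψ : E → ℝ} {x z : E} {B : ℝ} (hB : 1 ≤ B) (hs : slope u x ≤ B)
    (hz : ‖x - z‖ + |u x| ≤ B) (hη : 0 ≤ ψ x - u x) (β : ℕ) :
    (ψ x - u x) ^ β ≤ testWeight u ψ β B z x ∧
      testWeight u ψ β B z x ≤ (ψ x - u x) ^ β * (4 * B) := by
  have hB0 : 0 < B := by linarith
  have hsp := slope_pos u x
  have h1 : B⁻¹ ≤ (slope u x)⁻¹ := inv_anti₀ hsp hs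
  have h2 : 1 / (2 * B) = B⁻¹ / 2 := by field_simp
  have h3 : 0 < B⁻¹ := by positivity
  have h4 : (slope u x)⁻¹ ≤ 1 := inv_le_one_of_one_le₀ (one_le_slope u x)
  have hd1 : 1 / (2 * B) ≤ (slope u x)⁻¹ - 1 / (2 * B) := by rw [h2]; linarith
  have hd0 : 0 < (slope u x)⁻¹ - 1 / (2 * B) :=
    lt_of_lt_of_le (by positivity) hd1
  have hd2 : (slope u x)⁻¹ - 1 / (2 * B) ≤ 1 := by
    have : 0 < 1 / (2 * B) := by positivity
    linarith
  have hn := norm_nonneg (x - z)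
  have ha := abs_nonneg (u x)
  have he0 : 0 ≤ 1 / (8 * B ^ 2) * (‖x - z‖ ^ 2 + u x ^ 2) := by positivity
  have he1 : 1 / (8 * B ^ 2) * (‖x - z‖ ^ 2 + u x ^ 2) ≤ 1 / 8 := by
    have : ‖x - z‖ ^ 2 + u x ^ 2 ≤ B ^ 2 := by rw [← sq_abs (u x)]; nlinarith
    calc 1 / (8 * B ^ 2) * (‖x - z‖ ^ 2 + u x ^ 2) ≤ 1 / (8 * B ^ 2) * B ^ 2 := by gcongr
      _ = 1 / 8 := by field_simp
  have hE1 := Real.one_le_exp he0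
  have hE2 : Real.exp (1 / (8 * B ^ 2) * (‖x - z‖ ^ 2 + u x ^ 2)) ≤ 2 := by
    have h5 := Real.log_two_gt_d9
    rw [← Real.exp_log (by norm_num : (0 : ℝ) < 2)]
    exact Real.exp_le_exp.2 (by linarith)
  have hp : 0 ≤ (ψ x - u x) ^ β := pow_nonneg hη β
  rw [testWeight]
  constructor
  · rw [le_div_iff₀ hd0]
    exact mul_le_mul_of_nonneg_left (hd2.trans hE1) hp
  · rw [div_le_iff₀ hd0, mul_assoc]
    refine mul_le_mul_of_nonneg_left (hE2.trans ?_) hp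
    have := mul_le_mul_of_nonneg_left hd1 (by positivity : 0 ≤ 4 * B)
    refine le_trans (le_of_eq ?_) this
    field_simp
    norm_num

lemma continuousAt_testWeight_mul {u ψ : E → ℝ} {x ξ : E} (hu : ContDiffAt ℝ 4 u x)
    (hψ : ContinuousAt ψ x) (β : ℕ) {B : ℝ} (z : E) (hd : (slope u x)⁻¹ - 1 / (2 * B) ≠ 0)
    (hξ : ξ ≠ 0) : ContinuousAt (fun p : E × E => testWeight u ψ β B z p.1 *
      normalCurvature u p.1 p.2) (x, ξ) := by
  have c0 : ContinuousAt (fun p : E × E => u p.1) (x, ξ) :=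
    hu.continuousAt.comp (x := (x, ξ)) continuousAt_fst
  have c1 : ContinuousAt (fun p : E × E => fderiv ℝ u p.1) (x, ξ) :=
    (hu.fderiv_right (m := 3) (by norm_num)).continuousAt.comp (x := (x, ξ)) continuousAt_fst
  have c2 : ContinuousAt (fun p : E × E => fderiv ℝ (fderiv ℝ u) p.1) (x, ξ) :=
    ((hu.fderiv_right (m := 3) (by norm_num)).fderiv_right (m := 2)
      (by norm_num)).continuousAt.comp (x := (x, ξ)) continuousAt_fst
  have c3 : ContinuousAt (fun p : E × E => ψ p.1) (x, ξ) :=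
    hψ.comp (x := (x, ξ)) continuousAt_fst
  have c4 : ContinuousAt (fun p : E × E => (slope u p.1)⁻¹) (x, ξ) := by
    refine ContinuousAt.inv₀ ?_ (slope_pos u x).ne'
    simp only [slope, grad]
    refine Real.continuous_sqrt.continuousAt.comp (continuousAt_const.add ?_)
    exact tendsto_finsetSum _ fun i _ => (c1.clm_apply continuousAt_const).pow 2
  have c5 : ContinuousAt (fun p : E × E => p.1) (x, ξ) := continuousAt_fst
  have c6 : ContinuousAt (fun p : E × E => p.2) (x, ξ) := continuousAt_snd
  simp only [testWeight, normalCurvature, ← fderiv_eq_inner]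
  refine ContinuousAt.mul ?_ ?_
  · refine ContinuousAt.div (((c3.sub c0).pow β).mul ?_) (c4.sub continuousAt_const) hd
    exact Real.continuous_exp.continuousAt.comp
      (continuousAt_const.mul (((c5.sub continuousAt_const).norm.pow 2).add (c0.pow 2)))
  · refine ContinuousAt.div (c4.mul ((c2.clm_apply c6).clm_apply c6))
      ((c6.norm.pow 2).add ((c1.clm_apply c6).pow 2)) ?_
    rw [fderiv_eq_inner]
    exact (metric_pos _ hξ).ne'

/-- The gradient bound for the positive right-hand side in terms of its value. -/
lemma sq_fderiv_le_of_pos {Ω : Set E} {u : E → ℝ} (hu : ∀ x ∈ Ω, ContDiffAt ℝ 4 u x)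
    {ft : E × ℝ → ℝ} {S : Set (E × ℝ)} {K Ku N N₁ r : ℝ} (hK : 0 ≤ K) (hKu : 0 ≤ Ku)
    (hu1 : ∀ x ∈ Ω, ‖fderiv ℝ u x‖ ≤ Ku) (hS : ∀ x ∈ Ω, (x, u x) ∈ S)
    (hft : ∀ x ∈ Ω, DifferentiableAt ℝ ft (x, u x) ∧ 0 < ft (x, u x))
    (hft1 : ∀ p ∈ S, ‖fderiv ℝ ft p‖ ≤ K)
    (hft2 : ∀ p ∈ S, ∀ q ∈ S, ‖fderiv ℝ ft p - fderiv ℝ ft q‖ ≤ K * ‖p - q‖)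
    {x₀ b : E} (hr : 0 < r) (hball : closedBall x₀ r ⊆ Ω) (hb : ‖b‖ ≤ 1)
    (hN₁ : ∀ y ∈ closedBall x₀ r, |fderiv ℝ (fderiv ℝ u) y b b| ≤ N₁)
    (hN0 : 0 < N) (hN : K * (1 + Ku) ^ 2 + K * N₁ ≤ N) :
    fderiv ℝ ft (x₀, u x₀) (b, fderiv ℝ u x₀ b) ^ 2 ≤ 4 * N * ft (x₀, u x₀) ∨
      N * r ^ 2 ≤ ft (x₀, u x₀) := by
  have hmem : ∀ s : ℝ, |s| ≤ r → x₀ + s • b ∈ closedBall x₀ r := fun s hs => by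
    rw [mem_closedBall_iff_norm, add_sub_cancel_left, norm_smul, Real.norm_eq_abs]
    exact (mul_le_of_le_one_right (abs_nonneg s) hb).trans hs
  have hline : ∀ s : ℝ, HasDerivAt (fun s : ℝ => x₀ + s • b) b s := fun s => by
    simpa using ((hasDerivAt_id s).smul_const b).const_add x₀
  have hud : ∀ s : ℝ, |s| ≤ r → HasDerivAt (fun s : ℝ => u (x₀ + s • b))
      (fderiv ℝ u (x₀ + s • b) b) s := fun s hs =>
    ((hu _ (hball (hmem s hs))).differentiableAt (by norm_num)).hasFDerivAt.comp_hasDerivAt s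
      (hline s)
  have hudd : ∀ s : ℝ, |s| ≤ r → HasDerivAt (fun s : ℝ => fderiv ℝ u (x₀ + s • b) b)
      (fderiv ℝ (fderiv ℝ u) (x₀ + s • b) b b) s := fun s hs => by
    have h1 := (((hu _ (hball (hmem s hs))).fderiv_right (m := 3)
      (by norm_num)).differentiableAt (by norm_num)).hasFDerivAt.comp_hasDerivAt s (hline s)
    simpa using h1.clm_apply (hasDerivAt_const s b)
  have hx0 : x₀ ∈ Ω := hball (mem_closedBall_self hr.le)
  have h := sq_deriv_le_of_pos (φ := fun s => ft (x₀ + s • b, u (x₀ + s • b)))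
    (φ' := fun s => fderiv ℝ ft (x₀ + s • b, u (x₀ + s • b)) (b, fderiv ℝ u (x₀ + s • b) b))
    hr hN0 (fun s hs => (hft _ (hball (hmem s hs))).2)
    (fun s hs => (hft _ (hball (hmem s hs))).1.hasFDerivAt.comp_hasDerivAt s
      ((hline s).prodMk (hud s hs))) ?_
  · simpa using h
  intro s hs
  have hIcc : ∀ t ∈ Set.Icc (-|s|) |s|, |t| ≤ r := fun t ht => (abs_le.2 ht).trans hs
  have h0 : (0 : ℝ) ∈ Set.Icc (-|s|) |s| := ⟨neg_nonpos.2 (abs_nonneg s), abs_nonneg s⟩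
  have hs' : s ∈ Set.Icc (-|s|) |s| := abs_le.1 le_rfl
  have e1 : |u (x₀ + s • b) - u x₀| ≤ Ku * |s| := by
    have := (convex_Icc (-|s|) |s|).norm_image_sub_le_of_norm_hasDerivWithin_le
      (f := fun s : ℝ => u (x₀ + s • b)) (C := Ku)
      (fun t ht => (hud t (hIcc t ht)).hasDerivWithinAt)
      (fun t ht => ((fderiv ℝ u (x₀ + t • b)).le_opNorm b).trans
        ((mul_le_of_le_one_right (norm_nonneg _) hb).trans
          (hu1 _ (hball (hmem t (hIcc t ht)))))) h0 hs'
    simpa using this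
  have e2 : |fderiv ℝ u (x₀ + s • b) b - fderiv ℝ u x₀ b| ≤ N₁ * |s| := by
    have := (convex_Icc (-|s|) |s|).norm_image_sub_le_of_norm_hasDerivWithin_le
      (f := fun s : ℝ => fderiv ℝ u (x₀ + s • b) b) (C := N₁)
      (fun t ht => (hudd t (hIcc t ht)).hasDerivWithinAt)
      (fun t ht => hN₁ _ (hmem t (hIcc t ht))) h0 hs'
    simpa using this
  simp only [zero_smul, add_zero]
  have hxs := hball (hmem s hs)
  set p : E × ℝ := (x₀ + s • b, u (x₀ + s • b)) with hp
  set q : E × ℝ := (x₀, u x₀) with hq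
  set d := fderiv ℝ u (x₀ + s • b) b with hd
  have e3 : ‖p - q‖ ≤ (1 + Ku) * |s| := by
    rw [hp, hq, Prod.mk_sub_mk, Prod.norm_def]
    refine max_le ?_ ?_
    · simp only [add_sub_cancel_left, norm_smul, Real.norm_eq_abs]
      have := mul_le_of_le_one_right (abs_nonneg s) hb
      nlinarith [abs_nonneg s]
    · refine e1.trans ?_
      nlinarith [abs_nonneg s]
  have e4 : ‖((b, d) : E × ℝ)‖ ≤ 1 + Ku := by
    rw [Prod.norm_def]
    refine max_le (by simp only; linarith) ?_
    refine ((fderiv ℝ u (x₀ + s • b)).le_opNorm b).trans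
        ((mul_le_of_le_one_right (norm_nonneg _) hb).trans ((hu1 _ hxs).trans (by linarith)))
  -- Separates the variation of the derivative of `ft` from that of the direction; the latter brings
  -- in the second derivative of `u`, hence the term `K * N₁` in `N`.
  have e5 : fderiv ℝ ft p (b, d) - fderiv ℝ ft q (b, fderiv ℝ u x₀ b) =
      (fderiv ℝ ft p - fderiv ℝ ft q) (b, d) + fderiv ℝ ft q (0, d - fderiv ℝ u x₀ b) := by
    rw [_root_.sub_apply, show ((0 : E), d - fderiv ℝ u x₀ b) = (b, d) - (b, fderiv ℝ u x₀ b) by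
      simp, map_sub]
    ring
  rw [e5]
  refine (abs_add_le _ _).trans ?_
  have e6 : |(fderiv ℝ ft p - fderiv ℝ ft q) (b, d)| ≤ K * ((1 + Ku) * |s|) * (1 + Ku) := by
    refine ((fderiv ℝ ft p - fderiv ℝ ft q).le_opNorm _).trans ?_
    have := hft2 p (hS _ hxs) q (hS _ hx0)
    gcongr
    exact this.trans (by gcongr)
  have e7 : |fderiv ℝ ft q (0, d - fderiv ℝ u x₀ b)| ≤ K * (N₁ * |s|) := by
    refine ((fderiv ℝ ft q).le_opNorm _).trans ?_
    have := hft1 q (hS _ hx0)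
    gcongr
    rw [Prod.norm_def, norm_zero]
    exact max_le ((abs_nonneg _).trans e2) e2
  calc _ ≤ K * ((1 + Ku) * |s|) * (1 + Ku) + K * (N₁ * |s|) := add_le_add e6 e7
    _ = (K * (1 + Ku) ^ 2 + K * N₁) * |s| := by ring
    _ ≤ N * |s| := by gcongr

end InteriorEstimate

end KCurvature

namespace KCurvature

open Finset Filter Topology Metric MeasureTheory

/-! ### The interior estimate -/

section InteriorEstimate

variable {n : ℕ}

local notation "E" => EuclideanSpace ℝ (Fin n)

open scoped RealInnerProductSpace

lemma InCone.exists_pos {k : ℕ} {κ : Fin n → ℝ} (hκ : InCone univ (k + 2) κ) : ∃ i, 0 < κ i := by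
  by_contra! h
  have h1 := hκ 1 (by omega)
  rw [es_one] at h1
  exact absurd h1 (not_lt.2 (sum_nonpos fun i _ => h i))

/-- The test function attains its maximum over a compact set of base points. -/
lemma exists_max_testWeight {k : ℕ} {u ψ : E → ℝ} {K : Set E} (hK : IsCompact K) {y : E}
    (hy : y ∈ K) (hu : ∀ x ∈ K, ContDiffAt ℝ 4 u x)
    (hκ : ∀ x ∈ K, InCone univ (k + 2) (principalCurvatures u x)) (hψ : Continuous ψ)
    (hη : ∀ x ∈ K, 0 ≤ ψ x - u x) {β : ℕ} {B : ℝ} (hB : 1 ≤ B) {z : E}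
    (hs : ∀ x ∈ K, slope u x ≤ B) (hz : ∀ x ∈ K, ‖x - z‖ + |u x| ≤ B) :
    ∃ x₀ ∈ K, ∃ o, 0 < principalCurvatures u x₀ o ∧
      (∀ i, principalCurvatures u x₀ i ≤ principalCurvatures u x₀ o) ∧
      ∀ x ∈ K, ∀ ξ : E, ξ ≠ 0 → testWeight u ψ β B z x * normalCurvature u x ξ ≤
        testWeight u ψ β B z x₀ * principalCurvatures u x₀ o := by
  obtain ⟨i₀, -⟩ := (hκ y hy).exists_pos
  have hne : Nonempty (Fin n) := ⟨i₀⟩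
  have hd : ∀ x ∈ K, (slope u x)⁻¹ - 1 / (2 * B) ≠ 0 := fun x hx => by
    have h1 : B⁻¹ ≤ (slope u x)⁻¹ := inv_anti₀ (slope_pos u x) (hs x hx)
    have h2 : 1 / (2 * B) = B⁻¹ / 2 := by field_simp
    have h3 : 0 < B⁻¹ := by positivity
    rw [h2]; linarith
  have hsph : ∀ ξ ∈ sphere (0 : E) 1, ξ ≠ 0 := fun ξ hξ h => by
    rw [h, mem_sphere_zero_iff_norm, norm_zero] at hξ
    exact zero_ne_one hξ
  have hcont : ContinuousOn (fun p : E × E => testWeight u ψ β B z p.1 *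
      normalCurvature u p.1 p.2) (K ×ˢ sphere 0 1) := fun p hp =>
    (continuousAt_testWeight_mul (hu _ hp.1) hψ.continuousAt β z (hd _ hp.1)
      (hsph _ hp.2)).continuousWithinAt
  obtain ⟨p, hp, hmax⟩ := (hK.prod (isCompact_sphere (0 : E) 1)).exists_isMaxOn
    ⟨(y, EuclideanSpace.single i₀ 1), hy, by simp⟩ hcont
  obtain ⟨o, ho⟩ := Finite.exists_max (principalCurvatures u p.1)
  obtain ⟨i₁, hi₁⟩ := (hκ _ hp.1).exists_pos
  have hw : 0 ≤ testWeight u ψ β B z p.1 := (pow_nonneg (hη _ hp.1) β).trans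
    (testWeight_bounds hB (hs _ hp.1) (hz _ hp.1) (hη _ hp.1) β).1
  refine ⟨p.1, hp.1, o, hi₁.trans_le (ho i₁), ho, fun x hx ξ hξ => ?_⟩
  have hξn := norm_pos_iff.2 hξ
  have h1 : testWeight u ψ β B z x * normalCurvature u x (‖ξ‖⁻¹ • ξ) ≤
      testWeight u ψ β B z p.1 * normalCurvature u p.1 p.2 :=
    hmax (a := (x, ‖ξ‖⁻¹ • ξ)) ⟨hx, by
      rw [mem_sphere_zero_iff_norm, norm_smul, norm_inv, norm_norm, inv_mul_cancel₀ hξn.ne']⟩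
  rw [normalCurvature_smul _ _ _ (inv_ne_zero hξn.ne')] at h1
  exact h1.trans (mul_le_mul_of_nonneg_left
    (normalCurvature_le ((hu _ hp.1).of_le (by norm_num)) ho (hsph _ hp.2)) hw)

set_option maxHeartbeats 2000000 in
/-- The interior curvature estimate, in terms of pointwise bounds. -/
theorem interior_curvature_estimate (k : ℕ) (hn : k + 2 ≤ n) (D Ku Kv Kf : ℝ≥0) :
    ∃ C : ℝ, ∀ (Ω : Set (EuclideanSpace ℝ (Fin n))) (ft : EuclideanSpace ℝ (Fin n) × ℝ → ℝ)
      (S : Set (EuclideanSpace ℝ (Fin n) × ℝ)) (u v : EuclideanSpace ℝ (Fin n) → ℝ),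
      IsOpen Ω → Bornology.IsBounded Ω → Metric.diam Ω ≤ D →
      (∀ x ∈ Ω, ContDiffAt ℝ 4 u x) → ContinuousOn u (closure Ω) →
      (∀ x ∈ Ω, |u x| ≤ Ku) → (∀ x ∈ Ω, ‖fderiv ℝ u x‖ ≤ Ku) →
      (∀ x ∈ Ω, InCone univ (k + 2) (principalCurvatures u x)) →
      (∀ x ∈ Ω, (x, u x) ∈ S) →
      (∀ x ∈ Ω, DifferentiableAt ℝ ft (x, u x) ∧ 0 < ft (x, u x)) →
      (∀ x ∈ Ω, sigma (k + 2) (principalCurvatures u x) = ft (x, u x) ^ (k + 1)) →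
      (∀ p ∈ S, ‖fderiv ℝ ft p‖ ≤ Kf) →
      (∀ p ∈ S, ∀ q ∈ S, ‖fderiv ℝ ft p - fderiv ℝ ft q‖ ≤ Kf * ‖p - q‖) →
      ContDiffOn ℝ 1 v Ω → ContinuousOn v (closure Ω) →
      (∀ x ∈ Ω, |v x| ≤ Kv) → (∀ x ∈ Ω, ‖fderiv ℝ v x‖ ≤ Kv) →
      (∀ x ∈ Ω, ∀ y ∈ Ω, ‖fderiv ℝ v x - fderiv ℝ v y‖ ≤ Kv * ‖x - y‖) →
      (∀ (κ : Fin n → ℝ) (p : EuclideanSpace ℝ (Fin n)) (b : Fin n → EuclideanSpace ℝ (Fin n)),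
        InCone univ (k + 2) κ → IsFrame p b → ∀ᵐ y ∂(volume.restrict Ω),
          0 ≤ ∑ i, es (univ.erase i) (k + 1) κ * fderiv ℝ (fderiv ℝ v) y (b i) (b i)) →
      (∀ x ∈ Ω, u x < v x) → (∀ x ∈ frontier Ω, v x = u x) →
      ∀ x ∈ Ω, secondFundFormNorm u x ≤ C / (v x - u x) ^ (max 3 (k + 1)) := by
  obtain ⟨β, hβdef⟩ : ∃ β, β = max 3 (k + 1) := ⟨_, rfl⟩
  rw [← hβdef]
  have hβ : 3 ≤ β := hβdef ▸ le_max_left _ _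
  obtain ⟨L, hL⟩ : ∃ L : ℝ, L = Ku + Kv + 1 := ⟨_, rfl⟩
  obtain ⟨B, hB⟩ : ∃ B : ℝ, B = D + 2 * Ku + 2 * Kv + Kf + 2 := ⟨_, rfl⟩
  -- Where `ψ - u` is at least half its value at the maximum point, the curvature is at most `Λ`
  -- times the one there; see `hcurv`.
  obtain ⟨Λ, hΛ⟩ : ∃ Λ : ℝ, Λ = 2 ^ β * (4 * B) := ⟨_, rfl⟩
  obtain ⟨N₁, hN₁⟩ : ∃ N₁ : ℝ, N₁ = (1 + Ku) * (n * Λ) * (1 + Ku ^ 2) := ⟨_, rfl⟩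
  obtain ⟨N₂, hN₂⟩ : ∃ N₂ : ℝ, N₂ = (Kf + 1) * ((1 + Ku) ^ 2 + N₁) := ⟨_, rfl⟩
  obtain ⟨B', hB'⟩ : ∃ B' : ℝ, B' = 4 * N₂ + Kf ^ 2 := ⟨_, rfl⟩
  have hD0 := D.coe_nonneg
  have hKu0 := Ku.coe_nonneg
  have hKv0 := Kv.coe_nonneg
  have hKf0 := Kf.coe_nonneg
  have hB1 : 1 ≤ B := by rw [hB]; linarith
  have hB0 : 0 < B := by linarith
  have hL0 : 0 < L := by rw [hL]; positivity
  have hΛ0 : 0 < Λ := by rw [hΛ]; positivity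
  have hN₁0 : 0 ≤ N₁ := by rw [hN₁]; positivity
  have hN₂1 : 1 ≤ N₂ := by
    have h1 : (1 : ℝ) ≤ (1 + Ku) ^ 2 := one_le_pow₀ (by linarith)
    rw [hN₂]
    exact one_le_mul_of_one_le_of_one_le (by linarith) (by linarith)
  have hB'0 : 0 ≤ B' := by rw [hB']; positivity
  obtain ⟨C₀, hC₀⟩ := curvature_mul_le_of_isLocalMax n k hn hβ hB1 hB'0
  obtain ⟨C₁, hC₁⟩ : ∃ C₁ : ℝ, C₁ = max C₀ (max (4 * L) B) := ⟨_, rfl⟩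
  have hC₁B : B ≤ C₁ := hC₁ ▸ (le_max_right _ _).trans (le_max_right _ _)
  have hC₁L : 4 * L ≤ C₁ := hC₁ ▸ (le_max_left _ _).trans (le_max_right _ _)
  have hC₁C : C₀ ≤ C₁ := hC₁ ▸ le_max_left _ _
  have hC₁0 : 0 < C₁ := hB0.trans_le hC₁B
  refine ⟨n * (4 ^ β * (4 * B * (B ^ (β - 1) * C₁))), ?_⟩
  intro Ω ft S u v hΩ hbdd hdiam hu huc hu0 hu1 hκ hS hft hσ hft1 hft2 hv hvc hv0 hv1 hv2 hvD hlt
    hfr xs hxs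
  -- The barrier is mollified with error at most `δ` and lowered by `2 δ`. Then `ψ - u ≥ δ` remains
  -- at `xs`, while away from the boundary `ψ - u ≥ 0` forces `v - u ≥ δ`, which keeps the maximum
  -- inside `Ω`.
  obtain ⟨δ, hδ⟩ : ∃ δ : ℝ, δ = (v xs - u xs) / 4 := ⟨_, rfl⟩
  have hδ0 : 0 < δ := by have := hlt xs hxs; rw [hδ]; linarith
  obtain ⟨ε, hε⟩ : ∃ ε : ℝ, ε = δ / (2 * L) := ⟨_, rfl⟩
  have hε0 : 0 < ε := by rw [hε]; positivity
  have hεL : L * ε = δ / 2 := by rw [hε]; field_simp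
  obtain ⟨ψ₀, hψ₀, hψ₀'⟩ := exists_mollification hΩ hv hv0 hv1 hv2 hε0
  set ψ : E → ℝ := fun x => ψ₀ x - 2 * δ with hψ
  have hψc : ContDiff ℝ 2 ψ := hψ₀.sub contDiff_const
  have hfψ : fderiv ℝ ψ = fderiv ℝ ψ₀ := by
    funext x
    exact fderiv_sub_const (𝕜 := ℝ) (2 * δ)
  have hvd : ∀ x ∈ Ω, DifferentiableAt ℝ v x := fun x hx =>
    (hv.contDiffAt (hΩ.mem_nhds hx)).differentiableAt one_ne_zero
  have hud : ∀ x ∈ Ω, DifferentiableAt ℝ u x := fun x hx => (hu x hx).differentiableAt (by norm_num)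
  have hslope : ∀ x ∈ Ω, slope u x ≤ 1 + Ku := fun x hx => slope_le (hu1 x hx)
  have hslopeB : ∀ x ∈ Ω, slope u x ≤ B := fun x hx => (hslope x hx).trans (by rw [hB]; linarith)
  have hz : ∀ x ∈ Ω, ‖x - xs‖ + |u x| ≤ B := fun x hx => by
    have h1 := (dist_le_diam_of_mem hbdd hx hxs).trans hdiam
    rw [dist_eq_norm] at h1
    have := hu0 x hx
    rw [hB]; linarith
  have hball : ∀ x ∈ Ω, ball x ((v x - u x) / L) ⊆ Ω := fun x hx =>
    ball_subset_of_fderiv_le (w := fun x => v x - u x) hΩ (hvc.sub huc)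
      (fun y hy => (hvd y hy).sub (hud y hy)) hL0
      (fun y hy => by
        have e : fderiv ℝ (fun x => v x - u x) y = fderiv ℝ v y - fderiv ℝ u y :=
          fderiv_fun_sub (hvd y hy) (hud y hy)
        rw [e]
        have h1 := norm_sub_le (fderiv ℝ v y) (fderiv ℝ u y)
        have h2 := hv1 y hy
        have h3 := hu1 y hy
        rw [hL]; linarith)
      (fun y hy => by rw [hfr y hy, sub_self]) hx
  have hψv : ∀ x, ball x ε ⊆ Ω → |ψ₀ x - v x| ≤ δ := fun x hx => by
    refine (hψ₀' x hx).1.trans ?_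
    have : Kv * ε ≤ L * ε := by gcongr; rw [hL]; linarith
    linarith
  set K : Set E := {x ∈ closure Ω | δ ≤ v x - u x ∧ 0 ≤ ψ x - u x} with hK
  have hKΩ : K ⊆ Ω := fun x hx => by
    by_contra hc
    have h1 := hfr x ⟨hx.1, fun h => hc (interior_subset h)⟩
    have h2 := hx.2.1
    rw [h1, sub_self] at h2
    linarith
  have hKc : IsCompact K := by
    have h1 := (hvc.sub huc).preimage_isClosed_of_isClosed isClosed_closure
      (isClosed_Ici (a := δ))
    have h2 := (hψc.continuous.continuousOn.sub huc).preimage_isClosed_of_isClosed isClosed_closure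
      (isClosed_Ici (a := (0 : ℝ)))
    have h3 : K = (closure Ω ∩ (v - u) ⁻¹' Set.Ici δ) ∩
        (closure Ω ∩ (ψ - u) ⁻¹' Set.Ici 0) := by
      ext x
      simp only [hK, Set.mem_sep_iff, Set.mem_inter_iff, Set.mem_preimage, Set.mem_Ici,
        Pi.sub_apply]
      tauto
    rw [h3]
    exact isCompact_of_isClosed_isBounded (h1.inter h2)
      (hbdd.closure.subset fun x hx => hx.1.1)
  have hmemK : ∀ x ∈ Ω, ball x ε ⊆ Ω → 0 ≤ ψ x - u x → x ∈ K := fun x hx hxb hη => by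
    have h1 := (abs_le.1 (hψv x hxb)).2
    refine ⟨subset_closure hx, ?_, hη⟩
    simp only [hψ] at hη
    linarith
  have hballε : ∀ x ∈ Ω, δ ≤ v x - u x → ball x ε ⊆ Ω := fun x hx hδx =>
    (ball_subset_ball (by
      rw [le_div_iff₀ hL0]; linarith)).trans (hball x hx)
  have hηs : δ ≤ ψ xs - u xs := by
    have h1 := (abs_le.1 (hψv xs (hballε xs hxs (by linarith)))).1
    simp only [hψ]
    linarith
  have hxsK : xs ∈ K := ⟨subset_closure hxs, by linarith, by linarith⟩
  obtain ⟨x₀, hx₀K, o, ho, hmaxo, hmax⟩ := exists_max_testWeight (β := β) (z := xs) hKc hxsK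
    (fun x hx => hu x (hKΩ hx)) (fun x hx => hκ x (hKΩ hx)) hψc.continuous (fun x hx => hx.2.2) hB1
    (fun x hx => hslopeB x (hKΩ hx)) (fun x hx => hz x (hKΩ hx))
  have hx₀ : x₀ ∈ Ω := hKΩ hx₀K
  set η := ψ x₀ - u x₀ with hη
  have hW₀ := testWeight_bounds hB1 (hslopeB x₀ hx₀) (hz x₀ hx₀) hx₀K.2.2 β
  have hWs := testWeight_bounds hB1 (hslopeB xs hxs) (hz xs hxs) hxsK.2.2 β
  have hWs0 : δ ^ β ≤ testWeight u ψ β B xs xs := by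
    refine le_trans ?_ hWs.1
    gcongr
  obtain ⟨bs, hbs, hbsd⟩ :=
    exists_frame (contDiffAt_hess_isHermitian ((hu xs hxs).of_le (by norm_num)))
  have hfin : ∀ i, testWeight u ψ β B xs xs * principalCurvatures u xs i ≤
      η ^ β * (4 * B) * principalCurvatures u x₀ o := fun i => by
    have h1 := hmax xs hxsK (bs i) (hbs.ne_zero i)
    rw [normalCurvature_frame hbs hbsd] at h1
    exact h1.trans (mul_le_mul_of_nonneg_right hW₀.2 ho.le)
  have hη0 : 0 < η := by
    refine lt_of_le_of_ne hx₀K.2.2 fun h => ?_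
    obtain ⟨i, hi⟩ := (hκ xs hxs).exists_pos
    have h1 := hfin i
    rw [← h, zero_pow (by omega), zero_mul, zero_mul] at h1
    have h2 : 0 < testWeight u ψ β B xs xs := (pow_pos hδ0 β).trans_le hWs0
    exact absurd h1 (not_le.2 (mul_pos h2 hi))
  have hηle : η ≤ v x₀ - u x₀ - δ := by
    have h1 := (abs_le.1 (hψv x₀ (hballε x₀ hx₀ hx₀K.2.1))).2
    rw [hη]; simp only [hψ]
    linarith
  have hηB : η ≤ B := by
    have h1 := (abs_le.1 (hv0 x₀ hx₀)).2
    have h2 := (abs_le.1 (hu0 x₀ hx₀)).1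
    rw [hB]; linarith
  -- Both `v - u` and `ψ - u` vary at rate at most `L`, so on this ball `ψ - u ≥ η / 2`, and
  -- `ε`-balls around its points stay in `Ω`.
  obtain ⟨r, hr⟩ : ∃ r : ℝ, r = η / (4 * L) := ⟨_, rfl⟩
  have hr0 : 0 < r := by rw [hr]; positivity
  have hrL : L * r = η / 4 := by rw [hr]; field_simp
  have hnear : ∀ y ∈ closedBall x₀ r, ball y ε ⊆ Ω := fun y hy => by
    refine (ball_subset_ball' ?_).trans (hball x₀ hx₀)
    rw [mem_closedBall] at hy
    rw [le_div_iff₀ hL0, add_mul, mul_comm ε, mul_comm _ L]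
    have h1 := mul_le_mul_of_nonneg_left hy hL0.le
    linarith
  have hnearΩ : closedBall x₀ r ⊆ Ω := fun y hy => hnear y hy (mem_ball_self hε0)
  have hnearη : ∀ y ∈ closedBall x₀ r, η / 2 ≤ ψ y - u y := fun y hy => by
    have h1 := (convex_closedBall x₀ r).norm_image_sub_le_of_norm_fderiv_le
      (f := fun x => ψ x - u x) (C := L)
      (fun w hw => ((hψc.differentiable (by norm_num)) w).sub (hud w (hnearΩ hw)))
      (fun w hw => by
        have e : fderiv ℝ (fun x => ψ x - u x) w = fderiv ℝ ψ w - fderiv ℝ u w :=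
          fderiv_fun_sub ((hψc.differentiable (by norm_num)) w) (hud w (hnearΩ hw))
        rw [e, hfψ]
        have h1 := norm_sub_le (fderiv ℝ ψ₀ w) (fderiv ℝ u w)
        have h2 := (hψ₀' w (hnear w hw)).2.1
        have h3 := hu1 w (hnearΩ hw)
        rw [hL]; linarith) (mem_closedBall_self hr0.le) hy
    rw [mem_closedBall_iff_norm] at hy
    have h2 : L * ‖y - x₀‖ ≤ L * r := by gcongr
    have h3 := (abs_le.1 (h1.trans h2)).1
    linarith
  have hnearK : closedBall x₀ r ⊆ K := fun y hy =>
    hmemK y (hnearΩ hy) (hnear y hy) (by have := hnearη y hy; linarith)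
  have hκη : principalCurvatures u x₀ o * η ≤ C₁ := by
    rcases lt_or_ge (principalCurvatures u x₀ o) 1 with h1 | h1
    · exact (mul_le_of_le_one_left hη0.le h1.le).trans (hηB.trans hC₁B)
    rcases le_or_gt (principalCurvatures u x₀ o * η) (4 * L) with h2 | h2
    · exact h2.trans hC₁L
    refine le_trans ?_ hC₁C
    obtain ⟨b, hb, hbd⟩ :=
      exists_frame (contDiffAt_hess_isHermitian ((hu x₀ hx₀).of_le (by norm_num)))
    set κo := principalCurvatures u x₀ o with hκo
    -- Maximality of the test function at `x₀` bounds the curvature on the whole ball, so the second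
    -- derivatives of `u` there are of size `κo`.
    have hcurv : ∀ y ∈ closedBall x₀ r, ∀ ξ : E, ξ ≠ 0 → normalCurvature u y ξ ≤ Λ * κo := by
      intro y hy ξ hξ
      rcases le_or_gt (normalCurvature u y ξ) 0 with h3 | h3
      · exact h3.trans (by positivity)
      have h4 := hmax y (hnearK hy) ξ hξ
      have h5 := hnearη y hy
      have h6 := (testWeight_bounds hB1 (hslopeB y (hnearΩ hy)) (hz y (hnearΩ hy))
        (hnearK hy).2.2 β).1
      have h7 : (η / 2) ^ β * normalCurvature u y ξ ≤ η ^ β * (4 * B) * κo := by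
        calc (η / 2) ^ β * normalCurvature u y ξ
            ≤ (ψ y - u y) ^ β * normalCurvature u y ξ := by gcongr
          _ ≤ testWeight u ψ β B xs y * normalCurvature u y ξ := by gcongr
          _ ≤ testWeight u ψ β B xs x₀ * κo := h4
          _ ≤ η ^ β * (4 * B) * κo := mul_le_mul_of_nonneg_right hW₀.2 ho.le
      rw [div_pow, div_mul_eq_mul_div, div_le_iff₀ (by positivity)] at h7
      have h8 : η ^ β * normalCurvature u y ξ ≤ η ^ β * (Λ * κo) := by
        refine h7.trans (le_of_eq ?_)
        rw [hΛ]; ring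
      exact le_of_mul_le_mul_left h8 (by positivity)
    have hgo : fderiv ℝ ft (x₀, u x₀) (b o, fderiv ℝ u x₀ (b o)) ^ 2 ≤
        B' * κo * ft (x₀, u x₀) := by
      have hft0 := (hft x₀ hx₀).2
      have h3 := sq_fderiv_le_of_pos (N := N₂ * κo) (N₁ := N₁ * κo) (K := Kf) (Ku := Ku)
        hu hKf0 hKu0 hu1 hS hft hft1 hft2 hr0 hnearΩ (hb.norm_le_one o) (fun y hy => by
          have h4 := abs_snd_fderiv_le ((hu y (hnearΩ hy)).of_le (by norm_num)) (hκ y (hnearΩ hy))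
            (by positivity) (hcurv y hy) (b o)
          refine h4.trans ?_
          have h5 := hslope y (hnearΩ hy)
          have h6 : ‖b o‖ ^ 2 ≤ 1 := pow_le_one₀ (norm_nonneg _) (hb.norm_le_one o)
          have h7 : ⟪gradVec u y, b o⟫ ^ 2 ≤ Ku ^ 2 := by
            refine sq_le_sq' ?_ ?_ <;>
            · have h8 := (abs_real_inner_le_norm (gradVec u y) (b o)).trans
                (mul_le_of_le_one_right (norm_nonneg _) (hb.norm_le_one o))
              have h9 := abs_le.1 (h8.trans ((norm_gradVec_le u y).trans (hu1 y (hnearΩ hy))))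
              linarith
          calc slope u y * (n * (Λ * κo)) * (‖b o‖ ^ 2 + ⟪gradVec u y, b o⟫ ^ 2)
              ≤ (1 + Ku) * (n * (Λ * κo)) * (1 + Ku ^ 2) := by gcongr
            _ = N₁ * κo := by rw [hN₁]; ring) (by positivity)
        (by
          have e1 : (Kf : ℝ) * (1 + Ku) ^ 2 ≤ Kf * (1 + Ku) ^ 2 * κo :=
            le_mul_of_one_le_right (by positivity) h1
          have e2 : 0 ≤ ((1 + Ku : ℝ) ^ 2 + N₁) * κo := by positivity
          rw [hN₂]
          linarith)
      rcases h3 with h3 | h3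
      · refine h3.trans ?_
        have : 4 * (N₂ * κo) ≤ B' * κo := by
          rw [hB', ← mul_assoc, add_mul]
          exact le_add_of_nonneg_right (by positivity)
        gcongr
      -- In the alternative `N * r² ≤ ft`, the assumption `κo * η > 4 L` gives `κo * r ≥ 1`, hence
      -- `κo * ft ≥ 1`, and the plain bound `Kf` on the gradient suffices.
      · have h4 : 1 ≤ κo * r := by
          have e1 : κo * r = κo * η / (4 * L) := by rw [hr]; ring
          rw [e1, le_div_iff₀ (by positivity)]; linarith
        have h5 : 1 ≤ κo * ft (x₀, u x₀) := by
          calc (1 : ℝ) ≤ N₂ * (κo * r) ^ 2  :=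
                one_le_mul_of_one_le_of_one_le hN₂1 (one_le_pow₀ h4)
            _ = κo * (N₂ * κo * r ^ 2) := by ring
            _ ≤ κo * ft (x₀, u x₀) := by gcongr
        have h6 : fderiv ℝ ft (x₀, u x₀) (b o, fderiv ℝ u x₀ (b o)) ^ 2 ≤ Kf ^ 2 := by
          have e1 : ‖(b o, fderiv ℝ u x₀ (b o))‖ ≤ 1 := by
            rw [Prod.norm_def, fderiv_eq_inner]
            exact max_le (hb.norm_le_one o) (hb.abs_inner_le_one o)
          have e2 := ((fderiv ℝ ft (x₀, u x₀)).le_opNorm _).trans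
            ((mul_le_of_le_one_right (norm_nonneg _) e1).trans (hft1 _ (hS x₀ hx₀)))
          rw [Real.norm_eq_abs] at e2
          exact sq_le_sq' (abs_le.1 e2).1 (abs_le.1 e2).2
        calc _ ≤ (Kf : ℝ) ^ 2 := h6
          _ ≤ Kf ^ 2 * (κo * ft (x₀, u x₀)) := le_mul_of_one_le_right (by positivity) h5
          _ ≤ B' * (κo * ft (x₀, u x₀)) := by
              gcongr
              rw [hB']; linarith
          _ = _ := by ring
    refine hC₀ u ψ x₀ xs ft S b o (hu x₀ hx₀) hψc.contDiffAt ?_ ?_ ?_ (hκ x₀ hx₀) hb hbd ho hgo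
      hη0 hηB ?_ (hz x₀ hx₀) (hslopeB x₀ hx₀) ?_ ?_
    · filter_upwards [hΩ.mem_nhds hx₀] with x hx
      exact ⟨hS x hx, (hft x hx).1, (hft x hx).2, hσ x hx⟩
    · intro p hp q hq
      refine (hft2 p hp q hq).trans ?_
      gcongr
      rw [hB]; linarith
    · exact (hft1 _ (hS x₀ hx₀)).trans (by rw [hB]; linarith)
    · have := (hψ₀' x₀ (hballε x₀ hx₀ hx₀K.2.1)).2.1
      rw [hfψ, hB]; linarith
    · rw [hfψ]
      exact (hψ₀' x₀ (hballε x₀ hx₀ hx₀K.2.1)).2.2 _ b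
        (hvD _ _ b (hκ x₀ hx₀) hb)
    · filter_upwards [closedBall_mem_nhds x₀ hr0] with x hx using hmax x (hnearK hx)
  have hm0 : 0 < v xs - u xs := sub_pos.2 (hlt xs hxs)
  rw [mul_div_assoc]
  refine secondFundFormNorm_le ((hu xs hxs).of_le (by norm_num)) (hκ xs hxs) (by positivity)
    fun i => ?_
  rcases le_or_gt (principalCurvatures u xs i) 0 with h1 | h1
  · exact h1.trans (by positivity)
  rw [le_div_iff₀ (by positivity)]
  -- The maximal value is at most `4 B * η ^ β * κ_o`. One factor `η` goes into the bound for `κ_o *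
  -- η`, the others are bounded by `B`.
  have h2 : δ ^ β * principalCurvatures u xs i ≤ 4 * B * (B ^ (β - 1) * C₁) := by
    calc δ ^ β * principalCurvatures u xs i
        ≤ testWeight u ψ β B xs xs * principalCurvatures u xs i := by gcongr
      _ ≤ η ^ β * (4 * B) * principalCurvatures u x₀ o := hfin i
      _ = 4 * B * (η ^ (β - 1) * (principalCurvatures u x₀ o * η)) := by
          have : η ^ β = η ^ (β - 1) * η := by
            rw [← pow_succ]; congr 1; omega
          rw [this]; ring
      _ ≤ _ := by gcongr
  have h3 : (v xs - u xs) ^ β = 4 ^ β * δ ^ β := by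
    rw [← mul_pow, hδ]; congr 1; ring
  rw [h3]
  calc principalCurvatures u xs i * (4 ^ β * δ ^ β)
      = 4 ^ β * (δ ^ β * principalCurvatures u xs i) := by ring
    _ ≤ _ := by gcongr

end InteriorEstimate

end KCurvature

namespace KCurvature

open Finset Filter Topology Metric MeasureTheory

/-! ### The barrier under the two convexity hypotheses -/

section Barrier

variable {n : ℕ}

local notation "E" => EuclideanSpace ℝ (Fin n)

lemma ae_differentiableAt_fderiv {Ω : Set E} (hΩ : IsOpen Ω) {v : E → ℝ} {K : ℝ≥0}
    (h : ∀ x ∈ Ω, ∀ y ∈ Ω, ‖fderiv ℝ v x - fderiv ℝ v y‖ ≤ K * ‖x - y‖) :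
    ∀ᵐ y ∂(volume.restrict Ω), DifferentiableAt ℝ (fderiv ℝ v) y := by
  rw [ae_restrict_iff' hΩ.measurableSet]
  have hl : LipschitzOnWith K (fderiv ℝ v) Ω :=
    lipschitzOnWith_iff_norm_sub_le.2 fun x hx y hy => h x hx y hy
  filter_upwards [hl.ae_differentiableWithinAt_of_mem (μ := volume)] with y hy hyΩ
  exact (hy hyΩ).differentiableAt (hΩ.mem_nhds hyΩ)

lemma hasJet_line {v : E → ℝ} {y : E} (h1 : ∀ᶠ z in 𝓝 y, DifferentiableAt ℝ v z)
    (h2 : DifferentiableAt ℝ (fderiv ℝ v) y) (b : E) :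
    HasJet (fun t : ℝ => v (y + t • b)) (v y) (fderiv ℝ v y b)
      (fderiv ℝ (fderiv ℝ v) y b b) := by
  have hl : ∀ t : ℝ, HasDerivAt (fun t : ℝ => y + t • b) b t := fun t => by
    simpa using ((hasDerivAt_id t).smul_const b).const_add y
  have hl0 : Tendsto (fun t : ℝ => y + t • b) (𝓝 0) (𝓝 y) := by
    simpa using (hl 0).continuousAt.tendsto
  refine ⟨fun t => fderiv ℝ v (y + t • b) b, ?_, ?_, by simp, by simp⟩
  · filter_upwards [hl0.eventually h1] with t ht
    exact ht.hasFDerivAt.comp_hasDerivAt t (hl t)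
  · have h3 : HasFDerivAt (fderiv ℝ v) (fderiv ℝ (fderiv ℝ v) y) (y + (0 : ℝ) • b) := by
      simpa using h2.hasFDerivAt
    have h4 : HasDerivAt (fun t : ℝ => fderiv ℝ v (y + t • b)) (fderiv ℝ (fderiv ℝ v) y b) 0 :=
      h3.comp_hasDerivAt (0 : ℝ) (hl 0)
    simpa using h4.clm_apply (hasDerivAt_const (0 : ℝ) b)

lemma snd_fderiv_nonneg_of_isConvexIn {Ω : Set E} (hΩ : IsOpen Ω) {v : E → ℝ}
    (hd : ∀ x ∈ Ω, DifferentiableAt ℝ v x) (hc : IsConvexIn Ω v) {y : E} (hy : y ∈ Ω)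
    (h2 : DifferentiableAt ℝ (fderiv ℝ v) y) (b : E) :
    0 ≤ fderiv ℝ (fderiv ℝ v) y b b := by
  obtain ⟨r, hr, hball⟩ := Metric.isOpen_iff.1 hΩ y hy
  obtain ⟨-, hconv⟩ := hc _ hball (convex_ball y r)
  have hj := hasJet_line (by filter_upwards [hΩ.mem_nhds hy] with z hz using hd z hz) h2 b
  have hl0 : Tendsto (fun t : ℝ => y + t • b) (𝓝 0) (𝓝 y) := by
    have : Continuous fun t : ℝ => y + t • b := by fun_prop
    simpa using this.tendsto 0
  have hl1 : Tendsto (fun t : ℝ => y + (-t) • b) (𝓝 0) (𝓝 y) := by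
    have : Continuous fun t : ℝ => y + (-t) • b := by fun_prop
    simpa using this.tendsto 0
  have := (hj.const_mul (-1)).nonpos_of_midpoint (by
    filter_upwards [hl0.eventually (ball_mem_nhds y hr), hl1.eventually (ball_mem_nhds y hr)]
      with t ht ht'
    have h3 := hconv ht ht' (show (0 : ℝ) ≤ 1 / 2 by norm_num) (show (0 : ℝ) ≤ 1 / 2 by norm_num)
      (by norm_num)
    have e : (1 / 2 : ℝ) • (y + t • b) + (1 / 2 : ℝ) • (y + (-t) • b) = y := by module
    rw [e] at h3
    simp only [smul_eq_mul, zero_smul, add_zero] at h3 ⊢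
    linarith)
  linarith

/-- The barrier is a subsolution of the linearised operator. -/
lemma ae_sum_mul_snd_fderiv_nonneg {k : ℕ} (hn : k + 2 ≤ n) {Ω : Set E} (hΩ : IsOpen Ω) {v : E → ℝ}
    {K : ℝ≥0} (hd : ∀ x ∈ Ω, DifferentiableAt ℝ v x)
    (h : ∀ x ∈ Ω, ∀ y ∈ Ω, ‖fderiv ℝ v x - fderiv ℝ v y‖ ≤ K * ‖x - y‖)
    (h1 : k + 2 < n → IsMConvex (k + 3) Ω v) (h2 : k + 2 = n → IsConvexIn Ω v)
    {κ : Fin n → ℝ} {p : E} {b : Fin n → E} (hκ : InCone univ (k + 2) κ) (hb : IsFrame p b) :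
    ∀ᵐ y ∂(volume.restrict Ω),
      0 ≤ ∑ i, es (univ.erase i) (k + 1) κ * fderiv ℝ (fderiv ℝ v) y (b i) (b i) := by
  rcases hn.lt_or_eq with hlt | heq
  · filter_upwards [ae_differentiableAt_fderiv hΩ h, h1 hlt, ae_restrict_mem hΩ.measurableSet]
      -- For order `k + 2 < n` the `(k + 3)`-convexity allows for the one order lost in restricting
      -- to the tangent hyperplane.
      with y hy hcy hyΩ
    have := hb.sum_mul_nonneg hκ (hess_isHermitian
      (by filter_upwards [hΩ.mem_nhds hyΩ] with z hz using hd z hz) hy) hcy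
    simpa only [snd_fderiv_eq_sum] using this
  · filter_upwards [ae_differentiableAt_fderiv hΩ h, ae_restrict_mem hΩ.measurableSet]
      with y hy hyΩ
    exact sum_nonneg fun i _ => mul_nonneg ((hκ.erase (mem_univ i)) _ le_rfl).le
      (snd_fderiv_nonneg_of_isConvexIn hΩ hd (h2 heq) hyΩ hy (b i))

end Barrier

lemma mem_rangeInterval {n : ℕ} {Ω : Set (EuclideanSpace ℝ (Fin n))} (hb : Bornology.IsBounded Ω)
    {u : EuclideanSpace ℝ (Fin n) → ℝ} (hu : ContinuousOn u (closure Ω))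
    {x : EuclideanSpace ℝ (Fin n)} (hx : x ∈ Ω) : u x ∈ rangeInterval Ω u := by
  have hc := (hb.isCompact_closure).image_of_continuousOn hu
  have hm := Set.mem_image_of_mem u (subset_closure hx)
  exact ⟨csInf_le hc.bddBelow hm, le_csSup hc.bddAbove hm⟩

lemma rootFun_pow {n k : ℕ} {f : EuclideanSpace ℝ (Fin n) → ℝ → ℝ}
    {p : EuclideanSpace ℝ (Fin n) × ℝ} (hp : 0 < f p.1 p.2) :
    0 < rootFun (k + 2) f p ∧ rootFun (k + 2) f p ^ (k + 1) = f p.1 p.2 := by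
  refine ⟨Real.rpow_pos_of_pos hp _, ?_⟩
  have e : 1 / (((k + 2 : ℕ) : ℝ) - 1) = ((k + 1 : ℕ) : ℝ)⁻¹ := by
    push_cast
    rw [one_div]
    congr 1
    ring
  rw [rootFun, e, Real.rpow_inv_natCast_pow hp.le (by omega)]

end KCurvature

theorem theorem1p1 (n k : ℕ) (hk : 2 ≤ k) (hkn : k ≤ n) (D Ku Kv Kf : ℝ≥0) :
    ∃ C : ℝ, ∀ (Ω : Set (EuclideanSpace ℝ (Fin n)))
      (f : EuclideanSpace ℝ (Fin n) → ℝ → ℝ)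
      (φ u v : EuclideanSpace ℝ (Fin n) → ℝ),
      -- `Ω` is a bounded domain
      IsOpen Ω → IsConnected Ω → Bornology.IsBounded Ω → Metric.diam Ω ≤ D →
      -- `f > 0` and `f^{1/(k-1)}` is `C^{1,1}` on `closure Ω × ℝ` (locally uniformly in `z`)
      (∀ x ∈ Ω, ∀ z : ℝ, 0 < f x z) →
      KCurvature.IsC1UpToBoundary (Ω ×ˢ (Set.univ : Set ℝ)) (KCurvature.rootFun k f) →
      (∀ a b : ℝ, KCurvature.c11Norm (Ω ×ˢ Set.Icc a b) (KCurvature.rootFun k f) < ⊤) →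
      -- `u` is an admissible solution of the Dirichlet problem
      ContDiffOn ℝ 4 u Ω → KCurvature.IsC1UpToBoundary Ω u →
      KCurvature.IsAdmissible k Ω u →
      (∀ x ∈ Ω, KCurvature.sigma k (KCurvature.principalCurvatures u x) = f x (u x)) →
      (∀ x ∈ frontier Ω, u x = φ x) →
      -- the upper barrier `v`
      KCurvature.IsC1UpToBoundary Ω v → KCurvature.c11Norm Ω v < ⊤ →
      (k < n → KCurvature.IsMConvex (k + 1) Ω v) → (k = n → KCurvature.IsConvexIn Ω v) →
      (∀ x ∈ Ω, u x < v x) → (∀ x ∈ frontier Ω, v x = u x) →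
      -- the quantities on which `C` may depend
      KCurvature.c1Norm Ω u ≤ Ku → KCurvature.c11Norm Ω v ≤ Kv →
      KCurvature.c11Norm (Ω ×ˢ KCurvature.rangeInterval Ω u) (KCurvature.rootFun k f) ≤ Kf →
      ∀ x ∈ Ω, KCurvature.secondFundFormNorm u x ≤ C / (v x - u x) ^ (max 3 (k - 1)) := by
  -- From here the order is `k + 2`, so the root has exponent `1 / (k + 1)` and the power in the
  -- estimate is `max 3 (k + 1)`.
  obtain ⟨k, rfl⟩ := Nat.exists_eq_add_of_le' hk
  obtain ⟨C, hC⟩ := KCurvature.interior_curvature_estimate k hkn D Ku Kv Kf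
  refine ⟨C, ?_⟩
  intro Ω f φ u v hΩ _ hbdd hdiam hf hft _ hu hu1 hadm hσ _ hv hv11 hvM hvC hlt hfr hKu hKv hKf
  have hfτ := (KCurvature.c1Norm_le_c11Norm _ _).trans hKf
  have hvτ := (KCurvature.c1Norm_le_c11Norm _ _).trans hKv
  have hS : ∀ x ∈ Ω, (x, u x) ∈ Ω ×ˢ KCurvature.rangeInterval Ω u := fun x hx =>
    ⟨hx, KCurvature.mem_rangeInterval hbdd hu1.2.1 hx⟩
  have hvd : ∀ x ∈ Ω, DifferentiableAt ℝ v x := fun x hx =>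
    (hv.1.contDiffAt (hΩ.mem_nhds hx)).differentiableAt one_ne_zero
  have hvl : ∀ x ∈ Ω, ∀ y ∈ Ω, ‖fderiv ℝ v x - fderiv ℝ v y‖ ≤ Kv * ‖x - y‖ :=
    fun x hx y hy => KCurvature.norm_fderiv_sub_le_of_c11Norm_le hKv hx hy
  refine hC Ω (KCurvature.rootFun (k + 2) f) (Ω ×ˢ KCurvature.rangeInterval Ω u) u v hΩ hbdd hdiam
    (fun x hx => hu.contDiffAt (hΩ.mem_nhds hx)) hu1.2.1
    (fun x hx => (KCurvature.bounds_of_c1Norm_le hKu hx).1)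
    (fun x hx => (KCurvature.bounds_of_c1Norm_le hKu hx).2)
    -- Positivity of `f` moves the curvatures from the closed cone into the open one; no
    -- quantitative bound is extracted.
    (fun x hx => KCurvature.inCone_of_mem_closure (hadm.2 x hx) ?_) hS
    (fun x hx => ⟨?_, (KCurvature.rootFun_pow (hf x hx (u x))).1⟩)
    (fun x hx => ?_)
    (fun p hp => (KCurvature.bounds_of_c1Norm_le hfτ hp).2)
    (fun p hp q hq => KCurvature.norm_fderiv_sub_le_of_c11Norm_le hKf hp hq) hv.1 hv.2.1
    (fun x hx => (KCurvature.bounds_of_c1Norm_le hvτ hx).1)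
    (fun x hx => (KCurvature.bounds_of_c1Norm_le hvτ hx).2) hvl
    (fun κ p b hκ hb =>
      KCurvature.ae_sum_mul_snd_fderiv_nonneg hkn hΩ hvd hvl hvM hvC hκ hb) hlt hfr
  · rw [hσ x hx]
    exact hf x hx (u x)
  · exact (hft.1.contDiffAt ((hΩ.prod isOpen_univ).mem_nhds ⟨hx, trivial⟩)).differentiableAt
      one_ne_zero
  · rw [hσ x hx, (KCurvature.rootFun_pow (hf x hx (u x))).2]
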